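/- Let $E$ be a locally compact separable metric space and $m$ a Radon measure on $E$ with full support. Let $(\mathcal E,\mathcal D(\mathcal E))$ be a regular Dirichlet form on $L^2(E,m)$ that is pure-jump with a jumping kernel $J(x,dy)$, that is, $J(dx,dy)=J(x,dy)\,m(dx)$ is a symmetric Radon measure on $\{(x,y)\in E\times E: x\ne y\}$ and $$\mathcal E(u,v)=\frac12\iint_{x\neq y}(u(y)-u(x))(v(y)-v(x))\,J(dx,dy),\qquad u,v\in\mathcal D(\mathcal E).$$ Let $P_tf(x)=\int_E f(y)\,P_t(x,dy)$ be the semigroup associated with $\mathcal E$, where $P_t(x,dy)$ is an $m$-symmetric sub-Markovian transition function with $P_0(x,\cdot)=\delta_x$ that is jointly measurable in $(t,x)$ (for instance, that of the symmetric Hunt process associated with $\mathcal E$). Association means that $\mathcal D(\mathcal E)$ is the set of $u\in L^2(E,m)$ for which $\lim_{t\to0^+}\frac1t\int_E(u-P_tu)u\,dm$ exists and is finite, and that $\mathcal E(u,v)=\lim_{t\to0^+}\frac1t\int_E(u-P_tu)v\,dm$ for $u,v\in\mathcal D(\mathcal E)$. Define $$G(x)=\Big(\frac12\int_0^\infty\int_{E\setminus\{x\}}(P_tf(y)-P_tf(x))^2\,J(x,dy)\,dt\Big)^{1/2},$$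 $$\widetilde G(x)=\Big(\int_0^\infty\int_{E\setminus\{x\}}(P_tf(y)-P_tf(x))^2\,\chi(P_tf(x),P_tf(y))\,J(x,dy)\,dt\Big)^{1/2},$$ where $\chi(s,t)=\mathbf 1_{\{|s|>|t|\}}+\frac12\mathbf 1_{\{|s|=|t|\}}$; both functions take values in $[0,\infty]$. Let $2\le p<\infty$. There is a constant $C_p>0$, depending only on $p$, such that, for all $E$, $m$, $\mathcal E$, $J$, $(P_t)$ as above for which strong stability holds, that is, $\lim_{T\to\infty}\|P_Tg\|_p=0$ for every $g\in L^p(E,m)$, and for every $f\in L^p(E,m)$, $$\|f\|_p\le C_p\,\|\widetilde G\|_p,\qquad\text{and, if } p>2,\text{ also}\qquad \|f\|_p\le C_p\,\|G\|_p .$$ -/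

import Mathlib

open MeasureTheory ProbabilityTheory Filter Topology
open scoped NNReal ENNReal

noncomputable section

/-- A (symmetric) Dirichlet form `(𝓔, D(𝓔))` on the real space `L²(E, m)`: a densely defined,
symmetric, nonnegative, closed bilinear form on which the unit contraction operates. -/
structure DirichletForm {E : Type*} [MeasurableSpace E] (m : Measure E) where
  /-- The domain `D(𝓔) ⊆ L²(E, m)`. -/
  domain : Submodule ℝ (Lp ℝ 2 m)
  /-- The bilinear form `𝓔(u, v)`. -/
  form : domain →ₗ[ℝ] domain →ₗ[ℝ] ℝ
  dense : Dense (domain : Set (Lp ℝ 2 m))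
  symm : ∀ u v : domain, form u v = form v u
  nonneg : ∀ u : domain, 0 ≤ form u u
  /-- Closedness: `D(𝓔)` is complete for the norm `(𝓔(u, u) + ‖u‖₂²)^(1/2)`. -/
  closed : ∀ u : ℕ → domain,
    (∀ ε : ℝ, 0 < ε → ∃ N : ℕ, ∀ j ≥ N, ∀ k ≥ N,
      form (u j - u k) (u j - u k) + ‖((u j - u k : domain) : Lp ℝ 2 m)‖ ^ 2 < ε) →
    ∃ v : domain, Tendsto
      (fun k => form (u k - v) (u k - v) + ‖((u k - v : domain) : Lp ℝ 2 m)‖ ^ 2) atTop (𝓝 0)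
  /-- Markov property: if `u ∈ D(𝓔)` and `v = (0 ∨ u) ∧ 1`, then `v ∈ D(𝓔)` and
  `𝓔(v, v) ≤ 𝓔(u, u)`. -/
  markov : ∀ (u : domain) (v : Lp ℝ 2 m),
    (v =ᵐ[m] fun x => min (max 0 ((u : Lp ℝ 2 m) x)) 1) →
    ∃ hv : v ∈ domain, form ⟨v, hv⟩ ⟨v, hv⟩ ≤ form u u

/-- `φ` is a continuous function with compact support. -/
def IsCc {E : Type*} [TopologicalSpace E] (φ : E → ℝ) : Prop :=
  Continuous φ ∧ HasCompactSupport φ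

/-- Regularity of a Dirichlet form: `D(𝓔) ∩ C_c(E)` is dense in `D(𝓔)` for the norm
`(𝓔(u, u) + ‖u‖₂²)^(1/2)` and dense in `C_c(E)` for the uniform norm. -/
structure DirichletForm.IsRegular {E : Type*} [TopologicalSpace E] [MeasurableSpace E]
    {m : Measure E} (𝓔 : DirichletForm m) : Prop where
  dense_domain : ∀ (u : 𝓔.domain) (ε : ℝ), 0 < ε →
    ∃ w : 𝓔.domain, (∃ φ : E → ℝ, IsCc φ ∧ ((w : Lp ℝ 2 m) : E → ℝ) =ᵐ[m] φ) ∧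
      𝓔.form (u - w) (u - w) + ‖((u - w : 𝓔.domain) : Lp ℝ 2 m)‖ ^ 2 < ε
  dense_Cc : ∀ φ : E → ℝ, IsCc φ → ∀ ε : ℝ, 0 < ε →
    ∃ ψ : E → ℝ, IsCc ψ ∧ (∃ w : 𝓔.domain, ((w : Lp ℝ 2 m) : E → ℝ) =ᵐ[m] ψ) ∧
      ∀ x, |φ x - ψ x| < ε

/-- The measure `J(dx, dy) = J(x, dy) m(dx)` on `E × E` off the diagonal. -/
def jumpMeasure {E : Type*} [MeasurableSpace E] (m : Measure E) (J : Kernel E E) :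
    Measure (E × E) :=
  (m ⊗ₘ J).restrict (Set.diagonal E)ᶜ

/-- `𝓔` is a pure-jump form with jumping kernel `J`: the measure `J(dx, dy) = J(x, dy) m(dx)` is a
symmetric Radon measure on `E × E` off the diagonal and
`𝓔(u, v) = 1/2 ∬_{x ≠ y} (u(y) - u(x)) (v(y) - v(x)) J(dx, dy)` for all `u, v ∈ D(𝓔)`.
Both marginals of `J(dx, dy)` are absolutely continuous with respect to `m` (the second one by
symmetry), so that the integral does not depend on the versions of `u` and `v`; in particular the
quasi-continuous versions give the same value. -/
structure DirichletForm.IsPureJump {E : Type*} [TopologicalSpace E] [MeasurableSpace E]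
    {m : Measure E} (𝓔 : DirichletForm m) (J : Kernel E E) : Prop where
  symm : (jumpMeasure m J).map Prod.swap = jumpMeasure m J
  radon : ∀ K : Set (E × E), IsCompact K → K ⊆ (Set.diagonal E)ᶜ → jumpMeasure m J K < ∞
  integrable : ∀ u v : 𝓔.domain, Integrable (fun z : E × E =>
    ((u : Lp ℝ 2 m) z.2 - (u : Lp ℝ 2 m) z.1) * ((v : Lp ℝ 2 m) z.2 - (v : Lp ℝ 2 m) z.1))
    (jumpMeasure m J)
  form_eq : ∀ u v : 𝓔.domain, 𝓔.form u v = 1 / 2 * ∫ z : E × E,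
    ((u : Lp ℝ 2 m) z.2 - (u : Lp ℝ 2 m) z.1) * ((v : Lp ℝ 2 m) z.2 - (v : Lp ℝ 2 m) z.1)
    ∂(jumpMeasure m J)

/-- `P (t, x) (dy) = P_t(x, dy)` is an `m`-symmetric sub-Markovian transition function on `E`,
jointly measurable in `(t, x)`. The transition function `P_t(x, A) = ℙ_x(X_t ∈ A)`, `A ⊆ E`, of an
`m`-symmetric Hunt process `X` (with its cemetery state outside of `E`) is an instance. -/
structure IsSymmTransitionFunction {E : Type*} [MeasurableSpace E] (m : Measure E)
    (P : Kernel (ℝ≥0 × E) E) : Prop where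
  sub_markov : ∀ t x, P (t, x) Set.univ ≤ 1
  zero : ∀ x, P (0, x) = Measure.dirac x
  chapman_kolmogorov : ∀ (s t : ℝ≥0) (x : E) (A : Set E), MeasurableSet A →
    P (s + t, x) A = ∫⁻ y, P (t, y) A ∂(P (s, x))
  symm : ∀ (t : ℝ≥0) (A B : Set E), MeasurableSet A → MeasurableSet B →
    ∫⁻ x in A, P (t, x) B ∂m = ∫⁻ x in B, P (t, x) A ∂m

/-- The semigroup `P_t f(x) = ∫ f(y) P_t(x, dy)` of a transition function. For `f ∈ L^p(E, m)` and an
`m`-symmetric sub-Markovian `P`, the integral converges absolutely for `m`-almost every `x`. -/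
def semigroup {E : Type*} [MeasurableSpace E] (P : Kernel (ℝ≥0 × E) E) (t : ℝ≥0) (f : E → ℝ)
    (x : E) : ℝ :=
  ∫ y, f y ∂(P (t, x))

/-- `𝓔` is the Dirichlet form of the semigroup `(P_t)`: `D(𝓔)` consists of those `u ∈ L²(E, m)` for
which `(1/t) ∫ (u - P_t u) u dm` has a finite limit as `t → 0+`, and
`𝓔(u, v) = lim_{t → 0+} (1/t) ∫ (u - P_t u) v dm` for `u, v ∈ D(𝓔)`. -/
structure DirichletForm.IsAssociated {E : Type*} [MeasurableSpace E] {m : Measure E}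
    (𝓔 : DirichletForm m) (P : Kernel (ℝ≥0 × E) E) : Prop where
  mem_domain_iff : ∀ u : Lp ℝ 2 m, u ∈ 𝓔.domain ↔
    ∃ l : ℝ, Tendsto (fun t : ℝ≥0 => 1 / (t : ℝ) * ∫ x, (u x - semigroup P t u x) * u x ∂m)
      (𝓝[>] 0) (𝓝 l)
  tendsto_form : ∀ u v : 𝓔.domain,
    Tendsto (fun t : ℝ≥0 => 1 / (t : ℝ) *
      ∫ x, ((u : Lp ℝ 2 m) x - semigroup P t (u : Lp ℝ 2 m) x) * (v : Lp ℝ 2 m) x ∂m)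
      (𝓝[>] 0) (𝓝 (𝓔.form u v))

/-- Strong stability on `L^p(E, m)`: `‖P_T f‖_p → 0` as `T → ∞` for every `f ∈ L^p(E, m)`. -/
def StronglyStable {E : Type*} [MeasurableSpace E] (m : Measure E) (P : Kernel (ℝ≥0 × E) E)
    (p : ℝ≥0∞) : Prop :=
  ∀ f : E → ℝ, MemLp f p m → Tendsto (fun T : ℝ≥0 => eLpNorm (semigroup P T f) p m) atTop (𝓝 0)

/-- `χ(s, t) = 1_{|s| > |t|} + (1/2) 1_{|s| = |t|}`. -/
def chi (s t : ℝ) : ℝ :=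
  if |t| < |s| then 1 else if |s| = |t| then 1 / 2 else 0

/-- The carré du champ `Γ[u](x) = (1/2) ∫_{E ∖ {x}} (u(y) - u(x))² J(x, dy)`. -/
def carreDuChamp {E : Type*} [MeasurableSpace E] (J : Kernel E E) (u : E → ℝ) (x : E) : ℝ≥0∞ :=
  2⁻¹ * ∫⁻ y in {x}ᶜ, ENNReal.ofReal ((u y - u x) ^ 2) ∂(J x)

/-- The modified carré du champ
`Γ̃[u](x) = ∫_{E ∖ {x}} (u(y) - u(x))² χ(u(x), u(y)) J(x, dy)`. -/
def modifiedCarreDuChamp {E : Type*} [MeasurableSpace E] (J : Kernel E E) (u : E → ℝ) (x : E) :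
    ℝ≥0∞ :=
  ∫⁻ y in {x}ᶜ, ENNReal.ofReal ((u y - u x) ^ 2 * chi (u x) (u y)) ∂(J x)

/-- The square function `G(x) = (∫_0^∞ Γ[P_t f](x) dt)^(1/2)`, with values in `[0, ∞]`. -/
def squareG {E : Type*} [MeasurableSpace E] (P : Kernel (ℝ≥0 × E) E) (J : Kernel E E)
    (f : E → ℝ) (x : E) : ℝ≥0∞ :=
  (∫⁻ t : ℝ in Set.Ioi 0, carreDuChamp J (semigroup P t.toNNReal f) x) ^ (1 / 2 : ℝ)

/-- The square function `G̃(x) = (∫_0^∞ Γ̃[P_t f](x) dt)^(1/2)`, with values in `[0, ∞]`. -/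
def squareGTilde {E : Type*} [MeasurableSpace E] (P : Kernel (ℝ≥0 × E) E) (J : Kernel E E)
    (f : E → ℝ) (x : E) : ℝ≥0∞ :=
  (∫⁻ t : ℝ in Set.Ioi 0, modifiedCarreDuChamp J (semigroup P t.toNNReal f) x) ^ (1 / 2 : ℝ)

end

/-! Put `w_t = u |u|^(p/2-1)` with `u = P_t f`, so that `‖w_t‖₂² = ‖P_t f‖_p^p`. The Hardy-Stein
principle says that the rate of decrease of `‖P_t f‖_p^p` is comparable with the energy `𝓔(w_t,
w_t)`. Integrating over `(0, ∞)`, with strong stability killing the term at infinity, bounds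
`‖f‖_p^p` by a multiple of `∫ 𝓔(w_t, w_t) dt`.

No derivative in time is taken. Under a sub-probability measure, Jensen's gap for `|·|^p` is
comparable with the variance of `u |u|^(p/2-1)` (`variance_oddPow_le`, `jensen_gap_le`). Applied to
`P_h(x, dy)` and integrated in `x`, this compares the loss of `‖·‖_p^p` over a time step with the
loss of `‖w‖₂²` under the `L²` semigroup (`norm_halfPow_sub_comparable`). One direction shows that
`w_t` lies in the domain for almost every `t` (`ae_halfPowFlow_mem_domain`); the other gives the
integrated inequality (`norm_halfPowFlow_sub_le`, `eLpNorm_semigroup_rpow_le`).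

For a pure-jump form the mean value theorem and the symmetry of `J` bound `𝓔(w_t, w_t)` by a
multiple of `∫ |P_t f|^(p-2) Γ̃[P_t f] dm` (`ofReal_form_le`); the cutoff `χ` appears because each
pair `(x, y)` may be charged to the endpoint where `|u|` is larger. The weight is dominated by a
maximal function independent of `t`, so Tonelli and Hölder give `‖f‖_p^p ≤ C ‖f‖_p^(p-2) ‖G̃‖_p²`
(`lintegral_weighted_carreDuChamp_le`, `eLpNorm_rpow_le_squareGTilde`), and the finite factor
`‖f‖_p^(p-2)` cancels. The bound for `G` follows from `G̃ ≤ 2 G`.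

The maximal inequality is needed only in `L²`, for `|f|^(p/2)`. Dyadic averages of the semigroup are
handled by a `T T*` argument (`lintegral_maxAvg_sq_le`), and the difference between the semigroup
and its averages by a discrete Littlewood-Paley bound (`sum_mul_norm_sub_sq_le`). -/

/-! ### Odd powers and the Bregman divergence of `|·|^p` -/

/-- The odd power function `x ↦ x |x|^s`. -/
noncomputable def oddPow (s x : ℝ) : ℝ := x * |x| ^ s

lemma oddPow_neg (s x : ℝ) : oddPow s (-x) = -oddPow s x := by simp [oddPow]

lemma oddPow_of_nonneg {s x : ℝ} (hs : 0 ≤ s) (hx : 0 ≤ x) : oddPow s x = x ^ (s + 1) := by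
  rw [oddPow, abs_of_nonneg hx, Real.rpow_add_one' hx (by linarith), mul_comm]

lemma abs_oddPow {s : ℝ} (hs : 0 ≤ s) (x : ℝ) : |oddPow s x| = |x| ^ (s + 1) := by
  rw [oddPow, abs_mul, Real.rpow_add_one' (abs_nonneg x) (by linarith), mul_comm,
    abs_of_nonneg (Real.rpow_nonneg (abs_nonneg x) s)]

lemma oddPow_sq {s : ℝ} (hs : 0 ≤ s) (x : ℝ) : oddPow s x ^ 2 = |x| ^ (2 * (s + 1)) := by
  rw [← sq_abs, abs_oddPow hs, ← Real.rpow_natCast, ← Real.rpow_mul (abs_nonneg x)]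
  congr 1; push_cast; ring

lemma hasDerivAt_oddPow {s : ℝ} (hs : 0 ≤ s) (x : ℝ) :
    HasDerivAt (oddPow s) ((s + 1) * |x| ^ s) x := by
  rcases hs.eq_or_lt with rfl | hs
  · have : oddPow 0 = id := by ext y; simp [oddPow]
    simpa [this] using hasDerivAt_id x
  rcases lt_trichotomy x 0 with hx | rfl | hx
  · have h : HasDerivAt (fun y : ℝ => -(-y) ^ (s + 1)) (-((-1) * (s + 1) * (-x) ^ (s + 1 - 1))) x :=
      ((hasDerivAt_id x).neg.rpow_const (Or.inl (by simp; exact hx.ne))).neg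
    have e : oddPow s =ᶠ[𝓝 x] fun y : ℝ => -(-y) ^ (s + 1) := by
      filter_upwards [eventually_lt_nhds hx] with y hy
      rw [← neg_neg y, oddPow_neg, oddPow_of_nonneg hs.le (by linarith), neg_neg]
    refine (h.congr_of_eventuallyEq e).congr_deriv ?_
    rw [abs_of_neg hx]; ring_nf
  · rw [hasDerivAt_iff_tendsto_slope]
    have : Tendsto (fun y : ℝ => |y| ^ s) (𝓝[≠] 0) (𝓝 (|0| ^ s)) :=
      ((continuous_abs.tendsto 0).rpow_const (Or.inr hs.le)).mono_left nhdsWithin_le_nhds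
    simp only [abs_zero, Real.zero_rpow hs.ne', mul_zero] at this ⊢
    refine this.congr' ?_
    filter_upwards [self_mem_nhdsWithin] with y hy
    have hy : y ≠ 0 := hy
    simp [slope_def_field, oddPow]
    field_simp
  · have h : HasDerivAt (fun y : ℝ => y ^ (s + 1)) (1 * (s + 1) * x ^ (s + 1 - 1)) x :=
      (hasDerivAt_id x).rpow_const (Or.inl hx.ne')
    have e : oddPow s =ᶠ[𝓝 x] fun y : ℝ => y ^ (s + 1) := by
      filter_upwards [eventually_gt_nhds hx] with y hy
      rw [oddPow_of_nonneg hs.le hy.le]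
    refine (h.congr_of_eventuallyEq e).congr_deriv ?_
    rw [abs_of_pos hx]; ring_nf

lemma continuous_oddPow {s : ℝ} (hs : 0 ≤ s) : Continuous (oddPow s) :=
  continuous_iff_continuousAt.2 fun x => (hasDerivAt_oddPow hs x).continuousAt

lemma abs_oddPow_sub_le {s : ℝ} (hs : 0 ≤ s) (a b : ℝ) :
    |oddPow s b - oddPow s a| ≤ (s + 1) * max |a| |b| ^ s * |b - a| := by
  have := Convex.norm_image_sub_le_of_norm_hasDerivWithin_le (f := oddPow s)
    (f' := fun x => (s + 1) * |x| ^ s) (s := Set.Icc (-max |a| |b|) (max |a| |b|))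
    (C := (s + 1) * max |a| |b| ^ s) (x := a) (y := b)
    (fun x _ => (hasDerivAt_oddPow hs x).hasDerivWithinAt) (fun x hx => by
      rw [Real.norm_of_nonneg (by positivity)]
      gcongr
      exact abs_le.2 hx) (convex_Icc _ _) (abs_le.1 (le_max_left _ _)) (abs_le.1 (le_max_right _ _))
  simpa using this

/-- For `a ≥ 0` the bound follows from `|a|^s ≤ b^s`, even without the factor 2. For `a ≤ 0` the
right side is at least `2 b^(s+1)` and `b - a ≤ 2 b`; this case is what costs the 2. -/
lemma le_abs_oddPow_sub_aux {s : ℝ} (hs : 0 ≤ s) {a b : ℝ} (h : |a| ≤ b) :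
    b ^ s * (b - a) ≤ 2 * (oddPow s b - oddPow s a) := by
  have hb : 0 ≤ b := (abs_nonneg a).trans h
  have h1 : |a| ^ s ≤ b ^ s := Real.rpow_le_rpow (abs_nonneg a) h hs
  have h0 : 0 ≤ |a| ^ s := by positivity
  have hab := abs_le.1 h
  simp only [oddPow, abs_of_nonneg hb]
  rcases le_total 0 a with ha | ha
  · nlinarith [mul_le_mul_of_nonneg_left h1 ha, mul_nonneg (h0.trans h1) (sub_nonneg.2 hab.2)]
  · nlinarith [mul_nonneg (neg_nonneg.2 ha) h0,
      mul_nonneg (h0.trans h1) (by linarith : 0 ≤ b + a)]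

lemma le_abs_oddPow_sub {s : ℝ} (hs : 0 ≤ s) (a b : ℝ) :
    max |a| |b| ^ s * |b - a| ≤ 2 * |oddPow s b - oddPow s a| := by
  wlog h : |a| ≤ |b| generalizing a b
  · rw [max_comm, abs_sub_comm, abs_sub_comm (oddPow s b)]
    exact this b a (le_of_not_ge h)
  wlog hb : 0 ≤ b generalizing a b
  · have := this (-a) (-b) (by simpa using h) (by linarith)
    simp only [abs_neg, oddPow_neg] at this
    rwa [← abs_neg (b - a), ← abs_neg (oddPow s b - oddPow s a), neg_sub', neg_sub']
  rw [max_eq_right h]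
  rw [abs_of_nonneg hb] at h ⊢
  have := le_abs_oddPow_sub_aux hs h
  rw [abs_of_nonneg (sub_nonneg.2 (abs_le.1 h).2)]
  exact this.trans (by gcongr; exact le_abs_self _)

lemma oddPow_surjective {s : ℝ} (hs : 0 ≤ s) : Function.Surjective (oddPow s) := by
  intro y
  wlog hy : 0 ≤ y generalizing y
  · obtain ⟨x, hx⟩ := this (-y) (by linarith)
    exact ⟨-x, by rw [oddPow_neg, hx, neg_neg]⟩
  refine ⟨y ^ (s + 1)⁻¹, ?_⟩
  rw [oddPow_of_nonneg hs (by positivity), Real.rpow_inv_rpow hy (by linarith)]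

/-- The Bregman divergence `|b|^p - |a|^p - p a |a|^(p-2) (b - a)` of `|·|^p`. -/
noncomputable def bregman (p a b : ℝ) : ℝ := |b| ^ p - |a| ^ p - p * oddPow (p - 2) a * (b - a)

/-- With `r = p / 2` this is exactly the sign of the derivative needed in
`sq_oddPow_sub_le_bregman`. The proof splits by the signs of `a` and `b` and by which of `|a|`,
`|b|` is larger. -/
lemma abs_rpow_mul_oddPow_sub_le {r : ℝ} (hr : 1 ≤ r) {a b : ℝ} (hab : a ≤ b) :
    |b| ^ (r - 1) * (oddPow (r - 1) b - oddPow (r - 1) a)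
      ≤ 2 * (oddPow (2 * r - 2) b - oddPow (2 * r - 2) a) := by
  have key : ∀ x : ℝ, |x| ^ (2 * r - 2) = |x| ^ (r - 1) * |x| ^ (r - 1) := fun x => by
    rw [show 2 * r - 2 = (r - 1) + (r - 1) by ring, Real.rpow_add_of_nonneg (abs_nonneg x)
      (by linarith) (by linarith)]
  simp only [oddPow, key]
  have hA : 0 ≤ |a| ^ (r - 1) := by positivity
  have hB : 0 ≤ |b| ^ (r - 1) := by positivity
  have mono : ∀ x y : ℝ, |x| ≤ |y| → |x| ^ (r - 1) ≤ |y| ^ (r - 1) := fun x y h =>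
    Real.rpow_le_rpow (abs_nonneg x) h (by linarith)
  set A := |a| ^ (r - 1)
  set B := |b| ^ (r - 1)
  rcases le_total 0 a with ha | ha
  · have h1 : A ≤ B := mono a b (by rw [abs_of_nonneg ha, abs_of_nonneg (ha.trans hab)]; exact hab)
    have : 0 ≤ (b - a) * B * B := by have := sub_nonneg.2 hab; positivity
    have : 0 ≤ B * B - A * A := by nlinarith
    have : 0 ≤ a * (B * B - A * A) := by positivity
    have : 0 ≤ a * (A * B) := by positivity
    nlinarith
  rcases le_total 0 b with hb | hb
  · have ha' := neg_nonneg.2 ha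
    rcases le_total (-a) b with h | h
    · have h1 : A ≤ B := mono a b (by rwa [abs_of_nonneg hb, abs_of_nonpos ha])
      have h2 : -a * A ≤ b * B := mul_le_mul h h1 hA hb
      nlinarith [mul_le_mul_of_nonneg_right h2 hB, mul_nonneg ha' (mul_nonneg hA hA)]
    · have h1 : B ≤ A := mono b a (by rwa [abs_of_nonneg hb, abs_of_nonpos ha])
      nlinarith [mul_nonneg ha' (mul_nonneg hA (sub_nonneg.2 h1)),
        mul_nonneg hb (mul_nonneg hB hB), mul_nonneg ha' (mul_nonneg hA hA)]
  · have h1 : B ≤ A := mono b a (by rw [abs_of_nonpos ha, abs_of_nonpos hb]; linarith)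
    have h2 : 0 ≤ A * A - B * B := by nlinarith
    have : 0 ≤ (b - a) * (A * A) := mul_nonneg (sub_nonneg.2 hab) (by positivity)
    have : 0 ≤ (-b) * (A * A - B * B) := mul_nonneg (by linarith) h2
    have : 0 ≤ (-a) * (A * (A - B)) := mul_nonneg (by linarith) (mul_nonneg hA (by linarith))
    nlinarith

lemma hasDerivAt_abs_rpow_oddPow {p : ℝ} (hp : 2 ≤ p) (x : ℝ) :
    HasDerivAt (fun y : ℝ => |y| ^ p) (p * oddPow (p - 2) x) x := by
  refine (hasDerivAt_abs_rpow x (by linarith)).congr_deriv ?_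
  rw [oddPow]; ring

lemma bregman_neg (p a b : ℝ) : bregman p (-a) (-b) = bregman p a b := by
  simp only [bregman, abs_neg, oddPow_neg]; ring

/-- The square of the increment of `x |x|^(p/2-1)` is controlled by the Bregman divergence. -/
lemma sq_oddPow_sub_le_bregman {p : ℝ} (hp : 2 ≤ p) (a b : ℝ) :
    (oddPow (p / 2 - 1) b - oddPow (p / 2 - 1) a) ^ 2 ≤ 2 * bregman p a b := by
  wlog hab : a ≤ b generalizing a b
  · have := this (-a) (-b) (by linarith)
    rw [bregman_neg, oddPow_neg, oddPow_neg] at this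
    linarith
  have hr : 0 ≤ p / 2 - 1 := by linarith
  -- This function vanishes at `a` and is nondecreasing to the right of `a`, so it is nonnegative at
  -- `b`.
  let g : ℝ → ℝ := fun x =>
    2 * bregman p a x - (oddPow (p / 2 - 1) x - oddPow (p / 2 - 1) a) ^ 2
  have hg : ∀ x, HasDerivAt g (2 * (p * oddPow (p - 2) x - p * oddPow (p - 2) a)
      - 2 * (oddPow (p / 2 - 1) x - oddPow (p / 2 - 1) a) * ((p / 2) * |x| ^ (p / 2 - 1))) x := by
    intro x
    have h1 := (hasDerivAt_abs_rpow_oddPow hp x).sub_const (|a| ^ p)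
    have h2 := ((hasDerivAt_id x).sub_const a).const_mul (p * oddPow (p - 2) a)
    have h3 := ((hasDerivAt_oddPow hr x).sub_const (oddPow (p / 2 - 1) a)).pow 2
    refine (((h1.sub h2).const_mul 2).sub h3).congr_deriv ?_
    simp only [sub_add_cancel]
    push_cast
    ring
  have hmono : MonotoneOn g (Set.Ici a) := by
    refine monotoneOn_of_deriv_nonneg (convex_Ici a)
      (fun x _ => (hg x).continuousAt.continuousWithinAt)
      (fun x _ => (hg x).differentiableAt.differentiableWithinAt) fun x hx => ?_
    rw [interior_Ici] at hx
    have := abs_rpow_mul_oddPow_sub_le (r := p / 2) (by linarith) (le_of_lt hx)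
    rw [(hg x).deriv, show p - 2 = 2 * (p / 2) - 2 by ring]
    nlinarith
  have := hmono (Set.mem_Ici.2 le_rfl) (Set.mem_Ici.2 hab) hab
  have h0 : g a = 0 := by simp [g, bregman]
  rw [h0] at this
  simp only [g] at this
  linarith

lemma bregman_nonneg {p : ℝ} (hp : 2 ≤ p) (a b : ℝ) : 0 ≤ bregman p a b := by
  have := sq_oddPow_sub_le_bregman hp a b
  have := sq_nonneg (oddPow (p / 2 - 1) b - oddPow (p / 2 - 1) a)
  linarith

/-- Adding the nonnegative divergence with `a` and `b` exchanged leaves a product of increments, `p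
(oddPow (p-2) b - oddPow (p-2) a) (b - a)`. With `M = max |a| |b|` the mean value bound makes it at
most `p (p-1) (M^(p/2-1) |b - a|)²`, and `le_abs_oddPow_sub` bounds the square by 4 times the
squared increment on the right. -/
lemma bregman_le_sq_oddPow_sub {p : ℝ} (hp : 2 ≤ p) (a b : ℝ) :
    bregman p a b
      ≤ 4 * p * (p - 1) * (oddPow (p / 2 - 1) b - oddPow (p / 2 - 1) a) ^ 2 := by
  have h1 := bregman_nonneg hp b a
  have h2 : bregman p a b ≤ p * ((oddPow (p - 2) b - oddPow (p - 2) a) * (b - a)) := by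
    rw [bregman] at h1 ⊢
    linarith
  have h3 := abs_oddPow_sub_le (s := p - 2) (by linarith) a b
  have h4 := le_abs_oddPow_sub (s := p / 2 - 1) (by linarith) a b
  have hM : (0 : ℝ) ≤ max |a| |b| := (abs_nonneg a).trans (le_max_left _ _)
  have key : max |a| |b| ^ (p - 2) = max |a| |b| ^ (p / 2 - 1) * max |a| |b| ^ (p / 2 - 1) := by
    rw [← Real.rpow_add_of_nonneg hM (by linarith) (by linarith)]; congr 1; ring
  rw [key] at h3
  have hB : 0 ≤ max |a| |b| ^ (p / 2 - 1) := by positivity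
  set B := max |a| |b| ^ (p / 2 - 1)
  have h5 : (B * |b - a|) ^ 2 ≤ 4 * (oddPow (p / 2 - 1) b - oddPow (p / 2 - 1) a) ^ 2 := by
    calc _ ≤ (2 * |oddPow (p / 2 - 1) b - oddPow (p / 2 - 1) a|) ^ 2 := by gcongr
      _ = _ := by rw [mul_pow, sq_abs]; norm_num
  calc bregman p a b ≤ p * ((oddPow (p - 2) b - oddPow (p - 2) a) * (b - a)) := h2
    _ ≤ p * (|oddPow (p - 2) b - oddPow (p - 2) a| * |b - a|) := by
      rw [← abs_mul]
      exact mul_le_mul_of_nonneg_left (le_abs_self _) (by linarith)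
    _ ≤ p * (((p - 2 + 1) * (B * B) * |b - a|) * |b - a|) := by gcongr
    _ = p * (p - 1) * (B * |b - a|) ^ 2 := by ring
    _ ≤ p * (p - 1) * (4 * (oddPow (p / 2 - 1) b - oddPow (p / 2 - 1) a) ^ 2) := by
      have : 0 ≤ p - 1 := by linarith
      gcongr
    _ = _ := by ring

lemma oddPow_half_sq {p : ℝ} (hp : 2 ≤ p) (x : ℝ) : oddPow (p / 2 - 1) x ^ 2 = |x| ^ p := by
  rw [oddPow_sq (by linarith)]; congr 1; ring

/-! ### Jensen's gap and variance under a sub-probability measure -/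

section SubProbability
variable {α : Type*} [MeasurableSpace α] {μ : Measure α} [IsFiniteMeasure μ] {u : α → ℝ} {p : ℝ}

/-- The usual decomposition of the mean square around `A`, for the probability measure obtained by
placing the missing mass `1 - μ(univ)` at a cemetery point where `v = 0`. That point accounts for
the term with `A ^ 2`. -/
lemma integral_sub_const_sq {v : α → ℝ} (hv : Integrable v μ)
    (hv2 : Integrable (fun x => v x ^ 2) μ) (A : ℝ) :
    ∫ x, (v x - A) ^ 2 ∂μ + (1 - μ.real Set.univ) * A ^ 2
      = (∫ x, v x ^ 2 ∂μ - (∫ x, v x ∂μ) ^ 2) + (∫ x, v x ∂μ - A) ^ 2 := by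
  have : ∀ x, (v x - A) ^ 2 = v x ^ 2 - 2 * A * v x + A ^ 2 := fun x => by ring
  simp_rw [this]
  have i1 : Integrable (fun x => 2 * A * v x) μ := hv.const_mul _
  have i2 : Integrable (fun x => v x ^ 2 - 2 * A * v x) μ := hv2.sub i1
  rw [integral_add i2 (integrable_const _), integral_sub hv2 i1, integral_const_mul, integral_const]
  simp only [smul_eq_mul]; ring

/-- As in `integral_sub_const_sq`, the missing mass sits at a point where `u = 0` and contributes
`bregman p a 0`. At `a = ∫ u` the linear term disappears and the right side is Jensen's gap. -/
lemma integral_bregman (hp : 2 ≤ p) (hu : Integrable u μ)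
    (hup : Integrable (fun x => |u x| ^ p) μ) (a : ℝ) :
    ∫ x, bregman p a (u x) ∂μ + (1 - μ.real Set.univ) * bregman p a 0
      = ∫ x, |u x| ^ p ∂μ - |a| ^ p - p * oddPow (p - 2) a * (∫ x, u x ∂μ - a) := by
  simp only [bregman]
  have i1 : Integrable (fun x => |u x| ^ p - |a| ^ p) μ := hup.sub (integrable_const _)
  have i2 : Integrable (fun x => p * oddPow (p - 2) a * (u x - a)) μ :=
    (hu.sub (integrable_const _)).const_mul _
  rw [integral_sub i1 i2, integral_sub hup (integrable_const _), integral_const_mul,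
    integral_sub hu (integrable_const _),
    integral_const, integral_const, abs_zero, Real.zero_rpow (by linarith)]
  simp only [smul_eq_mul]; ring

lemma Integrable.bregman (hu : Integrable u μ)
    (hup : Integrable (fun x => |u x| ^ p) μ) (a : ℝ) :
    Integrable (fun x => bregman p a (u x)) μ :=
  (hup.sub (integrable_const _)).sub ((hu.sub (integrable_const _)).const_mul _)

/-- Jensen's gap for `|·|^p` bounds the variance of `u |u|^(p/2-1)`. -/
lemma variance_oddPow_le (hp : 2 ≤ p) (hμ : μ.real Set.univ ≤ 1) (hu : Integrable u μ)
    (hup : Integrable (fun x => |u x| ^ p) μ)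
    (hv : Integrable (fun x => oddPow (p / 2 - 1) (u x)) μ) :
    ∫ x, |u x| ^ p ∂μ - (∫ x, oddPow (p / 2 - 1) (u x) ∂μ) ^ 2
      ≤ 2 * (∫ x, |u x| ^ p ∂μ - |∫ x, u x ∂μ| ^ p) := by
  set a := ∫ x, u x ∂μ with ha
  have hv2 : Integrable (fun x => oddPow (p / 2 - 1) (u x) ^ 2) μ := by
    simpa only [oddPow_half_sq hp] using hup
  -- The variance is at most the mean square deviation from any centre; the centre chosen is the
  -- image of the mean of `u`, where the Bregman integral is Jensen's gap.
  have h1 := integral_sub_const_sq hv hv2 (oddPow (p / 2 - 1) a)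
  have h2 := integral_bregman hp hu hup a
  rw [← ha, sub_self, mul_zero, sub_zero] at h2
  simp only [oddPow_half_sq hp] at h1
  have h3 : ∫ x, (oddPow (p / 2 - 1) (u x) - oddPow (p / 2 - 1) a) ^ 2 ∂μ
      ≤ ∫ x, 2 * _root_.bregman p a (u x) ∂μ := by
    refine integral_mono_of_nonneg (ae_of_all _ fun x => sq_nonneg _)
      ((Integrable.bregman hu hup a).const_mul 2)
      (ae_of_all _ fun x => sq_oddPow_sub_le_bregman hp _ _)
  rw [integral_const_mul] at h3
  have h4 := sq_oddPow_sub_le_bregman hp a 0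
  have h5 : oddPow (p / 2 - 1) 0 = 0 := by simp [oddPow]
  rw [h5, zero_sub, neg_sq, oddPow_half_sq hp] at h4
  have h6 := mul_le_mul_of_nonneg_left h4 (sub_nonneg.2 hμ)
  nlinarith [sq_nonneg (∫ x, oddPow (p / 2 - 1) (u x) ∂μ - oddPow (p / 2 - 1) a)]

/-- Jensen's gap for `|·|^p` is bounded by the variance of `u |u|^(p/2-1)`. -/
lemma jensen_gap_le (hp : 2 ≤ p) (hμ : μ.real Set.univ ≤ 1) (hu : Integrable u μ)
    (hup : Integrable (fun x => |u x| ^ p) μ)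
    (hv : Integrable (fun x => oddPow (p / 2 - 1) (u x)) μ) :
    ∫ x, |u x| ^ p ∂μ - |∫ x, u x ∂μ| ^ p
      ≤ 4 * p * (p - 1) * (∫ x, |u x| ^ p ∂μ - (∫ x, oddPow (p / 2 - 1) (u x) ∂μ) ^ 2) := by
  -- Now the centre is the point `c` whose image is the mean of `oddPow (p/2-1) ∘ u`, so the squared
  -- deviations integrate to the variance exactly. Jensen's gap is at most the Bregman integral
  -- around any point, since `bregman p c (∫ u) ≥ 0`.
  obtain ⟨c, hc⟩ := oddPow_surjective (s := p / 2 - 1) (by linarith)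
    (∫ x, oddPow (p / 2 - 1) (u x) ∂μ)
  have hv2 : Integrable (fun x => oddPow (p / 2 - 1) (u x) ^ 2) μ := by
    simpa only [oddPow_half_sq hp] using hup
  have h1 := integral_sub_const_sq hv hv2 (oddPow (p / 2 - 1) c)
  have h2 := integral_bregman hp hu hup c
  rw [hc, sub_self] at h1
  rw [← hc] at h1 ⊢
  simp only [oddPow_half_sq hp] at h1
  have h3 : ∫ x, _root_.bregman p c (u x) ∂μ ≤
      ∫ x, 4 * p * (p - 1) * (oddPow (p / 2 - 1) (u x) - oddPow (p / 2 - 1) c) ^ 2 ∂μ := by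
    refine integral_mono_of_nonneg (ae_of_all _ fun x => bregman_nonneg hp _ _)
      (Integrable.const_mul ?_ _) (ae_of_all _ fun x => bregman_le_sq_oddPow_sub hp _ _)
    have : ∀ x, (oddPow (p / 2 - 1) (u x) - oddPow (p / 2 - 1) c) ^ 2
      = oddPow (p / 2 - 1) (u x) ^ 2 - 2 * oddPow (p / 2 - 1) c * oddPow (p / 2 - 1) (u x)
        + oddPow (p / 2 - 1) c ^ 2 := fun x => by ring
    simp_rw [this]
    exact (hv2.sub (hv.const_mul _)).add (integrable_const _)
  rw [integral_const_mul] at h3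
  have h4 := bregman_le_sq_oddPow_sub hp c 0
  have h5 : oddPow (p / 2 - 1) 0 = 0 := by simp [oddPow]
  rw [h5, zero_sub, neg_sq, oddPow_half_sq hp] at h4
  have h6 := mul_le_mul_of_nonneg_left h4 (sub_nonneg.2 hμ)
  have h7 := bregman_nonneg hp c (∫ x, u x ∂μ)
  rw [_root_.bregman] at h7
  rw [oddPow_half_sq hp]
  linear_combination h3 + h6 + h7 - h2 + 4 * p * (p - 1) * h1

end SubProbability

/-! ### Symmetric contraction semigroups on a Hilbert space, without spectral theory -/

section HilbertSemigroup
variable {H : Type*} [NormedAddCommGroup H] [InnerProductSpace ℝ H]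

/-- A strongly continuous semigroup of symmetric contractions on a real Hilbert space. -/
structure IsSymmContractionSemigroup (S : ℝ≥0 → H →L[ℝ] H) : Prop where
  zero : ∀ u, S 0 u = u
  add : ∀ s t u, S (s + t) u = S s (S t u)
  symm : ∀ t u v, inner ℝ (S t u) v = inner ℝ u (S t v)
  contraction : ∀ t u, ‖S t u‖ ≤ ‖u‖
  tendsto_zero : ∀ u, Tendsto (fun t => S t u) (𝓝[>] 0) (𝓝 u)

/-- `b(t) = ⟨u - S_t u, u⟩`. -/
noncomputable def energyGap (S : ℝ≥0 → H →L[ℝ] H) (u : H) (t : ℝ≥0) : ℝ := inner ℝ (u - S t u) u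

lemma mul_sub_le_of_concave {b : ℕ → ℝ} (h0 : b 0 = 0)
    (hb : ∀ n, b (n + 2) + b n ≤ 2 * b (n + 1)) :
    ∀ n : ℕ, n * (b (n + 1) - b n) ≤ b n := by
  intro n
  induction n with
  | zero => simp [h0]
  | succ n ih =>
    have h1 := hb n
    have h2 : ((n : ℝ) + 1) * (b (n + 2) - b (n + 1)) ≤ (n + 1) * (b (n + 1) - b n) := by
      gcongr ?_ * ?_
      linarith
    push_cast
    rw [show n + 1 + 1 = n + 2 by ring]
    linarith

lemma mul_le_mul_of_concave {b : ℕ → ℝ} (h0 : b 0 = 0)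
    (hb : ∀ n, b (n + 2) + b n ≤ 2 * b (n + 1)) {m n : ℕ} (hmn : m ≤ n) :
    m * b n ≤ n * b m := by
  induction n, hmn using Nat.le_induction with
  | base => rfl
  | succ n hmn ih =>
    rcases Nat.eq_zero_or_pos n with rfl | hn
    · obtain rfl : m = 0 := by omega
      simp [h0]
    have h1 := mul_sub_le_of_concave h0 hb n
    have hn' : (0 : ℝ) < n := by exact_mod_cast hn
    have h2 : (m : ℝ) * (n * b (n + 1)) ≤ m * ((n + 1) * b n) :=
      mul_le_mul_of_nonneg_left (by linarith) (Nat.cast_nonneg m)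
    have h3 : ((n : ℝ) + 1) * (m * b n) ≤ (n + 1) * (n * b m) := by gcongr
    push_cast
    refine le_of_mul_le_mul_left (a := (n : ℝ)) ?_ hn'
    linarith

namespace IsSymmContractionSemigroup
variable {S : ℝ≥0 → H →L[ℝ] H} (hS : IsSymmContractionSemigroup S)
include hS

lemma inner_add (s t : ℝ≥0) (u : H) : inner ℝ (S (s + t) u) u = inner ℝ (S t u) (S s u) := by
  rw [hS.add, hS.symm]

lemma inner_double (t : ℝ≥0) (u : H) : inner ℝ (S (2 * t) u) u = ‖S t u‖ ^ 2 := by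
  rw [two_mul, hS.inner_add, real_inner_self_eq_norm_sq]

lemma inner_eq_half (t : ℝ≥0) (u : H) : inner ℝ (S t u) u = ‖S (t / 2) u‖ ^ 2 := by
  rw [← hS.inner_double]; congr 3; ring

lemma energyGap_eq (t : ℝ≥0) (u : H) : energyGap S u t = ‖u‖ ^ 2 - ‖S (t / 2) u‖ ^ 2 := by
  rw [energyGap, inner_sub_left, real_inner_self_eq_norm_sq, hS.inner_eq_half]

lemma energyGap_double (t : ℝ≥0) (u : H) : energyGap S u (2 * t) = ‖u‖ ^ 2 - ‖S t u‖ ^ 2 := by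
  rw [energyGap, inner_sub_left, real_inner_self_eq_norm_sq, hS.inner_double]

lemma norm_antitone (u : H) : Antitone fun t => ‖S t u‖ := by
  intro s t hst
  obtain ⟨r, rfl⟩ := exists_add_of_le hst
  dsimp only
  rw [add_comm, hS.add]
  exact hS.contraction _ _

lemma energyGap_mono (u : H) : Monotone (energyGap S u) := by
  intro s t hst
  rw [hS.energyGap_eq, hS.energyGap_eq]
  have := hS.norm_antitone u (a := s / 2) (b := t / 2) (by gcongr)
  dsimp only at this
  gcongr

/-- By symmetry `⟨S_{s+t} u, u⟩ = ⟨S_t u, S_s u⟩`, so second differences of `t ↦ ⟨S_t u, u⟩` are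
squared norms. This convexity takes the place of the spectral theorem below. -/
lemma second_diff (s h : ℝ≥0) (u : H) :
    ‖S (s + 2 * h) u - S s u‖ ^ 2 = inner ℝ (S (2 * s + 4 * h) u) u
      - 2 * inner ℝ (S (2 * s + 2 * h) u) u + inner ℝ (S (2 * s) u) u := by
  rw [@norm_sub_sq ℝ, ← hS.inner_double, ← hS.inner_double, RCLike.re_to_real, ← hS.inner_add]
  congr 3
  · congr 3; ring
  · congr 3; ring

lemma energyGap_concave (h : ℝ≥0) (u : H) (n : ℕ) :
    energyGap S u ((n + 2 : ℕ) * h) + energyGap S u (n * h)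
      ≤ 2 * energyGap S u ((n + 1 : ℕ) * h) := by
  have h1 := hS.second_diff (n * h / 2) (h / 2) u
  rw [show 2 * (n * h / 2) + 4 * (h / 2) = ((n + 2 : ℕ) : ℝ≥0) * h by
      rw [← NNReal.coe_inj]; push_cast; ring,
    show 2 * (n * h / 2) + 2 * (h / 2) = ((n + 1 : ℕ) : ℝ≥0) * h by
      rw [← NNReal.coe_inj]; push_cast; ring,
    show 2 * (n * h / 2) = (n : ℝ≥0) * h by rw [← NNReal.coe_inj]; push_cast; ring] at h1
  have h2 := sq_nonneg ‖S (n * h / 2 + 2 * (h / 2)) u - S (n * h / 2) u‖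
  simp only [energyGap, inner_sub_left]
  linarith

lemma energyGap_zero (u : H) : energyGap S u 0 = 0 := by
  simp [energyGap, hS.zero]

lemma norm_sub_le (s t : ℝ≥0) (u : H) : ‖S s u - S t u‖ ≤ ‖S (nndist s t) u - u‖ := by
  wlog hst : s ≤ t generalizing s t
  · rw [norm_sub_rev, nndist_comm]
    exact this t s (le_of_not_ge hst)
  obtain ⟨r, rfl⟩ := exists_add_of_le hst
  have : nndist s (s + r) = r := by
    rw [← NNReal.coe_inj, coe_nndist, NNReal.dist_eq]
    push_cast
    rw [sub_add_cancel_left, abs_neg, abs_of_nonneg r.coe_nonneg]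
  rw [this, hS.add, ← map_sub, norm_sub_rev]
  exact hS.contraction _ _

lemma continuous_orbit (u : H) : Continuous fun t => S t u := by
  have h0 : Tendsto (fun t => S t u) (𝓝 0) (𝓝 u) := by
    have h1 : ContinuousWithinAt (fun t => S t u) (Set.Ioi 0) 0 := by
      simpa [ContinuousWithinAt, hS.zero] using hS.tendsto_zero u
    have h2 := continuousWithinAt_Ioi_iff_Ici.1 h1
    have h3 : Set.Ici (0 : ℝ≥0) = Set.univ := Set.eq_univ_of_forall fun x => zero_le (a := x)
    rw [h3, continuousWithinAt_univ, ContinuousAt, hS.zero] at h2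
    exact h2
  rw [continuous_iff_continuousAt]
  intro t
  rw [ContinuousAt, tendsto_iff_norm_sub_tendsto_zero]
  have h1 : Tendsto (fun s => nndist s t) (𝓝 t) (𝓝 0) := by
    have : Continuous fun s => nndist s t := by fun_prop
    simpa using this.tendsto t
  have h2 := tendsto_iff_norm_sub_tendsto_zero.1 (h0.comp h1)
  exact squeeze_zero (fun _ => norm_nonneg _) (fun s => hS.norm_sub_le s t u) h2

lemma continuous_energyGap (u : H) : Continuous (energyGap S u) := by
  have := hS.continuous_orbit u
  unfold energyGap
  fun_prop

/-- Discrete concavity is applied on the grid of mesh `s / (n + 1)`, which contains `s` itself, with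
`t` rounded down to a grid point. Continuity of the energy gap removes the rounding as `n → ∞`. -/
lemma energyGap_div_antitone (u : H) {s t : ℝ≥0} (hs : 0 < s) (hst : s ≤ t) :
    energyGap S u t / t ≤ energyGap S u s / s := by
  have ht : 0 < t := hs.trans_le hst
  rw [div_le_div_iff₀ (by exact_mod_cast ht) (by exact_mod_cast hs)]
  have key : ∀ n : ℕ, ((⌊t / (s / (n + 1))⌋₊ : ℝ≥0) * (s / (n + 1)) : ℝ≥0) * energyGap S u s
      ≥ s * energyGap S u ((⌊t / (s / (n + 1))⌋₊ : ℝ≥0) * (s / (n + 1))) := by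
    intro n
    set δ := s / (n + 1) with hδ
    have hn : ((n + 1 : ℕ) : ℝ≥0) * δ = s := by
      rw [hδ]; push_cast; field_simp
    have hδ0 : 0 < δ := by positivity
    have hle : n + 1 ≤ ⌊t / δ⌋₊ := by
      apply Nat.le_floor
      rw [le_div_iff₀ hδ0, hn]; exact hst
    have := mul_le_mul_of_concave (b := fun k => energyGap S u (k * δ))
      (by simp [hS.energyGap_zero]) (fun k => hS.energyGap_concave δ u k) hle
    rw [hn] at this
    have h2 : (s : ℝ) = ((n + 1 : ℕ) : ℝ) * δ := by rw [← hn]; push_cast; ring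
    calc (s : ℝ) * energyGap S u (⌊t / δ⌋₊ * δ)
        = δ * (((n + 1 : ℕ) : ℝ) * energyGap S u (⌊t / δ⌋₊ * δ)) := by rw [h2]; ring
      _ ≤ δ * (⌊t / δ⌋₊ * energyGap S u s) := by gcongr
      _ = _ := by push_cast; ring
  have lim : Tendsto (fun n : ℕ => (⌊t / (s / (n + 1))⌋₊ : ℝ≥0) * (s / (n + 1))) atTop (𝓝 t) := by
    rw [← NNReal.tendsto_coe]
    have h1 : Tendsto (fun n : ℕ => (t : ℝ) - s / ((n : ℝ) + 1)) atTop (𝓝 t) := by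
      have := (tendsto_one_div_add_atTop_nhds_zero_nat.const_mul (s : ℝ)).const_sub (t : ℝ)
      simpa only [mul_one_div, mul_zero, sub_zero] using this
    refine tendsto_of_tendsto_of_tendsto_of_le_of_le h1 tendsto_const_nhds (fun n => ?_) fun n => ?_
    · have h2 := (Nat.lt_floor_add_one (t / (s / (n + 1)))).le
      rw [div_le_iff₀ (by positivity)] at h2
      have h3 : (t : ℝ) ≤ (⌊t / (s / (n + 1))⌋₊ + 1) * (s / (n + 1)) := by exact_mod_cast h2
      push_cast
      linarith
    · have h2 := Nat.floor_le (zero_le (a := t / (s / (n + 1))))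
      rw [le_div_iff₀ (by positivity)] at h2
      exact_mod_cast h2
  have l1 := ((NNReal.continuous_coe.tendsto t).comp lim).mul_const (energyGap S u s)
  have l2 := (((hS.continuous_energyGap u).tendsto t).comp lim).const_mul (s : ℝ)
  have := le_of_tendsto_of_tendsto' l2 l1 key
  linarith

/-- If the difference quotients of `⟨u - S_t u, u⟩` converge, they are bounded by the limit. -/
lemma energyGap_le_of_tendsto {u : H} {l : ℝ}
    (h : Tendsto (fun t : ℝ≥0 => 1 / (t : ℝ) * energyGap S u t) (𝓝[>] 0) (𝓝 l)) (t : ℝ≥0) :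
    energyGap S u t ≤ t * l := by
  rcases eq_or_lt_of_le (zero_le (a := t)) with rfl | ht
  · simp [hS.energyGap_zero]
  rw [mul_comm, ← div_le_iff₀ (by exact_mod_cast ht)]
  refine ge_of_tendsto h ?_
  filter_upwards [Ioo_mem_nhdsGT ht] with s hs
  rw [one_div_mul_eq_div]
  exact hS.energyGap_div_antitone u hs.1 hs.2.le

/-- If `⟨u - S_t u, u⟩ / t` is bounded along a sequence tending to zero, it converges. -/
lemma exists_tendsto_energyGap {u : H} {L : ℝ} {h : ℕ → ℝ≥0} (hpos : ∀ k, 0 < h k)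
    (h0 : Tendsto h atTop (𝓝 0)) (hL : ∀ k, energyGap S u (h k) / h k ≤ L) :
    ∃ l : ℝ, Tendsto (fun t : ℝ≥0 => 1 / (t : ℝ) * energyGap S u t) (𝓝[>] 0) (𝓝 l) := by
  have hanti : AntitoneOn (fun t : ℝ≥0 => 1 / (t : ℝ) * energyGap S u t) (Set.Ioi 0) := by
    intro s hs t _ hst
    simp only [one_div_mul_eq_div]
    exact hS.energyGap_div_antitone u hs hst
  have hbdd : ∀ t ∈ Set.Ioi (0 : ℝ≥0), 1 / (t : ℝ) * energyGap S u t ≤ L := by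
    intro t ht
    obtain ⟨k, hk⟩ := (h0.eventually (gt_mem_nhds ht)).exists
    exact (hanti (hpos k) ht hk.le).trans ((one_div_mul_eq_div _ _).trans_le (hL k))
  exact ⟨_, hanti.tendsto_nhdsGT ⟨L, by rintro _ ⟨t, ht, rfl⟩; exact hbdd t ht⟩⟩

/-- A discrete Littlewood-Paley estimate. The squared increments are the second differences of `a j
= ⟨S_{jh} u, u⟩` at even indices, and Abel summation against the linear weight telescopes. It later
controls the distance between the semigroup and its averages. -/
lemma sum_mul_norm_sub_sq_le (h : ℝ≥0) (u : H) (N : ℕ) :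
    ∑ k ∈ Finset.range N, ((k : ℝ) + 1) * ‖S ((k + 1 : ℕ) * h) u - S (k * h) u‖ ^ 2 ≤ ‖u‖ ^ 2 := by
  let a : ℕ → ℝ := fun j => inner ℝ (S (j * h) u) u
  have hD : ∀ j, 0 ≤ a (j + 2) - 2 * a (j + 1) + a j := fun j => by
    have := hS.energyGap_concave h u j
    simp only [energyGap, inner_sub_left] at this
    simp only [a]; linarith
  have hd : ∀ k : ℕ, ‖S ((k + 1 : ℕ) * h) u - S (k * h) u‖ ^ 2
      = a (2 * k + 2) - 2 * a (2 * k + 1) + a (2 * k) := fun k => by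
    have := hS.second_diff (k * h) (h / 2) u
    rw [show k * h + 2 * (h / 2) = ((k + 1 : ℕ) : ℝ≥0) * h by
        rw [← NNReal.coe_inj]; push_cast; ring,
      show 2 * (k * h) + 4 * (h / 2) = ((2 * k + 2 : ℕ) : ℝ≥0) * h by
        rw [← NNReal.coe_inj]; push_cast; ring,
      show 2 * (k * h) + 2 * (h / 2) = ((2 * k + 1 : ℕ) : ℝ≥0) * h by
        rw [← NNReal.coe_inj]; push_cast; ring,
      show 2 * (k * h) = ((2 * k : ℕ) : ℝ≥0) * h by
        rw [← NNReal.coe_inj]; push_cast; ring] at this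
    exact this
  -- The boundary terms are kept so that the induction closes: the right side grows by `(2N+1)` and
  -- `(2N+2)` times the second differences at `2N` and `2N+1`, both nonnegative.
  have hsum : ∑ k ∈ Finset.range N, ((k : ℝ) + 1) * ‖S ((k + 1 : ℕ) * h) u - S (k * h) u‖ ^ 2
      ≤ a 0 - a (2 * N) - 2 * N * (a (2 * N) - a (2 * N + 1)) := by
    induction N with
    | zero => simp
    | succ N ih =>
      rw [Finset.sum_range_succ, hd, show 2 * (N + 1) = 2 * N + 2 by ring]
      have h1 := hD (2 * N)
      have h2 := hD (2 * N + 1)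
      rw [show 2 * N + 1 + 2 = 2 * N + 2 + 1 by ring, show 2 * N + 1 + 1 = 2 * N + 2 by ring] at h2
      have hN : (0 : ℝ) ≤ N := Nat.cast_nonneg N
      have e : ((N + 1 : ℕ) : ℝ) = N + 1 := by push_cast; ring
      rw [e] at *
      nlinarith [mul_nonneg hN h1, mul_nonneg hN h2]
  have h0 : a 0 = ‖u‖ ^ 2 := by simp [a, hS.zero]
  have h1 : 0 ≤ a (2 * N) := by simp only [a]; rw [hS.inner_eq_half]; positivity
  have h2 : 0 ≤ a (2 * N) - a (2 * N + 1) := by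
    have := hS.energyGap_mono u
      (show ((2 * N : ℕ) : ℝ≥0) * h ≤ ((2 * N + 1 : ℕ) : ℝ≥0) * h by gcongr; omega)
    simp only [energyGap, inner_sub_left] at this
    simp only [a]; linarith
  have hN : (0 : ℝ) ≤ N := Nat.cast_nonneg N
  nlinarith [mul_nonneg hN h2]

end IsSymmContractionSemigroup
end HilbertSemigroup

/-! ### Symmetric sub-Markovian kernels acting on `L^q(m)` -/

section SymmKernel
variable {E : Type*} [MeasurableSpace E] {m : Measure E} {κ : Kernel E E}

/-- An `m`-symmetric sub-Markovian kernel. -/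
structure IsSymmSubMarkov (m : Measure E) (κ : Kernel E E) : Prop where
  le_one : ∀ x, κ x Set.univ ≤ 1
  symm : ∀ A B : Set E, MeasurableSet A → MeasurableSet B →
    ∫⁻ x in A, κ x B ∂m = ∫⁻ x in B, κ x A ∂m

namespace IsSymmSubMarkov
variable (hκ : IsSymmSubMarkov m κ)
include hκ

lemma isFiniteKernel : IsFiniteKernel κ := ⟨1, ENNReal.one_lt_top, hκ.le_one⟩

lemma real_univ_le_one (x : E) : (κ x).real Set.univ ≤ 1 :=
  ENNReal.toReal_le_of_le_ofReal zero_le_one (by simpa using hκ.le_one x)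

lemma map_swap [SigmaFinite m] : (m ⊗ₘ κ).map Prod.swap = m ⊗ₘ κ := by
  have _ := hκ.isFiniteKernel
  have hrect : ∀ A B : Set E, MeasurableSet A → MeasurableSet B →
      (m ⊗ₘ κ) (A ×ˢ B) = (m ⊗ₘ κ) (B ×ˢ A) := fun A B hA hB => by
    rw [Measure.compProd_apply_prod hA hB, Measure.compProd_apply_prod hB hA, hκ.symm A B hA hB]
  have hswap : ∀ A B : Set E, MeasurableSet A → MeasurableSet B →
      (m ⊗ₘ κ).map Prod.swap (A ×ˢ B) = (m ⊗ₘ κ) (A ×ˢ B) := fun A B hA hB => by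
    rw [Measure.map_apply measurable_swap (hA.prod hB), Set.preimage_swap_prod, hrect B A hB hA]
  refine Measure.ext_of_generateFrom_of_iUnion
    (Set.image2 (· ×ˢ ·) {s : Set E | MeasurableSet s} {t : Set E | MeasurableSet t})
    (fun n => spanningSets m n ×ˢ spanningSets m n) generateFrom_prod.symm isPiSystem_prod
    ?_ ?_ ?_ ?_
  · rw [Set.iUnion_prod_of_monotone (monotone_spanningSets m) (monotone_spanningSets m),
      iUnion_spanningSets, Set.univ_prod_univ]
  · exact fun n => ⟨_, measurableSet_spanningSets m n, _, measurableSet_spanningSets m n, rfl⟩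
  · intro n
    rw [hswap _ _ (measurableSet_spanningSets m n) (measurableSet_spanningSets m n),
      Measure.compProd_apply_prod (measurableSet_spanningSets m n) (measurableSet_spanningSets m n)]
    refine ne_of_lt (lt_of_le_of_lt (lintegral_mono (g := fun _ => 1) fun x => ?_) ?_)
    · exact (measure_mono (Set.subset_univ _)).trans (hκ.le_one x)
    · simpa using measure_spanningSets_lt_top m n
  · rintro _ ⟨A, hA, B, hB, rfl⟩
    exact hswap A B hA hB

lemma lintegral_mul_symm [SigmaFinite m] {g h : E → ℝ≥0∞} (hg : Measurable g) (hh : Measurable h) :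
    ∫⁻ x, g x * ∫⁻ y, h y ∂κ x ∂m = ∫⁻ x, h x * ∫⁻ y, g y ∂κ x ∂m := by
  have _ := hκ.isFiniteKernel
  have key : ∀ {g h : E → ℝ≥0∞}, Measurable g → Measurable h →
      ∫⁻ x, g x * ∫⁻ y, h y ∂κ x ∂m = ∫⁻ z, g z.1 * h z.2 ∂(m ⊗ₘ κ) := fun {g h} hg hh => by
    rw [Measure.lintegral_compProd (by fun_prop)]
    refine lintegral_congr fun x => ?_
    dsimp only
    rw [lintegral_const_mul _ hh]
  rw [key hg hh, key hh hg]
  nth_rw 1 [← hκ.map_swap]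
  rw [lintegral_map (by fun_prop) measurable_swap]
  exact lintegral_congr fun z => mul_comm _ _

/-- Symmetry transfers the kernel from `g` to the constant 1, where it is at most 1. -/
lemma lintegral_lintegral_le [SigmaFinite m] {g : E → ℝ≥0∞} (hg : Measurable g) :
    ∫⁻ x, ∫⁻ y, g y ∂κ x ∂m ≤ ∫⁻ x, g x ∂m := by
  have := hκ.lintegral_mul_symm (measurable_const (a := (1 : ℝ≥0∞))) hg
  simp only [one_mul, lintegral_one] at this
  rw [this]
  exact lintegral_mono fun x => mul_le_of_le_one_right' (hκ.le_one x)

lemma lintegral_rpow_le {g : E → ℝ≥0∞} (hg : Measurable g) {q : ℝ} (hq : 1 ≤ q) (x : E) :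
    (∫⁻ y, g y ∂κ x) ^ q ≤ ∫⁻ y, g y ^ q ∂κ x := by
  rcases hq.eq_or_lt with rfl | hq
  · simp
  have h := ENNReal.lintegral_mul_le_Lp_mul_Lq (κ x) (Real.HolderConjugate.conjExponent hq)
    hg.aemeasurable (aemeasurable_const (b := (1 : ℝ≥0∞)))
  simp only [Pi.mul_apply, mul_one, ENNReal.one_rpow, lintegral_one] at h
  have h2 : (κ x Set.univ) ^ (1 / q.conjExponent) ≤ 1 :=
    ENNReal.rpow_le_one (hκ.le_one x)
      (one_div_nonneg.2 (Real.HolderConjugate.conjExponent hq).symm.nonneg)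
  calc (∫⁻ y, g y ∂κ x) ^ q ≤ ((∫⁻ y, g y ^ q ∂κ x) ^ (1 / q)) ^ q :=
        ENNReal.rpow_le_rpow (h.trans (mul_le_of_le_one_right' h2)) (by linarith)
    _ = _ := by rw [← ENNReal.rpow_mul, one_div_mul_cancel (by linarith), ENNReal.rpow_one]

/-- This is what lets the kernel act on almost-everywhere classes: changing a function on an
`m`-null set changes its image only on an `m`-null set. -/
lemma ae_null [SigmaFinite m] {N : Set E} (hN : m N = 0) : ∀ᵐ x ∂m, κ x N = 0 := by
  have _ := hκ.isFiniteKernel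
  have hN' : m (toMeasurable m N) = 0 := by rwa [measure_toMeasurable]
  have hmeas := measurableSet_toMeasurable m N
  have h := hκ.lintegral_lintegral_le
    (g := (toMeasurable m N).indicator 1) (measurable_one.indicator hmeas)
  simp only [lintegral_indicator_one hmeas, hN'] at h
  have h0 := (lintegral_eq_zero_iff (κ.measurable_coe hmeas)).1 (le_antisymm h zero_le)
  filter_upwards [h0] with x hx
  exact measure_mono_null (subset_toMeasurable m N) hx

lemma ae_ae [SigmaFinite m] {p : E → Prop} (h : ∀ᵐ x ∂m, p x) : ∀ᵐ x ∂m, ∀ᵐ y ∂κ x, p y :=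
  hκ.ae_null h

lemma lintegral_enorm_rpow_le [SigmaFinite m] {f : E → ℝ} (hf : AEStronglyMeasurable f m) {q : ℝ}
    (hq : 1 ≤ q) : ∫⁻ x, (∫⁻ y, ‖f y‖ₑ ∂κ x) ^ q ∂m ≤ ∫⁻ x, ‖f x‖ₑ ^ q ∂m := by
  have hmk := hf.stronglyMeasurable_mk.measurable
  have e1 : ∫⁻ x, (∫⁻ y, ‖f y‖ₑ ∂κ x) ^ q ∂m = ∫⁻ x, (∫⁻ y, ‖hf.mk f y‖ₑ ∂κ x) ^ q ∂m := by
    refine lintegral_congr_ae ?_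
    filter_upwards [hκ.ae_ae hf.ae_eq_mk] with x hx
    congr 1
    refine lintegral_congr_ae ?_
    filter_upwards [hx] with y hy
    rw [hy]
  have e2 : ∫⁻ x, ‖f x‖ₑ ^ q ∂m = ∫⁻ x, ‖hf.mk f x‖ₑ ^ q ∂m := by
    refine lintegral_congr_ae ?_
    filter_upwards [hf.ae_eq_mk] with x hx
    rw [hx]
  rw [e1, e2]
  exact (lintegral_mono fun x => hκ.lintegral_rpow_le hmk.enorm hq x).trans
    (hκ.lintegral_lintegral_le (hmk.enorm.pow_const q))

lemma aestronglyMeasurable_integral [SigmaFinite m] {f : E → ℝ} (hf : AEStronglyMeasurable f m) :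
    AEStronglyMeasurable (fun x => ∫ y, f y ∂κ x) m := by
  have _ := hκ.isFiniteKernel
  refine ⟨fun x => ∫ y, hf.mk f y ∂κ x, ?_, ?_⟩
  · exact hf.stronglyMeasurable_mk.integral_kernel
  · filter_upwards [hκ.ae_ae hf.ae_eq_mk] with x hx
    exact integral_congr_ae hx

lemma ae_integrable_rpow [SigmaFinite m] {f : E → ℝ} {q : ℝ} (hq : 1 ≤ q)
    (hf : MemLp f (ENNReal.ofReal q) m) : ∀ᵐ x ∂m, MemLp f (ENNReal.ofReal q) (κ x) := by
  have _ := hκ.isFiniteKernel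
  have hq0 : ENNReal.ofReal q ≠ 0 := by simp; linarith
  have hmk := hf.1.stronglyMeasurable_mk.measurable
  have h1 : ∫⁻ x, ∫⁻ y, ‖hf.1.mk f y‖ₑ ^ q ∂κ x ∂m < ∞ := by
    refine (hκ.lintegral_lintegral_le (hmk.enorm.pow_const q)).trans_lt ?_
    have := lintegral_rpow_enorm_lt_top_of_eLpNorm_lt_top hq0 ENNReal.ofReal_ne_top
      ((memLp_congr_ae hf.1.ae_eq_mk).1 hf).2
    rwa [ENNReal.toReal_ofReal (by linarith)] at this
  have h2 := ae_lt_top (Measurable.lintegral_kernel (hmk.enorm.pow_const q)) h1.ne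
  filter_upwards [h2, hκ.ae_ae hf.1.ae_eq_mk] with x hx hx'
  refine (memLp_congr_ae hx').2 ⟨hf.1.stronglyMeasurable_mk.aestronglyMeasurable, ?_⟩
  rw [eLpNorm_lt_top_iff_lintegral_rpow_enorm_lt_top hq0 ENNReal.ofReal_ne_top,
    ENNReal.toReal_ofReal (by linarith)]
  exact hx

lemma eLpNorm_integral_le [SigmaFinite m] {f : E → ℝ} (hf : AEStronglyMeasurable f m) {q : ℝ}
    (hq : 1 ≤ q) : eLpNorm (fun x => ∫ y, f y ∂κ x) (ENNReal.ofReal q) m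
      ≤ eLpNorm f (ENNReal.ofReal q) m := by
  have hq0 : ENNReal.ofReal q ≠ 0 := by simp; linarith
  rw [eLpNorm_eq_lintegral_rpow_enorm_toReal hq0 ENNReal.ofReal_ne_top,
    eLpNorm_eq_lintegral_rpow_enorm_toReal hq0 ENNReal.ofReal_ne_top,
    ENNReal.toReal_ofReal (by linarith)]
  refine ENNReal.rpow_le_rpow (le_trans (lintegral_mono fun x => ?_)
    (hκ.lintegral_enorm_rpow_le hf hq)) (by positivity)
  exact ENNReal.rpow_le_rpow (enorm_integral_le_lintegral_enorm _) (by linarith)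

lemma memLp_integral [SigmaFinite m] {f : E → ℝ} {q : ℝ} (hq : 1 ≤ q)
    (hf : MemLp f (ENNReal.ofReal q) m) :
    MemLp (fun x => ∫ y, f y ∂κ x) (ENNReal.ofReal q) m :=
  ⟨hκ.aestronglyMeasurable_integral hf.1, (hκ.eLpNorm_integral_le hf.1 hq).trans_lt hf.2⟩

lemma integral_mul_eq_compProd [SigmaFinite m] {u v : E → ℝ} (hu : StronglyMeasurable u)
    (hv : StronglyMeasurable v) (hu2 : MemLp u 2 m) (hv2 : MemLp v 2 m) :
    ∫ x, v x * ∫ y, u y ∂κ x ∂m = ∫ z, v z.1 * u z.2 ∂(m ⊗ₘ κ) := by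
  have _ := hκ.isFiniteKernel
  have hmeas : AEStronglyMeasurable (fun z : E × E => v z.1 * u z.2) (m ⊗ₘ κ) := by
    have h1 := hu.measurable; have h2 := hv.measurable
    exact (by fun_prop : Measurable fun z : E × E => v z.1 * u z.2).aestronglyMeasurable
  have hint : Integrable (fun z : E × E => v z.1 * u z.2) (m ⊗ₘ κ) := by
    refine ⟨hmeas, ?_⟩
    rw [HasFiniteIntegral, Measure.lintegral_compProd (by
      have h1 := hu.measurable; have h2 := hv.measurable; fun_prop)]
    have e : ∀ x, ∫⁻ y, ‖v x * u y‖ₑ ∂κ x = ‖v x‖ₑ * ∫⁻ y, ‖u y‖ₑ ∂κ x := fun x => by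
      simp_rw [enorm_mul]; rw [lintegral_const_mul _ hu.measurable.enorm]
    simp_rw [e]
    have h := ENNReal.lintegral_mul_le_Lp_mul_Lq m Real.HolderConjugate.two_two
      hv.measurable.enorm.aemeasurable
      (Measurable.lintegral_kernel hu.measurable.enorm (κ := κ)).aemeasurable
    refine h.trans_lt (ENNReal.mul_lt_top ?_ ?_)
    · have := hv2.2
      rw [eLpNorm_eq_lintegral_rpow_enorm_toReal (by simp) (by simp)] at this
      simpa using this
    · have h1 := ENNReal.rpow_le_rpow (z := 1 / 2)
        (hκ.lintegral_enorm_rpow_le hu.aestronglyMeasurable one_le_two) (by norm_num)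
      refine h1.trans_lt ?_
      have := hu2.2
      rw [eLpNorm_eq_lintegral_rpow_enorm_toReal (by simp) (by simp)] at this
      simpa using this
  rw [Measure.integral_compProd hint]
  simp_rw [integral_const_mul]

lemma integral_mul_symm [SigmaFinite m] {u v : E → ℝ} (hu : StronglyMeasurable u)
    (hv : StronglyMeasurable v) (hu2 : MemLp u 2 m) (hv2 : MemLp v 2 m) :
    ∫ x, v x * ∫ y, u y ∂κ x ∂m = ∫ x, u x * ∫ y, v y ∂κ x ∂m := by
  rw [hκ.integral_mul_eq_compProd hu hv hu2 hv2, hκ.integral_mul_eq_compProd hv hu hv2 hu2]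
  nth_rw 1 [← hκ.map_swap]
  rw [integral_map measurable_swap.aemeasurable (by
    have h1 := hu.measurable; have h2 := hv.measurable
    exact (by fun_prop : Measurable fun z : E × E => v z.1 * u z.2).aestronglyMeasurable)]
  exact integral_congr_ae (ae_of_all _ fun z => mul_comm _ _)

/-- The contraction of `L²(m)` induced by a symmetric sub-Markovian kernel. -/
noncomputable def toL2 [SigmaFinite m] : Lp ℝ 2 m →L[ℝ] Lp ℝ 2 m :=
  LinearMap.mkContinuous
    { toFun := fun u => MemLp.toLp (fun x => ∫ y, u y ∂κ x)
        (by simpa using hκ.memLp_integral one_le_two (by simpa using Lp.memLp u))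
      map_add' := fun u v => by
        rw [← MemLp.toLp_add]
        refine (MemLp.toLp_eq_toLp_iff _ _).2 ?_
        filter_upwards [hκ.ae_ae (Lp.coeFn_add u v),
          hκ.ae_integrable_rpow one_le_two (by simpa using Lp.memLp u),
          hκ.ae_integrable_rpow one_le_two (by simpa using Lp.memLp v)] with x hx hu hv
        have _ := hκ.isFiniteKernel
        rw [Pi.add_apply, ← integral_add (hu.integrable (by simp)) (hv.integrable (by simp))]
        exact integral_congr_ae hx
      map_smul' := fun c u => by
        rw [RingHom.id_apply, ← MemLp.toLp_const_smul]
        refine (MemLp.toLp_eq_toLp_iff _ _).2 ?_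
        filter_upwards [hκ.ae_ae (Lp.coeFn_smul c u)] with x hx
        rw [Pi.smul_apply, ← integral_smul]
        exact integral_congr_ae hx } 1 fun u => by
    rw [one_mul]
    simp only [LinearMap.coe_mk, AddHom.coe_mk]
    rw [Lp.norm_toLp, Lp.norm_def]
    refine ENNReal.toReal_mono (Lp.eLpNorm_ne_top u) ?_
    simpa using hκ.eLpNorm_integral_le (Lp.aestronglyMeasurable u) one_le_two

lemma coeFn_toL2 [SigmaFinite m] (u : Lp ℝ 2 m) :
    hκ.toL2 u =ᵐ[m] fun x => ∫ y, u y ∂κ x := by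
  simp only [toL2, LinearMap.mkContinuous_apply, LinearMap.coe_mk, AddHom.coe_mk]
  exact MemLp.coeFn_toLp _

lemma norm_toL2_le [SigmaFinite m] (u : Lp ℝ 2 m) : ‖hκ.toL2 u‖ ≤ ‖u‖ := by
  have := (hκ.toL2).le_of_opNorm_le (LinearMap.mkContinuous_norm_le _ zero_le_one _) u
  simpa using this

lemma toL2_symm [SigmaFinite m] (u v : Lp ℝ 2 m) :
    inner ℝ (hκ.toL2 u) v = inner ℝ u (hκ.toL2 v) := by
  rw [L2.inner_def, L2.inner_def]
  have e1 : ∫ x, inner ℝ (hκ.toL2 u x) (v x) ∂m = ∫ x, v x * ∫ y, u y ∂κ x ∂m := by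
    refine integral_congr_ae ?_
    filter_upwards [hκ.coeFn_toL2 u] with x hx
    rw [hx, Real.inner_apply, mul_comm]
  have e2 : ∫ x, inner ℝ (u x) (hκ.toL2 v x) ∂m = ∫ x, u x * ∫ y, v y ∂κ x ∂m := by
    refine integral_congr_ae ?_
    filter_upwards [hκ.coeFn_toL2 v] with x hx
    rw [hx, Real.inner_apply]
  rw [e1, e2]
  exact hκ.integral_mul_symm (Lp.stronglyMeasurable u) (Lp.stronglyMeasurable v)
    (Lp.memLp u) (Lp.memLp v)

end IsSymmSubMarkov
end SymmKernel

/-! ### The `L²` semigroup of the transition function -/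

section Semigroup
variable {E : Type*} [MeasurableSpace E] {m : Measure E} {P : Kernel (ℝ≥0 × E) E}

/-- The kernel `P_t(x, dy)` for a fixed time `t`. -/
noncomputable def timeSlice (P : Kernel (ℝ≥0 × E) E) (t : ℝ≥0) : Kernel E E :=
  P.comap (fun x => (t, x)) measurable_prodMk_left

lemma timeSlice_apply (t : ℝ≥0) (x : E) : timeSlice P t x = P (t, x) := rfl

namespace IsSymmTransitionFunction
variable (hP : IsSymmTransitionFunction m P)
include hP

lemma isFiniteKernel : IsFiniteKernel P := ⟨1, ENNReal.one_lt_top, fun z => hP.sub_markov z.1 z.2⟩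

lemma slice (t : ℝ≥0) : IsSymmSubMarkov m (timeSlice P t) := ⟨hP.sub_markov t, hP.symm t⟩

lemma comp_eq (s t : ℝ≥0) (x : E) :
    P (s + t, x) = (timeSlice P t ∘ₖ timeSlice P s) x := by
  rw [Kernel.comp_apply]
  ext A hA
  rw [hP.chapman_kolmogorov s t x A hA, Measure.bind_apply hA (Kernel.aemeasurable _)]
  rfl

lemma lintegral_add (s t : ℝ≥0) (x : E) {g : E → ℝ≥0∞} (hg : Measurable g) :
    ∫⁻ y, g y ∂P (s + t, x) = ∫⁻ y, ∫⁻ z, g z ∂P (t, y) ∂P (s, x) := by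
  rw [hP.comp_eq, Kernel.comp_apply, Measure.lintegral_bind (Kernel.aemeasurable _) hg.aemeasurable]
  rfl

lemma integral_add (s t : ℝ≥0) (x : E) {f : E → ℝ} (hf : Integrable f (P (s + t, x))) :
    semigroup P (s + t) f x = semigroup P s (semigroup P t f) x := by
  have _ := (hP.slice t).isFiniteKernel
  have _ := (hP.slice s).isFiniteKernel
  rw [hP.comp_eq] at hf
  rw [semigroup, hP.comp_eq, Kernel.integral_comp hf]
  rfl

lemma semigroup_add [SigmaFinite m] {f : E → ℝ} {q : ℝ} (hq : 1 ≤ q)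
    (hf : MemLp f (ENNReal.ofReal q) m) (s t : ℝ≥0) :
    semigroup P (s + t) f =ᵐ[m] semigroup P s (semigroup P t f) := by
  filter_upwards [(hP.slice (s + t)).ae_integrable_rpow hq hf] with x hx
  have _ := (hP.slice (s + t)).isFiniteKernel
  exact hP.integral_add s t x (hx.integrable (by simpa using hq))

/-- The operators `P_t` on `L²(m)`. -/
noncomputable def opL2 [SigmaFinite m] (t : ℝ≥0) : Lp ℝ 2 m →L[ℝ] Lp ℝ 2 m := (hP.slice t).toL2

lemma coeFn_opL2 [SigmaFinite m] (t : ℝ≥0) (u : Lp ℝ 2 m) :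
    hP.opL2 t u =ᵐ[m] semigroup P t u := (hP.slice t).coeFn_toL2 u

lemma semigroup_congr_ae [SigmaFinite m] (t : ℝ≥0) {f g : E → ℝ} (h : f =ᵐ[m] g) :
    semigroup P t f =ᵐ[m] semigroup P t g := by
  filter_upwards [(hP.slice t).ae_ae h] with x hx
  exact integral_congr_ae hx

lemma opL2_toLp [SigmaFinite m] (t : ℝ≥0) {f : E → ℝ} (hf : MemLp f 2 m) :
    hP.opL2 t (hf.toLp f) =ᵐ[m] semigroup P t f :=
  (hP.coeFn_opL2 t _).trans (hP.semigroup_congr_ae t hf.coeFn_toLp)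

lemma energyGap_eq_integral [SigmaFinite m] (u : Lp ℝ 2 m) (t : ℝ≥0) :
    energyGap hP.opL2 u t = ∫ x, (u x - semigroup P t u x) * u x ∂m := by
  rw [energyGap, L2.inner_def]
  refine integral_congr_ae ?_
  filter_upwards [Lp.coeFn_sub u (hP.opL2 t u), hP.coeFn_opL2 t u] with x h1 h2
  rw [h1, Real.inner_apply, Pi.sub_apply, h2]

/-- The `L²` semigroup of a transition function associated with a Dirichlet form is strongly
continuous. -/
lemma isSymmContractionSemigroup [SigmaFinite m] {𝓔 : DirichletForm m} (h𝓔 : 𝓔.IsAssociated P) :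
    IsSymmContractionSemigroup hP.opL2 where
  zero u := by
    refine Lp.ext ((hP.coeFn_opL2 0 u).trans (ae_of_all _ fun x => ?_))
    rw [semigroup, hP.zero, integral_dirac' _ _ (Lp.stronglyMeasurable u)]
  add s t u := by
    refine Lp.ext ((hP.coeFn_opL2 _ u).trans (EventuallyEq.trans ?_ (hP.coeFn_opL2 s _).symm))
    exact (hP.semigroup_add one_le_two (by simpa using Lp.memLp u) s t).trans
      (hP.semigroup_congr_ae s (hP.coeFn_opL2 t u).symm)
  symm t u v := (hP.slice t).toL2_symm u v
  contraction t u := (hP.slice t).norm_toL2_le u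
  tendsto_zero := by
    have hc : ∀ t u, ‖hP.opL2 t u‖ ≤ ‖u‖ := fun t u => (hP.slice t).norm_toL2_le u
    have hdom : ∀ u ∈ 𝓔.domain, Tendsto (fun t => hP.opL2 t u) (𝓝[>] 0) (𝓝 u) := by
      intro u hu
      have h1 := h𝓔.tendsto_form ⟨u, hu⟩ ⟨u, hu⟩
      have h2 : Tendsto (fun t : ℝ≥0 => (t : ℝ)) (𝓝[>] 0) (𝓝 0) :=
        (NNReal.continuous_coe.tendsto 0).mono_left nhdsWithin_le_nhds
      have h3 := (h2.mul h1).const_mul 2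
      simp only [zero_mul, mul_zero] at h3
      rw [tendsto_iff_norm_sub_tendsto_zero]
      -- Contractivity gives `‖S_t u - u‖² ≤ 2 ⟨u - S_t u, u⟩`, which is `2t` times a quotient with
      -- a finite limit when `u` is in the domain. Density of the domain then gives strong
      -- continuity on all of `L²`.
      have h4 : Tendsto (fun t : ℝ≥0 => ‖hP.opL2 t u - u‖ ^ 2) (𝓝[>] 0) (𝓝 0) := by
        refine squeeze_zero' (Eventually.of_forall fun t => sq_nonneg _) ?_ h3
        filter_upwards [self_mem_nhdsWithin] with t ht
        have ht : (t : ℝ) ≠ 0 := by exact_mod_cast (Set.mem_Ioi.1 ht).ne'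
        rw [← mul_assoc (t : ℝ), mul_one_div_cancel ht, one_mul, ← hP.energyGap_eq_integral,
          energyGap, inner_sub_left, real_inner_self_eq_norm_sq, @norm_sub_sq ℝ]
        have := pow_le_pow_left₀ (norm_nonneg _) (hc t u) 2
        simp only [RCLike.re_to_real]
        linarith
      have h5 := h4.sqrt
      simpa using h5
    intro u
    rw [Metric.tendsto_nhds]
    intro ε hε
    obtain ⟨v, hv, hvε⟩ := Metric.mem_closure_iff.1 (𝓔.dense u) (ε / 3) (by positivity)
    filter_upwards [Metric.tendsto_nhds.1 (hdom v hv) (ε / 3) (by positivity)] with t ht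
    rw [dist_eq_norm] at *
    have h1 := hc t (u - v)
    have e : hP.opL2 t u - u = hP.opL2 t (u - v) + (hP.opL2 t v - v) - (u - v) := by
      rw [map_sub]; abel
    rw [e]
    have h2 := norm_sub_le (hP.opL2 t (u - v) + (hP.opL2 t v - v)) (u - v)
    have h3 := norm_add_le (hP.opL2 t (u - v)) (hP.opL2 t v - v)
    linarith

end IsSymmTransitionFunction
end Semigroup

/-! ### The dyadic maximal ergodic inequality in `L²` -/

section MaximalAverages
variable {E : Type*} [MeasurableSpace E] {m : Measure E}

lemma sq_lintegral_mul_le {g h : E → ℝ≥0∞} (hg : Measurable g) (hh : Measurable h) :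
    (∫⁻ x, g x * h x ∂m) ^ 2 ≤ (∫⁻ x, g x ^ 2 ∂m) * ∫⁻ x, h x ^ 2 ∂m := by
  have h1 := ENNReal.lintegral_mul_le_Lp_mul_Lq m Real.HolderConjugate.two_two hg.aemeasurable
    hh.aemeasurable
  simp only [Pi.mul_apply, ENNReal.rpow_two] at h1
  refine (pow_le_pow_left' h1 2).trans_eq ?_
  rw [mul_pow, ← ENNReal.rpow_two, ← ENNReal.rpow_two, ← ENNReal.rpow_mul, ← ENNReal.rpow_mul]
  norm_num

/-- The arithmetic mean of the first `N` kernels of a sequence. -/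
noncomputable def avgKernel (κ : ℕ → Kernel E E) (N : ℕ) : Kernel E E where
  toFun x := (N : ℝ≥0∞)⁻¹ • ∑ i ∈ Finset.range N, κ i x
  measurable' := by
    refine Measure.measurable_of_measurable_coe _ fun s hs => ?_
    simp only [Measure.smul_apply, Measure.coe_finsetSum, Finset.sum_apply, smul_eq_mul]
    exact (Finset.measurable_fun_sum _ fun i _ => (κ i).measurable_coe hs).const_mul _

variable {κ : ℕ → Kernel E E}

lemma avgKernel_apply (N : ℕ) (x : E) :
    avgKernel κ N x = (N : ℝ≥0∞)⁻¹ • ∑ i ∈ Finset.range N, κ i x := rfl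

lemma lintegral_avgKernel (N : ℕ) (g : E → ℝ≥0∞) (x : E) :
    ∫⁻ y, g y ∂avgKernel κ N x = (N : ℝ≥0∞)⁻¹ * ∑ i ∈ Finset.range N, ∫⁻ y, g y ∂κ i x := by
  rw [avgKernel_apply, lintegral_smul_measure, lintegral_finsetSum_measure, smul_eq_mul]

lemma IsSymmSubMarkov.avgKernel (hκ : ∀ n, IsSymmSubMarkov m (κ n)) (N : ℕ) :
    IsSymmSubMarkov m (avgKernel κ N) where
  le_one x := by
    simp only [avgKernel_apply, Measure.smul_apply, Measure.coe_finsetSum, Finset.sum_apply,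
      smul_eq_mul]
    calc _ ≤ (N : ℝ≥0∞)⁻¹ * ∑ i ∈ Finset.range N, 1 := by
          gcongr with i; exact (hκ i).le_one x
      _ ≤ 1 := by simp [ENNReal.inv_mul_le_one]
  symm A B hA hB := by
    simp only [avgKernel_apply, Measure.smul_apply, Measure.coe_finsetSum, Finset.sum_apply,
      smul_eq_mul]
    rw [lintegral_const_mul _ (Finset.measurable_fun_sum _ fun i _ => (κ i).measurable_coe hB),
      lintegral_const_mul _ (Finset.measurable_fun_sum _ fun i _ => (κ i).measurable_coe hA),
      lintegral_finsetSum _ fun i _ => (κ i).measurable_coe hB,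
      lintegral_finsetSum _ fun i _ => (κ i).measurable_coe hA]
    congr 1
    exact Finset.sum_congr rfl fun i _ => (hκ i).symm A B hA hB

/-- For each fixed `i < a ≤ b` the indices `i + j` are distinct and below `2 * b`. -/
lemma sum_sum_add_le (G : ℕ → ℝ≥0∞) {a b : ℕ} (hab : a ≤ b) :
    ∑ i ∈ Finset.range a, ∑ j ∈ Finset.range b, G (i + j)
      ≤ a * ∑ k ∈ Finset.range (2 * b), G k := by
  calc _ ≤ ∑ i ∈ Finset.range a, ∑ k ∈ Finset.range (2 * b), G k := by
        refine Finset.sum_le_sum fun i hi => ?_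
        rw [← Finset.sum_image (s := Finset.range b) (g := fun j => i + j) (f := G)
          (fun x _ y _ h => by simpa using h)]
        refine Finset.sum_le_sum_of_subset fun k hk => ?_
        simp only [Finset.mem_image, Finset.mem_range] at hk hi ⊢
        omega
    _ = _ := by simp

lemma inv_mul_inv_mul_le (a b : ℕ) (S : ℝ≥0∞) :
    (a : ℝ≥0∞)⁻¹ * ((b : ℝ≥0∞)⁻¹ * (a * S)) ≤ 2 * (((2 * b : ℕ) : ℝ≥0∞)⁻¹ * S) := by
  have e : (2 : ℝ≥0∞) * ((2 * b : ℕ) : ℝ≥0∞)⁻¹ = (b : ℝ≥0∞)⁻¹ := by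
    push_cast
    rw [ENNReal.mul_inv (by simp) (by simp), ← mul_assoc,
      ENNReal.mul_inv_cancel (by simp) (by simp),
      one_mul]
  rw [← mul_assoc 2, e]
  calc _ = ((a : ℝ≥0∞)⁻¹ * a) * ((b : ℝ≥0∞)⁻¹ * S) := by ring
    _ ≤ _ := mul_le_of_le_one_left' (ENNReal.inv_mul_le_one _)

/-- The pointwise bound on the product of two averages behind the `T T*` argument. -/
lemma lintegral_avgKernel_avgKernel_le
    (hadd : ∀ i j x, ∀ g : E → ℝ≥0∞, Measurable g →
      ∫⁻ y, g y ∂κ (i + j) x = ∫⁻ y, ∫⁻ z, g z ∂κ j y ∂κ i x)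
    (a b : ℕ) {g : E → ℝ≥0∞} (hg : Measurable g) (x : E) :
    ∫⁻ y, ∫⁻ z, g z ∂avgKernel κ b y ∂avgKernel κ a x
      ≤ 2 * ∫⁻ y, g y ∂avgKernel κ (2 * b) x + 2 * ∫⁻ y, g y ∂avgKernel κ (2 * a) x := by
  have e : ∫⁻ y, ∫⁻ z, g z ∂avgKernel κ b y ∂avgKernel κ a x
      = (a : ℝ≥0∞)⁻¹ * ((b : ℝ≥0∞)⁻¹ *
        ∑ i ∈ Finset.range a, ∑ j ∈ Finset.range b, ∫⁻ y, g y ∂κ (i + j) x) := by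
    rw [lintegral_avgKernel]
    congr 1
    rw [Finset.mul_sum]
    refine Finset.sum_congr rfl fun i _ => ?_
    simp_rw [lintegral_avgKernel]
    rw [lintegral_const_mul _ (Finset.measurable_fun_sum _ fun j _ => hg.lintegral_kernel),
      lintegral_finsetSum _ fun j _ => hg.lintegral_kernel]
    congr 1
    exact Finset.sum_congr rfl fun j _ => (hadd i j x g hg).symm
  rw [e, lintegral_avgKernel, lintegral_avgKernel]
  rcases le_total a b with hab | hab
  · refine le_trans ?_ le_self_add
    refine le_trans ?_ (inv_mul_inv_mul_le a b _)
    gcongr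
    exact sum_sum_add_le (fun k => ∫⁻ y, g y ∂κ k x) hab
  · refine le_trans ?_ le_add_self
    rw [← mul_assoc, mul_comm (a : ℝ≥0∞)⁻¹, mul_assoc]
    refine le_trans ?_ (inv_mul_inv_mul_le b a _)
    gcongr
    rw [Finset.sum_comm]
    refine le_trans (le_of_eq ?_) (sum_sum_add_le (fun k => ∫⁻ y, g y ∂κ k x) hab)
    simp_rw [add_comm]

/-- The maximal function of the averages of lengths `1, 2, 4, …, 2^K`. -/
noncomputable def maxAvg (κ : ℕ → Kernel E E) (K : ℕ) (g : E → ℝ≥0∞) (x : E) : ℝ≥0∞ :=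
  (Finset.range (K + 1)).sup fun k => ∫⁻ y, g y ∂avgKernel κ (2 ^ k) x

lemma measurable_maxAvg (K : ℕ) {g : E → ℝ≥0∞} (hg : Measurable g) : Measurable (maxAvg κ K g) := by
  have : maxAvg κ K g = fun x =>
      ⨆ k ∈ Finset.range (K + 1), ∫⁻ y, g y ∂avgKernel κ (2 ^ k) x := by
    ext x; rw [maxAvg, Finset.sup_eq_iSup]
  rw [this]
  exact Measurable.iSup fun k => Measurable.iSup fun _ => hg.lintegral_kernel

lemma le_maxAvg {k K : ℕ} (hk : k ≤ K) (g : E → ℝ≥0∞) (x : E) :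
    ∫⁻ y, g y ∂avgKernel κ (2 ^ k) x ≤ maxAvg κ K g x :=
  Finset.le_sup (f := fun k => ∫⁻ y, g y ∂avgKernel κ (2 ^ k) x)
    (Finset.mem_range.2 (Nat.lt_succ_of_le hk))

lemma maxAvg_mono {K L : ℕ} (h : K ≤ L) (g : E → ℝ≥0∞) (x : E) :
    maxAvg κ K g x ≤ maxAvg κ L g x :=
  Finset.sup_mono (Finset.range_subset_range.2 (by omega))

lemma lintegral_avgKernel_sq_le [SigmaFinite m] (hκ : ∀ n, IsSymmSubMarkov m (κ n)) (N : ℕ)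
    {g : E → ℝ≥0∞} (hg : Measurable g) :
    ∫⁻ x, (∫⁻ y, g y ∂avgKernel κ N x) ^ 2 ∂m ≤ ∫⁻ x, g x ^ 2 ∂m := by
  have h := IsSymmSubMarkov.avgKernel hκ N
  have h1 : ∀ x, (∫⁻ y, g y ∂avgKernel κ N x) ^ 2 ≤ ∫⁻ y, g y ^ 2 ∂avgKernel κ N x := fun x => by
    simpa only [ENNReal.rpow_two] using h.lintegral_rpow_le hg one_le_two x
  exact (lintegral_mono h1).trans (h.lintegral_lintegral_le (hg.pow_const 2))

/-- The square of a maximum is at most the sum of the squares, and one average is an `L²`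
contraction. This crude step feeds the `T T*` step, which asks for a bound on a longer maximal
function. -/
lemma lintegral_maxAvg_succ_sq_le [SigmaFinite m] (hκ : ∀ n, IsSymmSubMarkov m (κ n)) (K : ℕ)
    {g : E → ℝ≥0∞} (hg : Measurable g) :
    ∫⁻ x, maxAvg κ (K + 1) g x ^ 2 ∂m ≤ ∫⁻ x, maxAvg κ K g x ^ 2 ∂m + ∫⁻ x, g x ^ 2 ∂m := by
  have h1 : ∀ x, maxAvg κ (K + 1) g x ^ 2
      ≤ maxAvg κ K g x ^ 2 + (∫⁻ y, g y ∂avgKernel κ (2 ^ (K + 1)) x) ^ 2 := fun x => by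
    have : maxAvg κ (K + 1) g x = (∫⁻ y, g y ∂avgKernel κ (2 ^ (K + 1)) x) ⊔ maxAvg κ K g x := by
      rw [maxAvg, Finset.range_add_one, Finset.sup_insert]; rfl
    rw [this]
    rcases le_total (∫⁻ y, g y ∂avgKernel κ (2 ^ (K + 1)) x) (maxAvg κ K g x) with h | h
    · rw [sup_eq_right.2 h]; exact le_self_add
    · rw [sup_eq_left.2 h]; exact le_add_self
  refine (lintegral_mono h1).trans ?_
  rw [lintegral_add_left ((measurable_maxAvg K hg).pow_const 2)]
  exact add_le_add le_rfl (lintegral_avgKernel_sq_le hκ _ hg)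

/-- Linearises the maximal operator: with a measurable choice of the maximising exponent it becomes
linear in `g` and has an adjoint. -/
lemma exists_selector (K : ℕ) {g : E → ℝ≥0∞} (hg : Measurable g) :
    ∃ n : E → ℕ, Measurable n ∧ (∀ x, n x < K + 1) ∧
      ∀ x, ∫⁻ y, g y ∂avgKernel κ (2 ^ n x) x = maxAvg κ K g x := by
  classical
  have hex : ∀ x, ∃ k, k < K + 1 ∧ ∫⁻ y, g y ∂avgKernel κ (2 ^ k) x = maxAvg κ K g x := fun x => by
    obtain ⟨k, hk, h⟩ := Finset.exists_mem_eq_sup (Finset.range (K + 1)) (by simp)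
      (fun k => ∫⁻ y, g y ∂avgKernel κ (2 ^ k) x)
    exact ⟨k, Finset.mem_range.1 hk, h.symm⟩
  refine ⟨fun x => Nat.find (hex x), measurable_find hex fun k => ?_,
    fun x => (Nat.find_spec (hex x)).1, fun x => (Nat.find_spec (hex x)).2⟩
  exact (MeasurableSet.const _).inter
    (measurableSet_eq_fun hg.lintegral_kernel (measurable_maxAvg K hg))

/-- The `T T*` step: a bound for the longer maximal function improves the one for the shorter. -/
lemma lintegral_maxAvg_sq_le_of_succ [SigmaFinite m] (hκ : ∀ n, IsSymmSubMarkov m (κ n))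
    (hadd : ∀ i j x, ∀ g : E → ℝ≥0∞, Measurable g →
      ∫⁻ y, g y ∂κ (i + j) x = ∫⁻ y, ∫⁻ z, g z ∂κ j y ∂κ i x) (K : ℕ) {c : ℝ≥0}
    (hc : ∀ g : E → ℝ≥0∞, Measurable g →
      ∫⁻ x, maxAvg κ (K + 1) g x ^ 2 ∂m ≤ c ^ 2 * ∫⁻ x, g x ^ 2 ∂m)
    {g : E → ℝ≥0∞} (hg : Measurable g) :
    ∫⁻ x, maxAvg κ K g x ^ 2 ∂m ≤ 4 * c * ∫⁻ x, g x ^ 2 ∂m := by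
  rcases eq_or_ne (∫⁻ x, maxAvg κ K g x ^ 2 ∂m) 0 with h0 | h0
  · rw [h0]; exact zero_le
  rcases eq_or_ne (∫⁻ x, g x ^ 2 ∂m) ∞ with htop | htop
  · rcases eq_or_ne c 0 with rfl | hc0
    · refine (lintegral_mono fun x => pow_le_pow_left' (maxAvg_mono (Nat.le_succ K) g x) 2).trans ?_
      simpa using hc g hg
    · rw [htop, ENNReal.mul_top (by simpa using hc0)]; exact le_top
  have hM := measurable_maxAvg (κ := κ) K hg
  have hMtop : ∫⁻ x, maxAvg κ K g x ^ 2 ∂m ≠ ∞ := by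
    refine ne_top_of_le_ne_top ?_
      ((lintegral_mono fun x => pow_le_pow_left' (maxAvg_mono (Nat.le_succ K) g x) 2).trans
        (hc g hg))
    exact ENNReal.mul_ne_top (by simp) htop
  obtain ⟨n, hn, hnK, hnM⟩ := exists_selector (κ := κ) K hg
  set M := maxAvg κ K g with hMdef
  let Q : ℕ → Kernel E E := fun k => avgKernel κ (2 ^ k)
  have hQ : ∀ k, IsSymmSubMarkov m (Q k) := fun k => IsSymmSubMarkov.avgKernel hκ _
  -- `M` is cut according to the selected exponent. With `T g (x)` the average of length `2 ^ n x`,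
  -- the function `h` below is `T* M`, and `e1` is the duality `⟨T g, M⟩ = ⟨g, T* M⟩`.
  let N : ℕ → E → ℝ≥0∞ := fun k x => if n x = k then M x else 0
  have hN : ∀ k, Measurable (N k) := fun k =>
    Measurable.ite (hn (measurableSet_singleton k)) hM measurable_const
  have hNsum : ∀ x, ∑ k ∈ Finset.range (K + 1), N k x = M x := fun x => by
    simp [N, hnK x]
  have hQN : ∀ k l, Measurable fun x => ∫⁻ y, N l y ∂Q k x := fun k l => (hN l).lintegral_kernel
  let h : E → ℝ≥0∞ := fun x => ∑ k ∈ Finset.range (K + 1), ∫⁻ y, N k y ∂Q k x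
  have hh : Measurable h := Finset.measurable_fun_sum _ fun k _ => hQN k k
  have e1 : ∫⁻ x, M x ^ 2 ∂m = ∫⁻ x, g x * h x ∂m := by
    have e : ∀ x, M x ^ 2 = ∑ k ∈ Finset.range (K + 1), N k x * ∫⁻ y, g y ∂Q k x := fun x => by
      have : ∀ k, N k x * ∫⁻ y, g y ∂Q k x = N k x * M x := fun k => by
        by_cases hk : n x = k
        · simp only [N, hk, if_true, Q]
          rw [← hk, hnM x]
        · simp [N, hk]
      simp_rw [this]
      rw [← Finset.sum_mul, hNsum, sq]
    simp_rw [e, h, Finset.mul_sum]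
    rw [lintegral_finsetSum _ fun k _ => (hN k).fun_mul hg.lintegral_kernel,
      lintegral_finsetSum _ fun k _ => hg.fun_mul (hQN k k)]
    exact Finset.sum_congr rfl fun k _ => (hQ k).lintegral_mul_symm (hN k) hg
  -- `‖T* M‖² = ⟨M, T T* M⟩` is a double sum over products of two averages. Each product is
  -- dominated by averages of doubled length; summing over the free index rebuilds `M`. The doubling
  -- is why the hypothesis concerns `K + 1`.
  have e2 : ∫⁻ x, h x ^ 2 ∂m ≤ 4 * ∫⁻ x, M x * maxAvg κ (K + 1) M x ∂m := by
    have a1 : ∫⁻ x, h x ^ 2 ∂m = ∑ k ∈ Finset.range (K + 1), ∑ l ∈ Finset.range (K + 1),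
        ∫⁻ x, N l x * ∫⁻ y, ∫⁻ z, N k z ∂Q k y ∂Q l x ∂m := by
      simp_rw [sq, h, Finset.sum_mul_sum]
      rw [lintegral_finsetSum _ fun k _ => Finset.measurable_fun_sum _ fun l _ =>
        (hQN k k).fun_mul (hQN l l)]
      refine Finset.sum_congr rfl fun k _ => ?_
      rw [lintegral_finsetSum _ fun l _ => (hQN k k).fun_mul (hQN l l)]
      exact Finset.sum_congr rfl fun l _ => (hQ l).lintegral_mul_symm (hQN k k) (hN l)
    have a2 : ∀ k l, ∫⁻ x, N l x * ∫⁻ y, ∫⁻ z, N k z ∂Q k y ∂Q l x ∂m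
        ≤ 2 * ∫⁻ x, N k x * ∫⁻ y, N l y ∂Q (k + 1) x ∂m
          + 2 * ∫⁻ x, N l x * ∫⁻ y, N k y ∂Q (l + 1) x ∂m := fun k l => by
      rw [(hQ (k + 1)).lintegral_mul_symm (hN k) (hN l),
        ← lintegral_const_mul _ ((hN l).fun_mul (hQN _ k)),
        ← lintegral_const_mul _ ((hN l).fun_mul (hQN _ k)),
        ← lintegral_add_left (((hN l).fun_mul (hQN _ k)).const_mul 2)]
      refine lintegral_mono fun x => ?_
      have := lintegral_avgKernel_avgKernel_le hadd (2 ^ l) (2 ^ k)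
        (hN k) x
      rw [← pow_succ', ← pow_succ'] at this
      calc _ ≤ N l x * _ := mul_le_mul_right this _
        _ = _ := by simp only [Q]; ring
    have a3 : ∑ k ∈ Finset.range (K + 1), ∑ l ∈ Finset.range (K + 1),
        ∫⁻ x, N k x * ∫⁻ y, N l y ∂Q (k + 1) x ∂m ≤ ∫⁻ x, M x * maxAvg κ (K + 1) M x ∂m := by
      calc _ = ∑ k ∈ Finset.range (K + 1), ∫⁻ x, N k x * ∫⁻ y, M y ∂Q (k + 1) x ∂m := by
            refine Finset.sum_congr rfl fun k _ => ?_
            rw [← lintegral_finsetSum _ fun l _ => (hN k).fun_mul (hQN _ l)]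
            refine lintegral_congr fun x => ?_
            rw [← Finset.mul_sum, ← lintegral_finsetSum _ fun l _ => hN l]
            simp_rw [hNsum]
        _ ≤ ∑ k ∈ Finset.range (K + 1), ∫⁻ x, N k x * maxAvg κ (K + 1) M x ∂m := by
            refine Finset.sum_le_sum fun k hk => lintegral_mono fun x => ?_
            gcongr
            exact le_maxAvg (by have := Finset.mem_range.1 hk; omega) M x
        _ = _ := by
            rw [← lintegral_finsetSum _ fun k _ => (hN k).fun_mul (measurable_maxAvg _ hM)]
            refine lintegral_congr fun x => ?_
            rw [← Finset.sum_mul, hNsum]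
    rw [a1]
    calc _ ≤ ∑ k ∈ Finset.range (K + 1), ∑ l ∈ Finset.range (K + 1),
          (2 * ∫⁻ x, N k x * ∫⁻ y, N l y ∂Q (k + 1) x ∂m
            + 2 * ∫⁻ x, N l x * ∫⁻ y, N k y ∂Q (l + 1) x ∂m) := by gcongr; exact a2 _ _
      _ = 2 * ∑ k ∈ Finset.range (K + 1), ∑ l ∈ Finset.range (K + 1),
            ∫⁻ x, N k x * ∫⁻ y, N l y ∂Q (k + 1) x ∂m
          + 2 * ∑ k ∈ Finset.range (K + 1), ∑ l ∈ Finset.range (K + 1),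
            ∫⁻ x, N k x * ∫⁻ y, N l y ∂Q (k + 1) x ∂m := by
          simp_rw [Finset.sum_add_distrib, Finset.mul_sum]
          congr 1
          rw [Finset.sum_comm]
      _ ≤ 2 * ∫⁻ x, M x * maxAvg κ (K + 1) M x ∂m + 2 * ∫⁻ x, M x * maxAvg κ (K + 1) M x ∂m := by
          gcongr
      _ = _ := by rw [← two_mul, ← mul_assoc]; norm_num
  have e3 : ∫⁻ x, M x * maxAvg κ (K + 1) M x ∂m ≤ c * ∫⁻ x, M x ^ 2 ∂m := by
    have := (sq_lintegral_mul_le hM (measurable_maxAvg (κ := κ) (K + 1) hM)).trans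
      (mul_le_mul_right (hc M hM) _)
    have h2 : (∫⁻ x, M x * maxAvg κ (K + 1) M x ∂m) ^ 2 ≤ (c * ∫⁻ x, M x ^ 2 ∂m) ^ 2 :=
      this.trans_eq (by ring)
    exact (ENNReal.pow_le_pow_left_iff two_ne_zero).1 h2
  have e4 : (∫⁻ x, M x ^ 2 ∂m) ^ 2
      ≤ (∫⁻ x, g x ^ 2 ∂m) * (4 * (c * ∫⁻ x, M x ^ 2 ∂m)) := by
    calc (∫⁻ x, M x ^ 2 ∂m) ^ 2 ≤ (∫⁻ x, g x ^ 2 ∂m) * ∫⁻ x, h x ^ 2 ∂m := by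
          rw [e1]; exact sq_lintegral_mul_le hg hh
      _ ≤ _ := by gcongr; exact e2.trans (by gcongr)
  have e5 : (∫⁻ x, M x ^ 2 ∂m) * ∫⁻ x, M x ^ 2 ∂m
      ≤ (4 * c * ∫⁻ x, g x ^ 2 ∂m) * ∫⁻ x, M x ^ 2 ∂m := by
    rw [← sq]; exact e4.trans_eq (by ring)
  -- Cancelling `∫ M²` is legitimate because it is nonzero and, through the assumed bound on the
  -- longer maximal function, finite.
  exact (ENNReal.mul_le_mul_iff_left h0 hMtop).1 e5

/-- The dyadic maximal ergodic inequality in `L²` for symmetric sub-Markovian semigroups. -/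
theorem lintegral_maxAvg_sq_le [SigmaFinite m] (hκ : ∀ n, IsSymmSubMarkov m (κ n))
    (hadd : ∀ i j x, ∀ g : E → ℝ≥0∞, Measurable g →
      ∫⁻ y, g y ∂κ (i + j) x = ∫⁻ y, ∫⁻ z, g z ∂κ j y ∂κ i x) (K : ℕ)
    {g : E → ℝ≥0∞} (hg : Measurable g) :
    ∫⁻ x, maxAvg κ K g x ^ 2 ∂m ≤ 23 * ∫⁻ x, g x ^ 2 ∂m := by
  induction K generalizing g with
  | zero =>
    have : ∀ x, maxAvg κ 0 g x = ∫⁻ y, g y ∂avgKernel κ (2 ^ 0) x := fun x => by simp [maxAvg]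
    simp_rw [this]
    refine (lintegral_avgKernel_sq_le hκ _ hg).trans ?_
    exact le_mul_of_one_le_left' (by norm_num)
  | succ K ih =>
    have h := lintegral_maxAvg_sq_le_of_succ (c := 5) hκ hadd (K + 1) (fun g hg => ?_) hg
    · refine h.trans ?_
      gcongr
      norm_num
    · refine (lintegral_maxAvg_succ_sq_le hκ _ hg).trans ?_
      refine (add_le_add_left ((lintegral_maxAvg_succ_sq_le hκ _ hg).trans
        (add_le_add_left (ih hg) _)) _).trans (le_of_eq ?_)
      push_cast
      ring
end MaximalAverages

lemma succ_mul_eq_sum_add_sum (y : ℕ → ℝ) (n : ℕ) :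
    ((n : ℝ) + 1) * y n = ∑ i ∈ Finset.range (n + 1), y i
      + ∑ k ∈ Finset.range n, ((k : ℝ) + 1) * (y (k + 1) - y k) := by
  induction n with
  | zero => simp
  | succ n ih =>
    rw [Finset.sum_range_succ _ (n + 1),
      Finset.sum_range_succ (fun k : ℕ => ((k : ℝ) + 1) * (y (k + 1) - y k)) n]
    push_cast
    linarith

/-- Abel summation and the Cauchy-Schwarz inequality: a sequence is controlled by its averages and
the square function of its increments. -/
lemma sq_le_avg_add_square_function (y : ℕ → ℝ) (n : ℕ) :
    y n ^ 2 ≤ 2 * ((∑ i ∈ Finset.range (n + 1), y i) / (n + 1)) ^ 2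
      + ∑ k ∈ Finset.range n, ((k : ℝ) + 1) * (y (k + 1) - y k) ^ 2 := by
  set A := ∑ i ∈ Finset.range (n + 1), y i
  set B := ∑ k ∈ Finset.range n, ((k : ℝ) + 1) * (y (k + 1) - y k) with hB
  set D := ∑ k ∈ Finset.range n, ((k : ℝ) + 1) * (y (k + 1) - y k) ^ 2 with hD
  have hn : (0 : ℝ) < n + 1 := by positivity
  have h1 : ((n : ℝ) + 1) * y n = A + B := succ_mul_eq_sum_add_sum y n
  have h2 : B ^ 2 ≤ (∑ k ∈ Finset.range n, ((k : ℝ) + 1)) * D := by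
    refine Finset.sum_sq_le_sum_mul_sum_of_sq_le_mul _ (fun k _ => by positivity)
      (fun k _ => by positivity) fun k _ => le_of_eq (by ring)
  have h3 : ∑ k ∈ Finset.range n, ((k : ℝ) + 1) ≤ (n + 1) ^ 2 / 2 := by
    clear * -
    induction n with
    | zero => simp
    | succ n ih => rw [Finset.sum_range_succ]; push_cast; nlinarith
  have hD0 : 0 ≤ D := Finset.sum_nonneg fun k _ => by positivity
  have h4 : B ^ 2 ≤ (n + 1) ^ 2 / 2 * D := h2.trans (by gcongr)
  have h5 : (((n : ℝ) + 1) * y n) ^ 2 ≤ 2 * A ^ 2 + (n + 1) ^ 2 * D := by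
    rw [h1]; nlinarith [sq_nonneg (A - B)]
  have h6 : (n + 1 : ℝ) ^ 2 * (2 * (A / (n + 1)) ^ 2 + D) = 2 * A ^ 2 + (n + 1) ^ 2 * D := by
    field_simp
  refine le_of_mul_le_mul_left (a := ((n : ℝ) + 1) ^ 2) ?_ (by positivity)
  rw [h6, ← mul_pow]; exact h5

section DyadicMaximal
variable {E : Type*} [MeasurableSpace E] {m : Measure E} {P : Kernel (ℝ≥0 × E) E}

lemma lintegral_enorm_sq_Lp (v : Lp ℝ 2 m) :
    ∫⁻ x, ‖v x‖ₑ ^ 2 ∂m = ENNReal.ofReal (‖v‖ ^ 2) := by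
  rw [Lp.norm_def, ← ENNReal.toReal_pow, ENNReal.ofReal_toReal
    (ENNReal.pow_ne_top (Lp.eLpNorm_ne_top v)),
    eLpNorm_eq_lintegral_rpow_enorm_toReal (by simp) (by simp)]
  simp only [ENNReal.toReal_ofNat, ENNReal.rpow_two]
  rw [← ENNReal.rpow_two, ← ENNReal.rpow_mul]
  norm_num

lemma lintegral_enorm_sq_eq {f : E → ℝ} (hf : MemLp f 2 m) :
    ∫⁻ x, ‖f x‖ₑ ^ 2 ∂m = ENNReal.ofReal (‖hf.toLp f‖ ^ 2) := by
  rw [← lintegral_enorm_sq_Lp]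
  refine lintegral_congr_ae ?_
  filter_upwards [hf.coeFn_toLp] with x hx
  rw [hx]

lemma lintegral_avgKernel_le_two_mul_maxAvg {κ : ℕ → Kernel E E} {n N : ℕ} (hn : n ≤ N)
    (g : E → ℝ≥0∞) (x : E) :
    ∫⁻ y, g y ∂avgKernel κ (n + 1) x ≤ 2 * maxAvg κ N g x := by
  set k := Nat.clog 2 (n + 1)
  have h1 : n + 1 ≤ 2 ^ k := Nat.le_pow_clog (by norm_num) _
  have hkN : k ≤ N := by
    refine (Nat.clog_le_iff_le_pow (by norm_num)).2 ?_
    exact Nat.succ_le_of_lt (hn.trans_lt N.lt_two_pow_self)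
  have h2 : 2 ^ k ≤ 2 * (n + 1) := by
    rcases Nat.eq_zero_or_pos n with rfl | hn0
    · simp [k]
    have hk : k ≠ 0 := (Nat.clog_pos (by norm_num) (by omega)).ne'
    obtain ⟨j, hj⟩ := Nat.exists_eq_succ_of_ne_zero hk
    have : 2 ^ j < n + 1 := by
      rw [← Nat.lt_clog_iff_pow_lt (by norm_num)]
      omega
    rw [hj, Nat.pow_succ]
    omega
  refine le_trans ?_ (mul_le_mul_right (le_maxAvg hkN g x) 2)
  rw [lintegral_avgKernel, lintegral_avgKernel, ← mul_assoc]
  gcongr ?_ * ?_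
  · have h3 : ((2 ^ k : ℕ) : ℝ≥0∞) ≤ 2 * ((n + 1 : ℕ) : ℝ≥0∞) := by exact_mod_cast h2
    have h4 := mul_le_mul_right (ENNReal.inv_le_inv.2 h3) 2
    rwa [ENNReal.mul_inv (by simp) (by simp), ← mul_assoc,
      ENNReal.mul_inv_cancel (by simp) (by simp), one_mul] at h4
  · exact Finset.sum_le_sum_of_subset (Finset.range_subset_range.2 h1)

namespace IsSymmTransitionFunction
variable (hP : IsSymmTransitionFunction m P)
include hP

lemma ae_lintegral_eq_enorm_opL2 [SigmaFinite m] {g : E → ℝ} (hg0 : 0 ≤ g) (hgm : Measurable g)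
    (hg : MemLp g 2 m) (t : ℝ≥0) :
    ∀ᵐ x ∂m, ∫⁻ y, ‖g y‖ₑ ∂P (t, x) = ‖hP.opL2 t (hg.toLp g) x‖ₑ := by
  have _ := (hP.slice t).isFiniteKernel
  filter_upwards [hP.opL2_toLp t hg,
    (hP.slice t).ae_integrable_rpow one_le_two (by simpa using hg)] with x h1 h2
  have h3 : Integrable g (P (t, x)) := h2.integrable (by simp)
  rw [h1, semigroup, integral_eq_lintegral_of_nonneg_ae (ae_of_all _ hg0) hgm.aestronglyMeasurable]
  have e : ∀ y, ENNReal.ofReal (g y) = ‖g y‖ₑ := fun y => (Real.enorm_of_nonneg (hg0 y)).symm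
  simp_rw [e]
  rw [Real.enorm_of_nonneg ENNReal.toReal_nonneg, ENNReal.ofReal_toReal h3.2.ne]

lemma lintegral_iSup_sq_le [SigmaFinite m] (hS : IsSymmContractionSemigroup hP.opL2)
    {g : E → ℝ} (hg0 : 0 ≤ g) (hgm : Measurable g) (hg : MemLp g 2 m) (h : ℝ≥0) (N : ℕ) :
    ∫⁻ x, ⨆ n ∈ Finset.range (N + 1), (∫⁻ y, ‖g y‖ₑ ∂P (n * h, x)) ^ 2 ∂m
      ≤ 185 * ∫⁻ x, ‖g x‖ₑ ^ 2 ∂m := by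
  let κ : ℕ → Kernel E E := fun n => timeSlice P (n * h)
  have hκ : ∀ n, IsSymmSubMarkov m (κ n) := fun n => hP.slice _
  have hadd : ∀ i j x, ∀ g : E → ℝ≥0∞, Measurable g →
      ∫⁻ y, g y ∂κ (i + j) x = ∫⁻ y, ∫⁻ z, g z ∂κ j y ∂κ i x := fun i j x g hg => by
    have := hP.lintegral_add (i * h) (j * h) x hg
    rw [← add_mul] at this
    simpa [κ, timeSlice_apply] using this
  let d : ℕ → Lp ℝ 2 m := fun k =>
    hP.opL2 ((k + 1 : ℕ) * h) (hg.toLp g) - hP.opL2 (k * h) (hg.toLp g)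
  have hpt : ∀ᵐ x ∂m, ⨆ n ∈ Finset.range (N + 1), (∫⁻ y, ‖g y‖ₑ ∂P (n * h, x)) ^ 2
      ≤ 8 * maxAvg κ N (fun y => ‖g y‖ₑ) x ^ 2
        + ∑ k ∈ Finset.range N, ENNReal.ofReal (k + 1) * ‖d k x‖ₑ ^ 2 := by
    have h1 : ∀ᵐ x ∂m, ∀ n : ℕ, ∫⁻ y, ‖g y‖ₑ ∂P (n * h, x)
        = ‖hP.opL2 (n * h) (hg.toLp g) x‖ₑ :=
      ae_all_iff.2 fun n => hP.ae_lintegral_eq_enorm_opL2 hg0 hgm hg _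
    have h2 : ∀ᵐ x ∂m, ∀ n : ℕ, 0 ≤ hP.opL2 (n * h) (hg.toLp g) x := by
      refine ae_all_iff.2 fun n => ?_
      filter_upwards [hP.opL2_toLp (n * h) hg] with x hx
      rw [hx]; exact integral_nonneg hg0
    have h3 : ∀ᵐ x ∂m, ∀ k : ℕ, d k x
        = hP.opL2 ((k + 1 : ℕ) * h) (hg.toLp g) x - hP.opL2 (k * h) (hg.toLp g) x :=
      ae_all_iff.2 fun k => Lp.coeFn_sub _ _
    filter_upwards [h1, h2, h3] with x h1 h2 h3
    refine iSup₂_le fun n hn => ?_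
    have hnN : n ≤ N := Nat.lt_succ_iff.1 (Finset.mem_range.1 hn)
    let y : ℕ → ℝ := fun n => hP.opL2 (n * h) (hg.toLp g) x
    have hU : ∀ n : ℕ, ∫⁻ y, ‖g y‖ₑ ∂P (n * h, x) = ENNReal.ofReal (y n) := fun n => by
      rw [h1 n, Real.enorm_of_nonneg (h2 n)]
    have havg : ∫⁻ y, ‖g y‖ₑ ∂avgKernel κ (n + 1) x
        = ENNReal.ofReal ((∑ i ∈ Finset.range (n + 1), y i) / (n + 1)) := by
      rw [lintegral_avgKernel, ENNReal.ofReal_div_of_pos (by positivity),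
        ENNReal.ofReal_sum_of_nonneg (fun i _ => h2 i), ENNReal.div_eq_inv_mul]
      congr 1
      · congr 1
        rw [← Nat.cast_succ, ENNReal.ofReal_natCast]
      · exact Finset.sum_congr rfl fun i _ => hU i
    have hsum : ENNReal.ofReal (∑ k ∈ Finset.range n, ((k : ℝ) + 1) * (y (k + 1) - y k) ^ 2)
        ≤ ∑ k ∈ Finset.range N, ENNReal.ofReal (k + 1) * ‖d k x‖ₑ ^ 2 := by
      rw [ENNReal.ofReal_sum_of_nonneg fun k _ => by positivity]
      refine le_trans (le_of_eq ?_) (Finset.sum_le_sum_of_subset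
        (f := fun k : ℕ => ENNReal.ofReal (k + 1) * ‖d k x‖ₑ ^ 2)
        (Finset.range_subset_range.2 hnN))
      refine Finset.sum_congr rfl fun k _ => ?_
      rw [ENNReal.ofReal_mul (by positivity), h3 k, ← sq_abs, ENNReal.ofReal_pow (abs_nonneg _),
        ← Real.enorm_eq_ofReal_abs]
    calc (∫⁻ y, ‖g y‖ₑ ∂P (n * h, x)) ^ 2 = ENNReal.ofReal (y n ^ 2) := by
          rw [hU, ENNReal.ofReal_pow (h2 n)]
      _ ≤ ENNReal.ofReal (2 * ((∑ i ∈ Finset.range (n + 1), y i) / (n + 1)) ^ 2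
          + ∑ k ∈ Finset.range n, ((k : ℝ) + 1) * (y (k + 1) - y k) ^ 2) :=
          ENNReal.ofReal_le_ofReal (sq_le_avg_add_square_function y n)
      _ = 2 * (∫⁻ y, ‖g y‖ₑ ∂avgKernel κ (n + 1) x) ^ 2
          + ENNReal.ofReal (∑ k ∈ Finset.range n, ((k : ℝ) + 1) * (y (k + 1) - y k) ^ 2) := by
          have hnn : 0 ≤ (∑ i ∈ Finset.range (n + 1), y i) / (n + 1) :=
            div_nonneg (Finset.sum_nonneg fun i _ => h2 i) (by positivity)
          rw [ENNReal.ofReal_add (by positivity) (Finset.sum_nonneg fun k _ => by positivity),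
            ENNReal.ofReal_mul zero_le_two, havg, ENNReal.ofReal_pow hnn]
          simp
      _ ≤ 2 * (2 * maxAvg κ N (fun y => ‖g y‖ₑ) x) ^ 2 + _ := by
          refine add_le_add ?_ hsum
          gcongr
          exact lintegral_avgKernel_le_two_mul_maxAvg hnN _ x
      _ = _ := by rw [mul_pow, ← mul_assoc]; norm_num
  refine (lintegral_mono_ae hpt).trans ?_
  rw [lintegral_add_left (((measurable_maxAvg N hgm.enorm).pow_const 2).const_mul 8),
    lintegral_const_mul _ ((measurable_maxAvg N hgm.enorm).pow_const 2),
    lintegral_finsetSum _ fun k _ =>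
      ((Lp.stronglyMeasurable (d k)).measurable.enorm.pow_const 2).const_mul _]
  have hsq : ∑ k ∈ Finset.range N, ∫⁻ x, ENNReal.ofReal (k + 1) * ‖d k x‖ₑ ^ 2 ∂m
      ≤ ∫⁻ x, ‖g x‖ₑ ^ 2 ∂m := by
    have e : ∀ k : ℕ, ∫⁻ x, ENNReal.ofReal (k + 1) * ‖d k x‖ₑ ^ 2 ∂m
        = ENNReal.ofReal (((k : ℝ) + 1) * ‖d k‖ ^ 2) := fun k => by
      rw [lintegral_const_mul _ ((Lp.stronglyMeasurable (d k)).measurable.enorm.pow_const 2),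
        lintegral_enorm_sq_Lp, ENNReal.ofReal_mul (by positivity)]
    simp_rw [e]
    rw [← ENNReal.ofReal_sum_of_nonneg fun k _ => by positivity, lintegral_enorm_sq_eq hg]
    exact ENNReal.ofReal_le_ofReal (hS.sum_mul_norm_sub_sq_le h _ N)
  refine (add_le_add (mul_le_mul_right (lintegral_maxAvg_sq_le hκ hadd N hgm.enorm) 8) hsq).trans
    (le_of_eq ?_)
  ring

end IsSymmTransitionFunction

/-- The square of the maximal function of `P_s g` over dyadic times `s`. -/
noncomputable def dyadicMaxSq (P : Kernel (ℝ≥0 × E) E) (g : E → ℝ) (x : E) : ℝ≥0∞ :=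
  ⨆ k : ℕ, ⨆ n ∈ Finset.range (4 ^ k + 1), (∫⁻ y, ‖g y‖ₑ ∂P (n * (2 ^ k)⁻¹, x)) ^ 2

namespace IsSymmTransitionFunction
variable (hP : IsSymmTransitionFunction m P)
include hP

lemma measurable_lintegral_sq {g : E → ℝ} (hgm : Measurable g) (t : ℝ≥0) :
    Measurable fun x => (∫⁻ y, ‖g y‖ₑ ∂P (t, x)) ^ 2 := by
  have _ := (hP.slice t).isFiniteKernel
  exact (Measurable.lintegral_kernel (κ := timeSlice P t) hgm.enorm).pow_const 2

lemma measurable_dyadicMaxSq {g : E → ℝ} (hgm : Measurable g) : Measurable (dyadicMaxSq P g) :=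
  Measurable.iSup fun _ => Measurable.iSup fun _ => Measurable.iSup fun _ =>
    hP.measurable_lintegral_sq hgm _

/-- The `L²` maximal inequality over dyadic times. -/
lemma lintegral_dyadicMaxSq_le [SigmaFinite m] (hS : IsSymmContractionSemigroup hP.opL2)
    {g : E → ℝ} (hg0 : 0 ≤ g) (hgm : Measurable g) (hg : MemLp g 2 m) :
    ∫⁻ x, dyadicMaxSq P g x ∂m ≤ 185 * ∫⁻ x, ‖g x‖ₑ ^ 2 ∂m := by
  unfold dyadicMaxSq
  rw [lintegral_iSup (fun _ => Measurable.iSup fun _ => Measurable.iSup fun _ =>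
    hP.measurable_lintegral_sq hgm _)]
  · exact iSup_le fun k => hP.lintegral_iSup_sq_le hS hg0 hgm hg _ _
  · refine monotone_nat_of_le_succ fun k x => iSup₂_le fun n hn => ?_
    have hn' : 2 * n ∈ Finset.range (4 ^ (k + 1) + 1) := by
      rw [Finset.mem_range] at hn ⊢
      rw [pow_succ]; omega
    refine le_trans (le_of_eq ?_) (le_iSup₂ (f := fun (n : ℕ)
      (_ : n ∈ Finset.range (4 ^ (k + 1) + 1)) =>
        (∫⁻ y, ‖g y‖ₑ ∂P (n * (2 ^ (k + 1))⁻¹, x)) ^ 2) (2 * n) hn')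
    have : (n : ℝ≥0) * (2 ^ k)⁻¹ = ((2 * n : ℕ) : ℝ≥0) * (2 ^ (k + 1))⁻¹ := by
      push_cast
      field_simp
      ring
    rw [this]

lemma ae_sq_le_dyadicMaxSq [SigmaFinite m] (hS : IsSymmContractionSemigroup hP.opL2)
    {g : E → ℝ} (hg0 : 0 ≤ g) (hgm : Measurable g) (hg : MemLp g 2 m) (t : ℝ≥0) :
    ∀ᵐ x ∂m, (∫⁻ y, ‖g y‖ₑ ∂P (t, x)) ^ 2 ≤ dyadicMaxSq P g x := by
  let s : ℕ → ℝ≥0 := fun j => (⌊t * 2 ^ j⌋₊ : ℝ≥0) * (2 ^ j)⁻¹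
  have hs : Tendsto s atTop (𝓝 t) := by
    rw [← NNReal.tendsto_coe]
    have h2 : Tendsto (fun j : ℕ => (t : ℝ) - (1 / 2) ^ j) atTop (𝓝 t) := by
      simpa using (tendsto_pow_atTop_nhds_zero_of_lt_one (r := (1 / 2 : ℝ)) (by norm_num)
        (by norm_num)).const_sub (t : ℝ)
    refine tendsto_of_tendsto_of_tendsto_of_le_of_le h2 tendsto_const_nhds (fun j => ?_) fun j => ?_
    · have h3 : (t : ℝ) * 2 ^ j ≤ ⌊t * 2 ^ j⌋₊ + 1 := by
        exact_mod_cast (Nat.lt_floor_add_one (t * 2 ^ j)).le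
      have h4 : (0 : ℝ) < 2 ^ j := by positivity
      simp only [s, NNReal.coe_mul, NNReal.coe_natCast, NNReal.coe_inv, NNReal.coe_pow,
        NNReal.coe_ofNat, one_div, inv_pow]
      rw [← div_eq_mul_inv, le_div_iff₀ h4, sub_mul, inv_mul_cancel₀ h4.ne']
      linarith
    · have h3 : (⌊t * 2 ^ j⌋₊ : ℝ) ≤ t * 2 ^ j := by
        exact_mod_cast Nat.floor_le (zero_le (a := t * 2 ^ j))
      have h4 : (0 : ℝ) < 2 ^ j := by positivity
      simp only [s, NNReal.coe_mul, NNReal.coe_natCast, NNReal.coe_inv, NNReal.coe_pow,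
        NNReal.coe_ofNat]
      rw [← div_eq_mul_inv, div_le_iff₀ h4]
      exact h3
  have hconv := ((hS.continuous_orbit (hg.toLp g)).tendsto t).comp hs
  obtain ⟨ns, hns, hae⟩ := (tendstoInMeasure_of_tendsto_Lp hconv).exists_seq_tendsto_ae
  have hall : ∀ᵐ x ∂m, ∀ j : ℕ, ∫⁻ y, ‖g y‖ₑ ∂P (s j, x) = ‖hP.opL2 (s j) (hg.toLp g) x‖ₑ :=
    ae_all_iff.2 fun j => hP.ae_lintegral_eq_enorm_opL2 hg0 hgm hg _
  filter_upwards [hae, hall, hP.ae_lintegral_eq_enorm_opL2 hg0 hgm hg t] with x h1 h2 h3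
  rw [h3]
  have h4 : Tendsto (fun i => ‖hP.opL2 (s (ns i)) (hg.toLp g) x‖ₑ ^ 2) atTop
      (𝓝 (‖hP.opL2 t (hg.toLp g) x‖ₑ ^ 2)) := (ENNReal.continuous_pow 2).tendsto _ |>.comp h1.enorm
  refine le_of_tendsto h4 ?_
  have hbig : ∀ᶠ j : ℕ in atTop, t ≤ 2 ^ j :=
    (tendsto_pow_atTop_atTop_of_one_lt (r := (2 : ℝ≥0)) one_lt_two).eventually_ge_atTop t
  filter_upwards [hns.tendsto_atTop.eventually hbig] with i hi
  rw [← h2]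
  refine le_iSup_of_le (ns i) (le_iSup₂_of_le ⌊t * 2 ^ ns i⌋₊ ?_ le_rfl)
  rw [Finset.mem_range, Nat.lt_succ_iff]
  refine Nat.floor_le_of_le ?_
  push_cast
  calc t * 2 ^ ns i ≤ 2 ^ ns i * 2 ^ ns i := by gcongr
    _ = 4 ^ ns i := by rw [← mul_pow]; norm_num

end IsSymmTransitionFunction
end DyadicMaximal

section OneStep
variable {E : Type*} [MeasurableSpace E] {m : Measure E} {p : ℝ}

lemma enorm_oddPow_half_sq (hp : 2 ≤ p) (x : ℝ) : ‖oddPow (p / 2 - 1) x‖ₑ ^ 2 = ‖x‖ₑ ^ p := by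
  rw [Real.enorm_eq_ofReal_abs, Real.enorm_eq_ofReal_abs, ← ENNReal.ofReal_pow (abs_nonneg _),
    sq_abs, oddPow_half_sq hp, ENNReal.ofReal_rpow_of_nonneg (abs_nonneg _) (by linarith)]

lemma ofReal_ne_zero_of_two_le (hp : 2 ≤ p) : ENNReal.ofReal p ≠ 0 := by simp; linarith

lemma eLpNorm_rpow_eq (hp : 2 ≤ p) (v : E → ℝ) :
    eLpNorm v (ENNReal.ofReal p) m ^ p = ∫⁻ x, ‖v x‖ₑ ^ p ∂m := by
  rw [eLpNorm_eq_lintegral_rpow_enorm_toReal (ofReal_ne_zero_of_two_le hp) ENNReal.ofReal_ne_top,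
    ENNReal.toReal_ofReal (by linarith), ← ENNReal.rpow_mul, one_div_mul_cancel (by linarith),
    ENNReal.rpow_one]

lemma memLp_oddPow (hp : 2 ≤ p) {v : E → ℝ} (hv : MemLp v (ENNReal.ofReal p) m) :
    MemLp (fun x => oddPow (p / 2 - 1) (v x)) 2 m := by
  refine ⟨(continuous_oddPow (by linarith)).comp_aestronglyMeasurable hv.1, ?_⟩
  rw [eLpNorm_lt_top_iff_lintegral_rpow_enorm_lt_top (by simp) (by simp)]
  simp only [ENNReal.toReal_ofNat, ENNReal.rpow_two, enorm_oddPow_half_sq hp]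
  rw [← eLpNorm_rpow_eq hp]
  exact ENNReal.rpow_lt_top_of_nonneg (by linarith) hv.2.ne

lemma integrable_abs_rpow (hp : 2 ≤ p) {v : E → ℝ} (hv : MemLp v (ENNReal.ofReal p) m) :
    Integrable (fun x => |v x| ^ p) m := by
  have := (memLp_oddPow hp hv).integrable_sq
  simpa only [oddPow_half_sq hp] using this

/-- The element `v |v|^(p/2-1)` of `L²(m)`. -/
noncomputable def halfPow (hp : 2 ≤ p) {v : E → ℝ} (hv : MemLp v (ENNReal.ofReal p) m) :
    Lp ℝ 2 m := (memLp_oddPow hp hv).toLp _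

lemma coeFn_halfPow (hp : 2 ≤ p) {v : E → ℝ} (hv : MemLp v (ENNReal.ofReal p) m) :
    halfPow hp hv =ᵐ[m] fun x => oddPow (p / 2 - 1) (v x) := (memLp_oddPow hp hv).coeFn_toLp

lemma halfPow_congr (hp : 2 ≤ p) {v v' : E → ℝ} (hv : MemLp v (ENNReal.ofReal p) m)
    (hv' : MemLp v' (ENNReal.ofReal p) m) (h : v =ᵐ[m] v') : halfPow hp hv = halfPow hp hv' := by
  refine (MemLp.toLp_eq_toLp_iff _ _).2 ?_
  filter_upwards [h] with x hx
  rw [hx]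

lemma ofReal_norm_halfPow_sq (hp : 2 ≤ p) {v : E → ℝ} (hv : MemLp v (ENNReal.ofReal p) m) :
    ENNReal.ofReal (‖halfPow hp hv‖ ^ 2) = eLpNorm v (ENNReal.ofReal p) m ^ p := by
  rw [halfPow, ← lintegral_enorm_sq_eq, eLpNorm_rpow_eq hp]
  simp only [enorm_oddPow_half_sq hp]

lemma norm_sq_Lp_eq_integral (v : Lp ℝ 2 m) : ‖v‖ ^ 2 = ∫ x, v x ^ 2 ∂m := by
  rw [← real_inner_self_eq_norm_sq, L2.inner_def]
  exact integral_congr_ae (ae_of_all _ fun x => by simp [sq])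

lemma norm_halfPow_sq (hp : 2 ≤ p) {v : E → ℝ} (hv : MemLp v (ENNReal.ofReal p) m) :
    ‖halfPow hp hv‖ ^ 2 = ∫ x, |v x| ^ p ∂m := by
  rw [norm_sq_Lp_eq_integral]
  refine integral_congr_ae ?_
  filter_upwards [coeFn_halfPow hp hv] with x hx
  rw [hx, oddPow_half_sq hp]

lemma IsSymmSubMarkov.integrable_integral [SigmaFinite m] {κ : Kernel E E}
    (hκ : IsSymmSubMarkov m κ) {g : E → ℝ} (hg : Integrable g m) :
    Integrable (fun x => ∫ y, g y ∂κ x) m := by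
  have := hκ.memLp_integral le_rfl (f := g) (by simpa [memLp_one_iff_integrable] using hg)
  simpa [memLp_one_iff_integrable] using this

lemma IsSymmSubMarkov.integral_integral_le [SigmaFinite m] {κ : Kernel E E}
    (hκ : IsSymmSubMarkov m κ) {g : E → ℝ} (hg0 : 0 ≤ g) (hg : Integrable g m) :
    ∫ x, ∫ y, g y ∂κ x ∂m ≤ ∫ x, g x ∂m := by
  have h := hκ.eLpNorm_integral_le hg.1 le_rfl
  simp only [ENNReal.ofReal_one, eLpNorm_one_eq_lintegral_enorm] at h
  have h1 := ENNReal.toReal_mono hg.2.ne h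
  rw [← integral_norm_eq_lintegral_enorm hg.1,
    ← integral_norm_eq_lintegral_enorm (hκ.integrable_integral hg).1] at h1
  simpa only [Real.norm_of_nonneg (hg0 _), Real.norm_of_nonneg (integral_nonneg hg0)] using h1

variable {P : Kernel (ℝ≥0 × E) E} (hP : IsSymmTransitionFunction m P)
include hP

lemma IsSymmTransitionFunction.memLp_semigroup [SigmaFinite m] (hp : 2 ≤ p) {v : E → ℝ}
    (hv : MemLp v (ENNReal.ofReal p) m) (t : ℝ≥0) :
    MemLp (semigroup P t v) (ENNReal.ofReal p) m := (hP.slice t).memLp_integral (by linarith) hv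

/-- The finite time step versions of the Hardy-Stein identity: the decrease of `‖P_t v‖_p^p` is
comparable with the decrease of the `L²` norm of `v |v|^(p/2-1)`. -/
lemma IsSymmTransitionFunction.norm_halfPow_sub_comparable [SigmaFinite m] (hp : 2 ≤ p)
    {v : E → ℝ} (hv : MemLp v (ENNReal.ofReal p) m) (t : ℝ≥0) :
    ‖halfPow hp hv‖ ^ 2 - ‖hP.opL2 t (halfPow hp hv)‖ ^ 2
      ≤ 2 * (‖halfPow hp hv‖ ^ 2 - ‖halfPow hp (hP.memLp_semigroup hp hv t)‖ ^ 2) ∧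
    ‖halfPow hp hv‖ ^ 2 - ‖halfPow hp (hP.memLp_semigroup hp hv t)‖ ^ 2
      ≤ 4 * p * (p - 1) * (‖halfPow hp hv‖ ^ 2 - ‖hP.opL2 t (halfPow hp hv)‖ ^ 2) := by
  have hκ := hP.slice t
  set κ := timeSlice P t with hκdef
  have _ := hκ.isFiniteKernel
  have hq : (1 : ℝ) ≤ p := by linarith
  have hvp := integrable_abs_rpow hp hv
  have i1 := hκ.integrable_integral hvp
  have i2 := integrable_abs_rpow hp (hP.memLp_semigroup hp hv t)
  have e2 : ‖hP.opL2 t (halfPow hp hv)‖ ^ 2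
      = ∫ x, (∫ y, oddPow (p / 2 - 1) (v y) ∂κ x) ^ 2 ∂m := by
    rw [norm_sq_Lp_eq_integral]
    refine integral_congr_ae ?_
    filter_upwards [hP.opL2_toLp t (memLp_oddPow hp hv)] with x hx
    rw [halfPow, hx]; rfl
  have i3 : Integrable (fun x => (∫ y, oddPow (p / 2 - 1) (v y) ∂κ x) ^ 2) m := by
    have := hκ.memLp_integral one_le_two (by simpa using memLp_oddPow hp hv)
    rw [show ENNReal.ofReal 2 = 2 by simp] at this
    exact this.integrable_sq
  have hle := hκ.integral_integral_le (fun x => Real.rpow_nonneg (abs_nonneg (v x)) p) hvp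
  have hae : ∀ᵐ x ∂m, Integrable v (κ x) ∧ Integrable (fun y => |v y| ^ p) (κ x) ∧
      Integrable (fun y => oddPow (p / 2 - 1) (v y)) (κ x) := by
    filter_upwards [hκ.ae_integrable_rpow hq hv] with x hx
    exact ⟨hx.integrable (by simpa using hq), integrable_abs_rpow hp hx,
      (memLp_oddPow hp hx).integrable (by simp)⟩
  have hA : ∫ x, ∫ y, |v y| ^ p ∂κ x ∂m - ∫ x, (∫ y, oddPow (p / 2 - 1) (v y) ∂κ x) ^ 2 ∂m
      ≤ 2 * (∫ x, ∫ y, |v y| ^ p ∂κ x ∂m - ∫ x, |semigroup P t v x| ^ p ∂m) := by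
    rw [← integral_sub i1 i3, ← integral_sub i1 i2, ← integral_const_mul]
    refine integral_mono_ae (i1.sub i3) ((i1.sub i2).const_mul 2) ?_
    filter_upwards [hae] with x hx
    exact variance_oddPow_le hp (hκ.real_univ_le_one x) hx.1 hx.2.1 hx.2.2
  have hB : ∫ x, ∫ y, |v y| ^ p ∂κ x ∂m - ∫ x, |semigroup P t v x| ^ p ∂m
      ≤ 4 * p * (p - 1) * (∫ x, ∫ y, |v y| ^ p ∂κ x ∂m
        - ∫ x, (∫ y, oddPow (p / 2 - 1) (v y) ∂κ x) ^ 2 ∂m) := by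
    rw [← integral_sub i1 i3, ← integral_sub i1 i2, ← integral_const_mul]
    refine integral_mono_ae (i1.sub i2) ((i1.sub i3).const_mul _) ?_
    filter_upwards [hae] with x hx
    exact jensen_gap_le hp (hκ.real_univ_le_one x) hx.1 hx.2.1 hx.2.2
  rw [norm_halfPow_sq, norm_halfPow_sq, e2]
  constructor
  · linarith
  · nlinarith [mul_nonneg (by nlinarith : (0 : ℝ) ≤ 4 * p * (p - 1) - 1) (sub_nonneg.2 hle)]

end OneStep

section Telescoping
variable {N : ℝ → ℝ} (hN : Antitone N) (hN0 : ∀ t, 0 ≤ N t)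
include hN

lemma integral_sub_shift (T h : ℝ) :
    ∫ t in (0)..T, (N t - N (t + h)) = (∫ t in (0)..h, N t) - ∫ t in T..(T + h), N t := by
  have hi : ∀ a b, IntervalIntegrable N volume a b := fun a b => hN.intervalIntegrable
  have hs : IntervalIntegrable (fun t => N (t + h)) volume 0 T :=
    (hN.comp_monotone
      (fun x y hxy => by dsimp only; linarith : Monotone fun t : ℝ => t + h)).intervalIntegrable
  rw [intervalIntegral.integral_sub (hi _ _) hs, intervalIntegral.integral_comp_add_right, zero_add,
    intervalIntegral.integral_interval_sub_interval_comm (hi _ _) (hi _ _) (hi _ _)]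

lemma lintegral_sub_shift_eq {T h : ℝ} (hT : 0 ≤ T) (hh : 0 ≤ h) :
    ∫⁻ t in Set.Ioc 0 T, ENNReal.ofReal (N t - N (t + h))
      = ENNReal.ofReal ((∫ t in (0)..h, N t) - ∫ t in T..(T + h), N t) := by
  have hs : IntervalIntegrable (fun t => N (t + h)) volume 0 T :=
    (hN.comp_monotone
      (fun x y hxy => by dsimp only; linarith : Monotone fun t : ℝ => t + h)).intervalIntegrable
  rw [← integral_sub_shift hN, intervalIntegral.integral_of_le hT,
    ofReal_integral_eq_lintegral_ofReal]
  · exact ((intervalIntegrable_iff_integrableOn_Ioc_of_le hT).1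
      (hN.intervalIntegrable.sub hs))
  · exact ae_of_all _ fun t => sub_nonneg.2 (hN (by linarith))

include hN0 in
lemma lintegral_sub_shift_le {T h : ℝ} (hT : 0 ≤ T) (hh : 0 ≤ h) :
    ∫⁻ t in Set.Ioc 0 T, ENNReal.ofReal (N t - N (t + h)) ≤ ENNReal.ofReal (h * N 0) := by
  rw [lintegral_sub_shift_eq hN hT hh]
  refine ENNReal.ofReal_le_ofReal ?_
  have h1 : ∫ t in (0)..h, N t ≤ h * N 0 := by
    have := intervalIntegral.integral_mono_on hh (hN.intervalIntegrable (μ := volume))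
      (intervalIntegrable_const (c := N 0)) fun t ht => hN ht.1
    simpa using this
  have h2 : 0 ≤ ∫ t in T..(T + h), N t :=
    intervalIntegral.integral_nonneg (by linarith) fun t _ => hN0 t
  linarith

lemma le_lintegral_sub_shift {T h : ℝ} (hT : 0 ≤ T) (hh : 0 ≤ h) :
    ENNReal.ofReal (h * (N h - N T))
      ≤ ∫⁻ t in Set.Ioc 0 T, ENNReal.ofReal (N t - N (t + h)) := by
  rw [lintegral_sub_shift_eq hN hT hh]
  refine ENNReal.ofReal_le_ofReal ?_
  have h1 : h * N h ≤ ∫ t in (0)..h, N t := by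
    have := intervalIntegral.integral_mono_on (μ := volume) hh (intervalIntegrable_const (c := N h))
      hN.intervalIntegrable fun t ht => hN ht.2
    simpa using this
  have h2 : ∫ t in T..(T + h), N t ≤ h * N T := by
    have := intervalIntegral.integral_mono_on (by linarith : T ≤ T + h)
      (hN.intervalIntegrable (μ := volume))
      (intervalIntegrable_const (c := N T)) fun t ht => hN ht.1
    simpa using this
  linarith
end Telescoping

section TimeIntegration
variable {E : Type*} [MeasurableSpace E] {m : Measure E} {p : ℝ} {P : Kernel (ℝ≥0 × E) E}

namespace IsSymmTransitionFunction
variable (hP : IsSymmTransitionFunction m P)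
include hP

lemma measurable_semigroup {f : E → ℝ} (hf : Measurable f) :
    Measurable fun z : ℝ≥0 × E => semigroup P z.1 f z.2 := by
  have _ := hP.isFiniteKernel
  exact (StronglyMeasurable.integral_kernel (κ := P) hf.stronglyMeasurable).measurable

lemma measurable_integral_slice (h : ℝ≥0) {w : ℝ≥0 × E → ℝ} (hw : Measurable w) :
    Measurable fun z : ℝ≥0 × E => ∫ y, w (z.1, y) ∂P (h, z.2) := by
  have _ := hP.isFiniteKernel
  let κ : Kernel (ℝ≥0 × E) E := P.comap (fun z : ℝ≥0 × E => (h, z.2)) (by fun_prop)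
  have hmeas : Measurable fun q : (ℝ≥0 × E) × E => w (q.1.1, q.2) := by fun_prop
  exact (StronglyMeasurable.integral_kernel_prod_right' (κ := κ)
    hmeas.stronglyMeasurable).measurable

/-- The curve `t ↦ P_t f |P_t f|^(p/2-1)` in `L²(m)`. -/
noncomputable def halfPowFlow [SigmaFinite m] (hp : 2 ≤ p) {f : E → ℝ}
    (hf : MemLp f (ENNReal.ofReal p) m) (t : ℝ≥0) : Lp ℝ 2 m :=
  halfPow hp (hP.memLp_semigroup hp hf t)

variable [SigmaFinite m] (hp : 2 ≤ p) {f : E → ℝ} (hf : MemLp f (ENNReal.ofReal p) m)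

lemma halfPowFlow_add (t h : ℝ≥0) : hP.halfPowFlow hp hf (t + h)
    = halfPow hp (hP.memLp_semigroup hp (hP.memLp_semigroup hp hf t) h) := by
  refine halfPow_congr hp _ _ ?_
  rw [add_comm]
  exact hP.semigroup_add (by linarith) hf h t

lemma halfPowFlow_comparable (t h : ℝ≥0) :
    ‖hP.halfPowFlow hp hf t‖ ^ 2 - ‖hP.opL2 h (hP.halfPowFlow hp hf t)‖ ^ 2
      ≤ 2 * (‖hP.halfPowFlow hp hf t‖ ^ 2 - ‖hP.halfPowFlow hp hf (t + h)‖ ^ 2) ∧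
    ‖hP.halfPowFlow hp hf t‖ ^ 2 - ‖hP.halfPowFlow hp hf (t + h)‖ ^ 2
      ≤ 4 * p * (p - 1) *
        (‖hP.halfPowFlow hp hf t‖ ^ 2 - ‖hP.opL2 h (hP.halfPowFlow hp hf t)‖ ^ 2) := by
  rw [halfPowFlow_add]
  exact hP.norm_halfPow_sub_comparable hp (hP.memLp_semigroup hp hf t) h

lemma antitone_norm_halfPowFlow_sq :
    Antitone fun t : ℝ => ‖hP.halfPowFlow hp hf t.toNNReal‖ ^ 2 := by
  intro s t hst
  obtain ⟨r, hr⟩ := exists_add_of_le (Real.toNNReal_le_toNNReal hst)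
  dsimp only
  rw [hr]
  have h1 := (hP.halfPowFlow_comparable hp hf s.toNNReal r).1
  have h2 := pow_le_pow_left₀ (norm_nonneg _)
    ((hP.slice r).norm_toL2_le (hP.halfPowFlow hp hf s.toNNReal)) 2
  change ‖hP.opL2 r _‖ ^ 2 ≤ _ at h2
  linarith

lemma measurable_energyGap_halfPowFlow (hfm : Measurable f)
    (hS : IsSymmContractionSemigroup hP.opL2) (h : ℝ≥0) :
    Measurable fun t : ℝ≥0 => energyGap hP.opL2 (hP.halfPowFlow hp hf t) h := by
  have hr : 0 ≤ p / 2 - 1 := by linarith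
  have hw : Measurable fun z : ℝ≥0 × E => oddPow (p / 2 - 1) (semigroup P z.1 f z.2) :=
    (continuous_oddPow hr).measurable.comp (hP.measurable_semigroup hfm)
  have e1 : ∀ t, ‖hP.halfPowFlow hp hf t‖ ^ 2
      = (∫⁻ x, ‖oddPow (p / 2 - 1) (semigroup P t f x)‖ₑ ^ 2 ∂m).toReal := fun t => by
    rw [halfPowFlow, halfPow, lintegral_enorm_sq_eq (memLp_oddPow hp (hP.memLp_semigroup hp hf t)),
      ENNReal.toReal_ofReal (by positivity)]
  have e2 : ∀ t, ‖hP.opL2 (h / 2) (hP.halfPowFlow hp hf t)‖ ^ 2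
      = (∫⁻ x, ‖∫ y, oddPow (p / 2 - 1) (semigroup P t f y) ∂P (h / 2, x)‖ₑ ^ 2 ∂m).toReal :=
    fun t => by
      rw [← ENNReal.toReal_ofReal (sq_nonneg ‖hP.opL2 (h / 2) (hP.halfPowFlow hp hf t)‖),
        ← lintegral_enorm_sq_Lp]
      congr 1
      refine lintegral_congr_ae ?_
      filter_upwards [hP.opL2_toLp (h / 2) (memLp_oddPow hp (hP.memLp_semigroup hp hf t))] with x hx
      rw [halfPowFlow, halfPow, hx]; rfl
  simp_rw [hS.energyGap_eq, e1, e2]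
  have m1 : Measurable fun t : ℝ≥0 =>
      ∫⁻ x, ‖oddPow (p / 2 - 1) (semigroup P t f x)‖ₑ ^ 2 ∂m :=
    (hw.enorm.pow_const 2).lintegral_prod_right'
  have m2 : Measurable fun t : ℝ≥0 =>
      ∫⁻ x, ‖∫ y, oddPow (p / 2 - 1) (semigroup P t f y) ∂P (h / 2, x)‖ₑ ^ 2 ∂m :=
    ((hP.measurable_integral_slice (h / 2) hw).enorm.pow_const 2).lintegral_prod_right'
  exact m1.ennreal_toReal.sub m2.ennreal_toReal

/-- For almost every `t`, the function `P_t f |P_t f|^(p/2-1)` belongs to the Dirichlet space. -/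
lemma ae_halfPowFlow_mem_domain (hfm : Measurable f) {𝓔 : DirichletForm m}
    (h𝓔 : 𝓔.IsAssociated P) {T : ℝ} (hT : 0 ≤ T) :
    ∀ᵐ t : ℝ ∂volume.restrict (Set.Ioc 0 T), hP.halfPowFlow hp hf t.toNNReal ∈ 𝓔.domain := by
  have hS := hP.isSymmContractionSemigroup h𝓔
  let W : ℝ → Lp ℝ 2 m := fun t => hP.halfPowFlow hp hf t.toNNReal
  let η : ℕ → ℝ≥0 := fun k => (2 ^ k)⁻¹
  have hη : ∀ k, 0 < η k := fun k => by positivity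
  have hη0 : Tendsto η atTop (𝓝 0) := by
    have : Tendsto (fun k : ℕ => ((2 : ℝ≥0)⁻¹) ^ k) atTop (𝓝 0) :=
      tendsto_pow_atTop_nhds_zero_of_lt_one (by norm_num) (inv_lt_one_of_one_lt₀ one_lt_two)
    simpa [η] using this
  have hηanti : Antitone η := by
    intro j k hjk
    simp only [η]
    gcongr
    · exact one_le_two
  let β : ℕ → ℝ → ℝ≥0∞ := fun k t => ENNReal.ofReal (energyGap hP.opL2 (W t) (η k) / η k)
  have hβm : ∀ k, Measurable (β k) := fun k =>
    (((hP.measurable_energyGap_halfPowFlow hp hf hfm hS (η k)).comp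
      measurable_real_toNNReal).div_const _).ennreal_ofReal
  have hβmono : Monotone β := fun j k hjk t =>
    ENNReal.ofReal_le_ofReal (hS.energyGap_div_antitone (W t) (hη k) (hηanti hjk))
  have hβle : ∀ k, ∫⁻ t in Set.Ioc 0 T, β k t ≤ ENNReal.ofReal (‖W 0‖ ^ 2) := fun k => by
    have h1 : ∀ t ∈ Set.Ioc (0 : ℝ) T, β k t
        ≤ ENNReal.ofReal (2 / η k) * ENNReal.ofReal (‖W t‖ ^ 2 - ‖W (t + η k / 2)‖ ^ 2) := by
      intro t ht
      rw [← ENNReal.ofReal_mul (by positivity)]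
      refine ENNReal.ofReal_le_ofReal ?_
      have h2 := (hP.halfPowFlow_comparable hp hf t.toNNReal (η k / 2)).1
      rw [← hS.energyGap_eq] at h2
      have h3 : (t + η k / 2).toNNReal = t.toNNReal + η k / 2 := by
        rw [Real.toNNReal_add ht.1.le (by positivity)]
        congr 1
        rw [← NNReal.coe_inj, Real.coe_toNNReal _ (by positivity)]
        push_cast; ring
      have hpos : (0 : ℝ) < η k := by exact_mod_cast hη k
      simp only [W]
      rw [h3, div_mul_eq_mul_div]
      gcongr
    calc _ ≤ ∫⁻ t in Set.Ioc 0 T, ENNReal.ofReal (2 / η k) *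
          ENNReal.ofReal (‖W t‖ ^ 2 - ‖W (t + η k / 2)‖ ^ 2) :=
          setLIntegral_mono' measurableSet_Ioc h1
      _ = ENNReal.ofReal (2 / η k) *
          ∫⁻ t in Set.Ioc 0 T, ENNReal.ofReal (‖W t‖ ^ 2 - ‖W (t + η k / 2)‖ ^ 2) :=
          lintegral_const_mul' _ _ ENNReal.ofReal_ne_top
      _ ≤ ENNReal.ofReal (2 / η k) * ENNReal.ofReal (η k / 2 * ‖W 0‖ ^ 2) := by
          gcongr
          exact lintegral_sub_shift_le (hP.antitone_norm_halfPowFlow_sq hp hf)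
            (fun t => sq_nonneg _) hT (by positivity)
      _ = _ := by
          rw [← ENNReal.ofReal_mul (by positivity)]
          congr 1
          have hpos : (0 : ℝ) < η k := by exact_mod_cast hη k
          field_simp
  have hsup : ∫⁻ t in Set.Ioc 0 T, ⨆ k, β k t ≤ ENNReal.ofReal (‖W 0‖ ^ 2) := by
    rw [lintegral_iSup hβm hβmono]
    exact iSup_le hβle
  have hfin := ae_lt_top (Measurable.iSup hβm) (hsup.trans_lt ENNReal.ofReal_lt_top).ne
  filter_upwards [hfin] with t ht
  rw [h𝓔.mem_domain_iff]
  simp_rw [← hP.energyGap_eq_integral]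
  refine hS.exists_tendsto_energyGap (L := (⨆ k, β k t).toReal) hη hη0 fun k => ?_
  refine (ENNReal.ofReal_le_iff_le_toReal ht.ne).1 ?_
  exact le_iSup (fun k => β k t) k

/-- The Hardy-Stein inequality, with a bound `Φ` for the energy of `P_t f |P_t f|^(p/2-1)`. -/
lemma norm_halfPowFlow_sub_le (hfm : Measurable f) {𝓔 : DirichletForm m}
    (h𝓔 : 𝓔.IsAssociated P) {Φ : ℝ → ℝ≥0∞}
    (hΦ : ∀ t (ht : hP.halfPowFlow hp hf t.toNNReal ∈ 𝓔.domain),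
      ENNReal.ofReal (𝓔.form ⟨_, ht⟩ ⟨_, ht⟩) ≤ Φ t) {h T : ℝ≥0} (hh : 0 < h) :
    ENNReal.ofReal (‖hP.halfPowFlow hp hf h‖ ^ 2 - ‖hP.halfPowFlow hp hf T‖ ^ 2)
      ≤ ENNReal.ofReal (8 * p * (p - 1)) * ∫⁻ t in Set.Ioi 0, Φ t := by
  have hS := hP.isSymmContractionSemigroup h𝓔
  have hh' : (0 : ℝ) < h := by exact_mod_cast hh
  have h1 := le_lintegral_sub_shift (hP.antitone_norm_halfPowFlow_sq hp hf) T.coe_nonneg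
    h.coe_nonneg
  simp only [Real.toNNReal_coe] at h1
  have hC : 0 ≤ 8 * p * (p - 1) := by nlinarith
  have h2 : ∀ᵐ t : ℝ ∂volume.restrict (Set.Ioc 0 (T : ℝ)),
      ENNReal.ofReal (‖hP.halfPowFlow hp hf t.toNNReal‖ ^ 2
        - ‖hP.halfPowFlow hp hf (t + h).toNNReal‖ ^ 2)
      ≤ ENNReal.ofReal (h * (8 * p * (p - 1))) * Φ t := by
    filter_upwards [hP.ae_halfPowFlow_mem_domain hp hf hfm h𝓔 T.coe_nonneg,
      ae_restrict_mem measurableSet_Ioc] with t ht htT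
    rw [Real.toNNReal_add htT.1.le h.coe_nonneg, Real.toNNReal_coe]
    have h3 := (hP.halfPowFlow_comparable hp hf t.toNNReal h).2
    rw [← hS.energyGap_double] at h3
    have h4 := h𝓔.tendsto_form ⟨_, ht⟩ ⟨_, ht⟩
    simp only [← hP.energyGap_eq_integral] at h4
    have h5 := hS.energyGap_le_of_tendsto h4 (2 * h)
    refine le_trans ?_ (mul_le_mul_right (hΦ t ht) _)
    rw [← ENNReal.ofReal_mul (by positivity)]
    refine ENNReal.ofReal_le_ofReal (h3.trans ?_)
    have h6 := mul_le_mul_of_nonneg_left h5 (by nlinarith : 0 ≤ 4 * p * (p - 1))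
    push_cast at h6
    linarith
  have h7 := (h1.trans (lintegral_mono_ae h2)).trans_eq
    (lintegral_const_mul' _ _ ENNReal.ofReal_ne_top)
  rw [ENNReal.ofReal_mul h.coe_nonneg, ENNReal.ofReal_mul h.coe_nonneg, mul_assoc] at h7
  have h8 := (ENNReal.mul_le_mul_iff_right (by simpa using hh.ne') ENNReal.ofReal_ne_top).1 h7
  refine h8.trans ?_
  gcongr
  exact Set.Ioc_subset_Ioi_self

/-- The Hardy-Stein inequality under strong stability. -/
lemma eLpNorm_semigroup_rpow_le (hfm : Measurable f) {𝓔 : DirichletForm m}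
    (h𝓔 : 𝓔.IsAssociated P) (hstab : StronglyStable m P (ENNReal.ofReal p)) {Φ : ℝ → ℝ≥0∞}
    (hΦ : ∀ t (ht : hP.halfPowFlow hp hf t.toNNReal ∈ 𝓔.domain),
      ENNReal.ofReal (𝓔.form ⟨_, ht⟩ ⟨_, ht⟩) ≤ Φ t) {h : ℝ≥0} (hh : 0 < h) :
    eLpNorm (semigroup P h f) (ENNReal.ofReal p) m ^ p
      ≤ ENNReal.ofReal (8 * p * (p - 1)) * ∫⁻ t in Set.Ioi 0, Φ t := by
  have e : ∀ t, ENNReal.ofReal (‖hP.halfPowFlow hp hf t‖ ^ 2)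
      = eLpNorm (semigroup P t f) (ENNReal.ofReal p) m ^ p := fun t => ofReal_norm_halfPow_sq hp _
  have h1 : Tendsto (fun T : ℝ≥0 => ENNReal.ofReal (‖hP.halfPowFlow hp hf T‖ ^ 2)
      + ENNReal.ofReal (8 * p * (p - 1)) * ∫⁻ t in Set.Ioi 0, Φ t) atTop
      (𝓝 (0 + ENNReal.ofReal (8 * p * (p - 1)) * ∫⁻ t in Set.Ioi 0, Φ t)) := by
    refine Tendsto.add_const _ ?_
    simp_rw [e]
    have := ((ENNReal.continuous_rpow_const (y := p)).tendsto 0).comp (hstab f hf)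
    rwa [ENNReal.zero_rpow_of_pos (by linarith)] at this
  rw [zero_add] at h1
  refine ge_of_tendsto' h1 fun T => ?_
  rw [← e]
  have h2 := hP.norm_halfPowFlow_sub_le hp hf hfm h𝓔 hΦ (T := T) hh
  rw [ENNReal.ofReal_sub _ (sq_nonneg _), tsub_le_iff_right, add_comm] at h2
  exact h2

include hp hf in
/-- `‖f‖_p` is at most the supremum of `‖P_h f‖_p` over `h > 0`. -/
lemma eLpNorm_le_of_semigroup (hS : IsSymmContractionSemigroup hP.opL2) {B : ℝ≥0∞}
    (hB : ∀ h : ℝ≥0, 0 < h → eLpNorm (semigroup P h f) (ENNReal.ofReal p) m ≤ B) :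
    eLpNorm f (ENNReal.ofReal p) m ≤ B := by
  have hp0 := ofReal_ne_zero_of_two_le hp
  have hp1 : (1 : ℝ≥0∞) ≤ ENNReal.ofReal p := by simp; linarith
  refine ENNReal.le_of_forall_pos_le_add fun ε hε _ => ?_
  obtain ⟨g, hg, hgp, hg2⟩ : ∃ g : E → ℝ,
      eLpNorm (f - g) (ENNReal.ofReal p) m < ((ε / 2 : ℝ≥0) : ℝ≥0∞) ∧
        MemLp g (ENNReal.ofReal p) m ∧ MemLp g 2 m := by
    obtain ⟨g, hg, hgp⟩ := hf.exists_simpleFunc_eLpNorm_sub_lt ENNReal.ofReal_ne_top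
      (ε := ((ε / 2 : ℝ≥0) : ℝ≥0∞)) (by simpa using hε.ne')
    exact ⟨g, hg, hgp, SimpleFunc.memLp_of_finite_measure_preimage 2
      ((SimpleFunc.memLp_iff hp0 ENNReal.ofReal_ne_top).1 hgp)⟩
  have hsub : MemLp (f - g) (ENNReal.ofReal p) m := hf.sub hgp
  have hPg : ∀ h : ℝ≥0, 0 < h →
      eLpNorm (semigroup P h g) (ENNReal.ofReal p) m ≤ B + (ε / 2 : ℝ≥0) := by
    intro h hh
    have _ := (hP.slice h).isFiniteKernel
    have e : semigroup P h g =ᵐ[m] semigroup P h f - semigroup P h (f - g) := by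
      filter_upwards [(hP.slice h).ae_integrable_rpow (by linarith) hf,
        (hP.slice h).ae_integrable_rpow (by linarith) hgp] with x h1 h2
      have h1 : Integrable f (P (h, x)) := h1.integrable hp1
      have h2 : Integrable g (P (h, x)) := h2.integrable hp1
      simp only [semigroup, Pi.sub_apply]
      rw [integral_sub h1 h2]
      ring
    rw [eLpNorm_congr_ae e]
    refine (eLpNorm_sub_le (hP.memLp_semigroup hp hf h).1
      (hP.memLp_semigroup hp hsub h).1 hp1).trans
      (add_le_add (hB h hh) ?_)
    exact ((hP.slice h).eLpNorm_integral_le hsub.1 (by linarith)).trans hg.le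
  have hlim : eLpNorm g (ENNReal.ofReal p) m ≤ B + (ε / 2 : ℝ≥0) := by
    have hs : Tendsto (fun n : ℕ => ((n : ℝ≥0) + 1)⁻¹) atTop (𝓝 0) := by
      have := tendsto_one_div_add_atTop_nhds_zero_nat (𝕜 := ℝ)
      rw [← NNReal.tendsto_coe]
      simpa using this
    have hconv := ((hS.continuous_orbit (hg2.toLp g)).tendsto 0).comp hs
    rw [hS.zero] at hconv
    obtain ⟨ns, hns, hae⟩ := (tendstoInMeasure_of_tendsto_Lp hconv).exists_seq_tendsto_ae
    have hall : ∀ᵐ x ∂m, ∀ n : ℕ, hP.opL2 ((n : ℝ≥0) + 1)⁻¹ (hg2.toLp g) x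
        = semigroup P ((n : ℝ≥0) + 1)⁻¹ g x := ae_all_iff.2 fun n => hP.opL2_toLp _ hg2
    have hlim' : ∀ᵐ x ∂m, Tendsto (fun i => semigroup P ((ns i : ℝ≥0) + 1)⁻¹ g x) atTop
        (𝓝 (g x)) := by
      filter_upwards [hae, hall, hg2.coeFn_toLp] with x h1 h2 h3
      rw [← h3]
      refine h1.congr fun i => ?_
      exact h2 _
    refine (Lp.eLpNorm_lim_le_liminf_eLpNorm
      (fun i => (hP.memLp_semigroup hp hgp ((ns i : ℝ≥0) + 1)⁻¹).1) g hlim').trans ?_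
    refine liminf_le_of_le (by isBoundedDefault) fun b hb => ?_
    obtain ⟨i, hi⟩ := hb.exists
    exact hi.trans (hPg _ (by positivity))
  calc eLpNorm f (ENNReal.ofReal p) m = eLpNorm ((f - g) + g) (ENNReal.ofReal p) m := by
        rw [sub_add_cancel]
    _ ≤ eLpNorm (f - g) (ENNReal.ofReal p) m + eLpNorm g (ENNReal.ofReal p) m :=
        eLpNorm_add_le hsub.1 hgp.1 hp1
    _ ≤ (ε / 2 : ℝ≥0) + (B + (ε / 2 : ℝ≥0)) := add_le_add hg.le hlim
    _ = B + ε := by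
        rw [add_left_comm, ← ENNReal.coe_add, add_halves]

end IsSymmTransitionFunction
end TimeIntegration

lemma chi_nonneg (s t : ℝ) : 0 ≤ chi s t := by
  unfold chi; split_ifs <;> norm_num

lemma chi_le_one (s t : ℝ) : chi s t ≤ 1 := by
  unfold chi; split_ifs <;> norm_num

lemma measurable_chi : Measurable fun z : ℝ × ℝ => chi z.1 z.2 := by
  unfold chi
  refine Measurable.ite (measurableSet_lt (by fun_prop) (by fun_prop)) measurable_const ?_
  exact Measurable.ite (measurableSet_eq_fun (by fun_prop) (by fun_prop)) measurable_const
    measurable_const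

lemma max_abs_rpow_eq (q a b : ℝ) :
    max |a| |b| ^ q = chi a b * |a| ^ q + chi b a * |b| ^ q := by
  unfold chi
  rcases lt_trichotomy |a| |b| with h | h | h
  · simp [h, h.le, h.not_gt, h.ne]
  · simp only [h, lt_irrefl, if_true, if_false, max_self]; ring
  · simp [h, h.le, h.not_gt, h.ne]

lemma sq_oddPow_sub_le_chi {p : ℝ} (hp : 2 ≤ p) (a b : ℝ) :
    (oddPow (p / 2 - 1) b - oddPow (p / 2 - 1) a) ^ 2
      ≤ (p / 2) ^ 2 * (|a| ^ (p - 2) * ((b - a) ^ 2 * chi a b)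
        + |b| ^ (p - 2) * ((a - b) ^ 2 * chi b a)) := by
  have h := abs_oddPow_sub_le (s := p / 2 - 1) (by linarith) a b
  have hM : (0 : ℝ) ≤ max |a| |b| := (abs_nonneg a).trans (le_max_left _ _)
  have key : (max |a| |b| ^ (p / 2 - 1)) ^ 2 = max |a| |b| ^ (p - 2) := by
    rw [← Real.rpow_natCast, ← Real.rpow_mul hM]; congr 1; push_cast; ring
  have h2 := pow_le_pow_left₀ (abs_nonneg _) h 2
  rw [sq_abs, mul_pow, mul_pow, key, sq_abs, sub_add_cancel, max_abs_rpow_eq] at h2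
  linarith

section JumpMeasure
variable {E : Type*} [MeasurableSpace E] {m : Measure E} {J : Kernel E E} {p : ℝ}

lemma ae_jumpMeasure_fst [SFinite m] [IsSFiniteKernel J] {q : E → Prop} (hq : ∀ᵐ x ∂m, q x) :
    ∀ᵐ z ∂jumpMeasure m J, q z.1 := by
  refine ae_restrict_of_ae ?_
  have hN := measurableSet_toMeasurable m {x | ¬q x}
  have h0 : ∀ᵐ x ∂m, x ∉ toMeasurable m {x | ¬q x} := by
    rw [← measure_eq_zero_iff_ae_notMem, measure_toMeasurable]; exact hq
  filter_upwards [Measure.ae_compProd_of_ae_fst J hN.compl h0] with z hz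
  by_contra h
  exact hz (subset_toMeasurable m _ h)

lemma ae_jumpMeasure_snd [SFinite m] [IsSFiniteKernel J]
    (hsymm : (jumpMeasure m J).map Prod.swap = jumpMeasure m J) {q : E → Prop}
    (hq : ∀ᵐ x ∂m, q x) : ∀ᵐ z ∂jumpMeasure m J, q z.2 := by
  have h := ae_jumpMeasure_fst (J := J) hq
  rw [← hsymm] at h
  exact ae_of_ae_map measurable_swap.aemeasurable h

lemma measurable_modified_integrand {u : E → ℝ} (hu : Measurable u) :
    Measurable fun z : E × E => ENNReal.ofReal ((u z.2 - u z.1) ^ 2 * chi (u z.1) (u z.2)) := by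
  have := measurable_chi.comp ((hu.comp measurable_fst).prodMk (hu.comp measurable_snd))
  exact (((hu.comp measurable_snd).sub (hu.comp measurable_fst)).pow_const 2 |>.mul
    this).ennreal_ofReal

lemma modifiedCarreDuChamp_le (u : E → ℝ) (x : E) :
    modifiedCarreDuChamp J u x ≤ 2 * carreDuChamp J u x := by
  rw [carreDuChamp, ← mul_assoc, ENNReal.mul_inv_cancel (by simp) (by simp), one_mul]
  refine lintegral_mono fun y => ENNReal.ofReal_le_ofReal ?_
  exact mul_le_of_le_one_right (sq_nonneg _) (chi_le_one _ _)

variable {P : Kernel (ℝ≥0 × E) E}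

lemma squareGTilde_le (f : E → ℝ) (x : E) : squareGTilde P J f x ≤ 2 * squareG P J f x := by
  rw [squareGTilde, squareG]
  calc _ ≤
        (2 * ∫⁻ t : ℝ in Set.Ioi 0, carreDuChamp J (semigroup P t.toNNReal f) x) ^ (1 / 2 : ℝ) := by
        refine ENNReal.rpow_le_rpow ?_ (by norm_num)
        rw [← lintegral_const_mul' _ _ (by simp)]
        exact lintegral_mono fun t => modifiedCarreDuChamp_le _ _
    _ = 2 ^ (1 / 2 : ℝ) * _ := ENNReal.mul_rpow_of_nonneg _ _ (by norm_num)
    _ ≤ 2 * _ := by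
        refine mul_le_mul_left ?_ _
        calc (2 : ℝ≥0∞) ^ (1 / 2 : ℝ) ≤ 2 ^ (1 : ℝ) :=
              ENNReal.rpow_le_rpow_of_exponent_le (by norm_num) (by norm_num)
          _ = 2 := ENNReal.rpow_one 2

lemma eLpNorm_squareGTilde_le (hp : 2 ≤ p) (f : E → ℝ) :
    eLpNorm (squareGTilde P J f) (ENNReal.ofReal p) m
      ≤ 2 * eLpNorm (squareG P J f) (ENNReal.ofReal p) m := by
  have hp0 := ofReal_ne_zero_of_two_le hp
  have hpp : 0 < p := by linarith
  rw [eLpNorm_eq_lintegral_rpow_enorm_toReal hp0 ENNReal.ofReal_ne_top,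
    eLpNorm_eq_lintegral_rpow_enorm_toReal hp0 ENNReal.ofReal_ne_top,
    ENNReal.toReal_ofReal hpp.le]
  simp only [enorm_eq_self]
  have e : (2 : ℝ≥0∞) = (2 ^ p) ^ (1 / p) := by
    rw [← ENNReal.rpow_mul, mul_one_div_cancel hpp.ne', ENNReal.rpow_one]
  rw [e, ← ENNReal.mul_rpow_of_nonneg _ _ (by positivity)]
  refine ENNReal.rpow_le_rpow ?_ (by positivity)
  rw [← lintegral_const_mul' _ _ (ENNReal.rpow_ne_top_of_nonneg hpp.le (by simp))]
  refine lintegral_mono fun x => ?_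
  rw [← ENNReal.mul_rpow_of_nonneg _ _ hpp.le]
  exact ENNReal.rpow_le_rpow (squareGTilde_le f x) hpp.le

end JumpMeasure

section Jump
variable {E : Type*} [MetricSpace E] [TopologicalSpace.SeparableSpace E] [MeasurableSpace E]
  [BorelSpace E] {m : Measure E} {J : Kernel E E} {p : ℝ}

lemma measurableSet_diagonal_compl : MeasurableSet ((Set.diagonal E)ᶜ) := by
  have := UniformSpace.secondCountable_of_separable E
  exact isClosed_diagonal.measurableSet.compl

lemma lintegral_jumpMeasure [SFinite m] [IsSFiniteKernel J] {F : E × E → ℝ≥0∞} (hF : Measurable F) :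
    ∫⁻ z, F z ∂jumpMeasure m J = ∫⁻ x, ∫⁻ y in {x}ᶜ, F (x, y) ∂J x ∂m := by
  rw [jumpMeasure, ← lintegral_indicator measurableSet_diagonal_compl,
    Measure.lintegral_compProd (hF.indicator measurableSet_diagonal_compl)]
  refine lintegral_congr fun x => ?_
  rw [← lintegral_indicator (measurableSet_singleton x).compl]
  refine lintegral_congr fun y => ?_
  by_cases h : y = x
  · subst h; simp
  · have : (x, y) ∈ (Set.diagonal E)ᶜ := fun h' => h (Eq.symm h')
    rw [Set.indicator_of_mem this, Set.indicator_of_mem (by simpa using h)]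

/-- The energy of `u |u|^(p/2-1)` is bounded by the weighted integral of the modified carré du
champ of `u`. -/
lemma DirichletForm.IsPureJump.ofReal_form_le [SFinite m] [IsSFiniteKernel J] (hp : 2 ≤ p)
    {𝓔 : DirichletForm m} (hJ : 𝓔.IsPureJump J) {u : E → ℝ} (hu : Measurable u) (w : 𝓔.domain)
    (hw : (w : Lp ℝ 2 m) =ᵐ[m] fun x => oddPow (p / 2 - 1) (u x)) :
    ENNReal.ofReal (𝓔.form w w) ≤ ENNReal.ofReal ((p / 2) ^ 2)
      * ∫⁻ x, ‖u x‖ₑ ^ (p - 2) * modifiedCarreDuChamp J u x ∂m := by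
  let G : E × E → ℝ≥0∞ := fun z =>
    ‖u z.1‖ₑ ^ (p - 2) * ENNReal.ofReal ((u z.2 - u z.1) ^ 2 * chi (u z.1) (u z.2))
  have hG : Measurable G :=
    ((hu.comp measurable_fst).enorm.pow_const _).mul (measurable_modified_integrand hu)
  have hGint : ∫⁻ z, G z ∂jumpMeasure m J
      = ∫⁻ x, ‖u x‖ₑ ^ (p - 2) * modifiedCarreDuChamp J u x ∂m := by
    rw [lintegral_jumpMeasure hG]
    refine lintegral_congr fun x => ?_
    have hm : Measurable fun y => ENNReal.ofReal ((u y - u x) ^ 2 * chi (u x) (u y)) :=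
      (measurable_modified_integrand hu).comp measurable_prodMk_left
    rw [modifiedCarreDuChamp, ← lintegral_const_mul _ hm]
  have hGswap : ∫⁻ z, G z.swap ∂jumpMeasure m J = ∫⁻ z, G z ∂jumpMeasure m J := by
    rw [← lintegral_map hG measurable_swap, hJ.symm]
  have hpt : ∀ᵐ z ∂jumpMeasure m J,
      ENNReal.ofReal (((w : Lp ℝ 2 m) z.2 - (w : Lp ℝ 2 m) z.1)
        * ((w : Lp ℝ 2 m) z.2 - (w : Lp ℝ 2 m) z.1))
      ≤ ENNReal.ofReal ((p / 2) ^ 2) * (G z + G z.swap) := by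
    filter_upwards [ae_jumpMeasure_fst hw, ae_jumpMeasure_snd hJ.symm hw] with z h1 h2
    rw [h1, h2, ← sq]
    refine (ENNReal.ofReal_le_ofReal (sq_oddPow_sub_le_chi hp (u z.1) (u z.2))).trans_eq ?_
    have e : ∀ a : ℝ, ‖a‖ₑ ^ (p - 2) = ENNReal.ofReal (|a| ^ (p - 2)) := fun a => by
      rw [Real.enorm_eq_ofReal_abs, ENNReal.ofReal_rpow_of_nonneg (abs_nonneg _) (by linarith)]
    have c1 := chi_nonneg (u z.1) (u z.2)
    have c2 := chi_nonneg (u z.2) (u z.1)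
    rw [ENNReal.ofReal_mul (by positivity), ENNReal.ofReal_add (by positivity) (by positivity),
      ENNReal.ofReal_mul (p := |u z.1| ^ (p - 2)) (by positivity),
      ENNReal.ofReal_mul (p := |u z.2| ^ (p - 2)) (by positivity)]
    simp only [G, Prod.fst_swap, Prod.snd_swap, e]
  have hsw : Measurable fun z : E × E => G z.swap := hG.comp measurable_swap
  have hadd : Measurable fun z : E × E => G z + G z.swap := hG.add hsw
  rw [hJ.form_eq w w, ENNReal.ofReal_mul (by norm_num),
    ofReal_integral_eq_lintegral_ofReal (hJ.integrable w w)
      (ae_of_all _ fun z => mul_self_nonneg _)]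
  calc _ ≤ ENNReal.ofReal (1 / 2) *
        ∫⁻ z, ENNReal.ofReal ((p / 2) ^ 2) * (G z + G z.swap) ∂jumpMeasure m J :=
        mul_le_mul_right (lintegral_mono_ae hpt) _
    _ = ENNReal.ofReal (1 / 2) * (ENNReal.ofReal ((p / 2) ^ 2) *
        (2 * ∫⁻ z, G z ∂jumpMeasure m J)) := by
        rw [lintegral_const_mul _ hadd, lintegral_add_left hG, hGswap, ← two_mul]
    _ = (ENNReal.ofReal (1 / 2) * 2) * (ENNReal.ofReal ((p / 2) ^ 2) *
        ∫⁻ z, G z ∂jumpMeasure m J) := by ring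
    _ = _ := by
        rw [hGint, ENNReal.ofReal_div_of_pos two_pos, ENNReal.ofReal_one]
        simp only [ENNReal.ofReal_ofNat, one_div]
        rw [ENNReal.inv_mul_cancel (by simp) (by simp), one_mul]

lemma measurable_modifiedCarreDuChamp [IsSFiniteKernel J] {u : ℝ × E → ℝ} (hu : Measurable u) :
    Measurable fun z : ℝ × E => modifiedCarreDuChamp J (fun x => u (z.1, x)) z.2 := by
  let J' : Kernel (ℝ × E) E := J.comap Prod.snd measurable_snd
  let F : (ℝ × E) × E → ℝ≥0∞ := fun q =>
    ENNReal.ofReal ((u (q.1.1, q.2) - u q.1) ^ 2 * chi (u q.1) (u (q.1.1, q.2)))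
  have hu2 : Measurable fun q : (ℝ × E) × E => u (q.1.1, q.2) := by fun_prop
  have hu1 : Measurable fun q : (ℝ × E) × E => u q.1 := by fun_prop
  have hF : Measurable F :=
    ((hu2.sub hu1).pow_const 2 |>.mul (measurable_chi.comp (hu1.prodMk hu2))).ennreal_ofReal
  let D : Set ((ℝ × E) × E) := (fun q => (q.1.2, q.2)) ⁻¹' (Set.diagonal E)ᶜ
  have hD : MeasurableSet D := (by fun_prop : Measurable fun q : (ℝ × E) × E => (q.1.2, q.2))
    measurableSet_diagonal_compl
  have h := Measurable.lintegral_kernel_prod_right' (κ := J') (hF.indicator hD)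
  convert h using 2 with z
  rw [modifiedCarreDuChamp, ← lintegral_indicator (measurableSet_singleton _).compl]
  refine lintegral_congr fun y => ?_
  by_cases hy : y = z.2
  · subst hy
    have : (z, z.2) ∉ D := fun h => h rfl
    rw [Set.indicator_of_notMem this, Set.indicator_of_notMem (by simp)]
  · have : (z, y) ∈ D := fun h' => hy (Eq.symm h')
    rw [Set.indicator_of_mem this, Set.indicator_of_mem (by simpa using hy)]

variable {P : Kernel (ℝ≥0 × E) E}

/-- The square function does not depend on the version of `f`. -/
lemma squareGTilde_congr_ae [SigmaFinite m] [IsSFiniteKernel J]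
    (hP : IsSymmTransitionFunction m P)
    (hsymm : (jumpMeasure m J).map Prod.swap = jumpMeasure m J) {f g : E → ℝ} (hfg : f =ᵐ[m] g) :
    squareGTilde P J f =ᵐ[m] squareGTilde P J g := by
  have _ := hP.isFiniteKernel
  set N := toMeasurable m {x | ¬f x = g x} with hNdef
  have hN : MeasurableSet N := measurableSet_toMeasurable _ _
  have hN0 : m N = 0 := by rw [hNdef, measure_toMeasurable]; exact hfg
  have hsg : ∀ t x, P (t, x) N = 0 → semigroup P t f x = semigroup P t g x := fun t x h => by
    refine integral_congr_ae ?_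
    exact measure_mono_null (subset_toMeasurable m _) h
  have hPN : Measurable fun q : ℝ × E => P (q.1.toNNReal, q.2) N :=
    (P.measurable_coe hN).comp (by fun_prop)
  let J' : Kernel (E × ℝ) E := J.comap Prod.fst measurable_fst
  let B : Set ((E × ℝ) × E) := {q | q.2 ≠ q.1.1 ∧ P (q.1.2.toNNReal, q.2) N ≠ 0}
  have hB : MeasurableSet B := by
    refine MeasurableSet.inter ?_ ?_
    · exact (by fun_prop : Measurable fun q : (E × ℝ) × E => (q.2, q.1.1))
        measurableSet_diagonal_compl
    · exact (hPN.comp (by fun_prop : Measurable fun q : (E × ℝ) × E => (q.1.2, q.2)))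
        (measurableSet_singleton 0).compl
  have hJB : Measurable fun z : E × ℝ => J z.1 {y | y ≠ z.1 ∧ P (z.2.toNNReal, y) N ≠ 0} :=
    Kernel.measurable_kernel_prodMk_left (κ := J') hB
  have hgood : ∀ᵐ x ∂m, ∀ᵐ t ∂volume.restrict (Set.Ioi (0 : ℝ)),
      P (t.toNNReal, x) N = 0 ∧ J x {y | y ≠ x ∧ P (t.toNNReal, y) N ≠ 0} = 0 := by
    rw [Measure.ae_ae_comm]
    · refine ae_of_all _ fun t => ?_
      have h1 := (hP.slice t.toNNReal).ae_null hN0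
      have h2 := ae_jumpMeasure_snd (J := J) hsymm h1
      rw [jumpMeasure, ae_restrict_iff' measurableSet_diagonal_compl] at h2
      filter_upwards [h1, Measure.ae_ae_of_ae_compProd h2] with x hx1 hx2
      refine ⟨hx1, measure_mono_null (fun y hy => ?_) hx2⟩
      exact fun h => hy.2 (h fun h' => hy.1 (Eq.symm h'))
    · refine MeasurableSet.inter ?_ (hJB (measurableSet_singleton 0))
      exact (hPN.comp measurable_swap) (measurableSet_singleton 0)
  filter_upwards [hgood] with x hx
  rw [squareGTilde, squareGTilde]
  congr 1
  refine lintegral_congr_ae ?_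
  filter_upwards [hx] with t ht
  rw [modifiedCarreDuChamp, modifiedCarreDuChamp]
  refine setLIntegral_congr_fun_ae (measurableSet_singleton x).compl ?_
  have h3 : ∀ᵐ y ∂J x, ¬(y ≠ x ∧ P (t.toNNReal, y) N ≠ 0) := by
    rw [ae_iff]; simpa using ht.2
  filter_upwards [h3] with y hy hyx
  have hy' : P (t.toNNReal, y) N = 0 := by
    by_contra h
    exact hy ⟨hyx, h⟩
  rw [hsg _ _ ht.1, hsg _ _ hy']

end Jump

section HalfPower
variable {E : Type*} [MeasurableSpace E] {m : Measure E} {p : ℝ} {f : E → ℝ}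

lemma enorm_abs_rpow {q : ℝ} (hq : 0 ≤ q) (x : ℝ) : ‖|x| ^ q‖ₑ = ‖x‖ₑ ^ q := by
  rw [Real.enorm_of_nonneg (by positivity), ← ENNReal.ofReal_rpow_of_nonneg (abs_nonneg _) hq,
    ← Real.enorm_eq_ofReal_abs]

lemma enorm_abs_rpow_half_sq (hp : 2 ≤ p) (x : ℝ) : ‖|x| ^ (p / 2)‖ₑ ^ 2 = ‖x‖ₑ ^ p := by
  rw [enorm_abs_rpow (by linarith), ← ENNReal.rpow_two, ← ENNReal.rpow_mul]
  congr 1; ring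

lemma memLp_abs_rpow_half (hp : 2 ≤ p) (hfm : Measurable f) (hf : MemLp f (ENNReal.ofReal p) m) :
    MemLp (fun x => |f x| ^ (p / 2)) 2 m := by
  refine ⟨(hfm.norm.pow_const (p / 2)).aestronglyMeasurable, ?_⟩
  rw [eLpNorm_lt_top_iff_lintegral_rpow_enorm_lt_top (by simp) (by simp)]
  simp only [ENNReal.toReal_ofNat, ENNReal.rpow_two, enorm_abs_rpow_half_sq hp]
  rw [← eLpNorm_rpow_eq hp]
  exact ENNReal.rpow_lt_top_of_nonneg (by linarith) hf.2.ne

lemma IsSymmTransitionFunction.ae_enorm_semigroup_rpow_le [SigmaFinite m]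
    {P : Kernel (ℝ≥0 × E) E} (hP : IsSymmTransitionFunction m P)
    (hS : IsSymmContractionSemigroup hP.opL2) (hp : 2 ≤ p) (hfm : Measurable f)
    (hf : MemLp f (ENNReal.ofReal p) m) (t : ℝ≥0) :
    ∀ᵐ x ∂m, ‖semigroup P t f x‖ₑ ^ p ≤ dyadicMaxSq P (fun x => |f x| ^ (p / 2)) x := by
  have hgm : Measurable fun x => |f x| ^ (p / 2) := hfm.norm.pow_const (p / 2)
  filter_upwards [hP.ae_sq_le_dyadicMaxSq hS (fun x => by positivity) hgm
    (memLp_abs_rpow_half hp hfm hf) t] with x hx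
  refine le_trans ?_ hx
  have h2 : 0 ≤ p / 2 := by linarith
  have e : ∀ a : ℝ≥0∞, a ^ p = (a ^ (p / 2)) ^ 2 := fun a => by
    rw [← ENNReal.rpow_two, ← ENNReal.rpow_mul]; congr 1; ring
  rw [e]
  refine pow_le_pow_left' ?_ 2
  calc ‖semigroup P t f x‖ₑ ^ (p / 2) ≤ (∫⁻ y, ‖f y‖ₑ ∂P (t, x)) ^ (p / 2) :=
        ENNReal.rpow_le_rpow (enorm_integral_le_lintegral_enorm _) h2
    _ ≤ ∫⁻ y, ‖f y‖ₑ ^ (p / 2) ∂P (t, x) :=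
        (hP.slice t).lintegral_rpow_le hfm.enorm (by linarith) x
    _ = ∫⁻ y, ‖|f y| ^ (p / 2)‖ₑ ∂P (t, x) := by simp_rw [enorm_abs_rpow h2]

end HalfPower

/-- The constant in the estimate of `‖f‖_p ^ p` by `‖f‖_p ^ (p-2) * ‖G̃‖_p ^ 2`. -/
noncomputable def squareFunctionConst (p : ℝ) : ℝ≥0∞ :=
  ENNReal.ofReal (8 * p * (p - 1)) * (ENNReal.ofReal ((p / 2) ^ 2) * 185 ^ ((p - 2) / p))

lemma squareFunctionConst_ne_top {p : ℝ} (hp : 2 ≤ p) : squareFunctionConst p ≠ ∞ := by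
  refine ENNReal.mul_ne_top ENNReal.ofReal_ne_top (ENNReal.mul_ne_top ENNReal.ofReal_ne_top ?_)
  exact ENNReal.rpow_ne_top_of_nonneg (div_nonneg (by linarith) (by linarith)) (by simp)

section SquareFunction
variable {E : Type*} [MetricSpace E] [TopologicalSpace.SeparableSpace E] [MeasurableSpace E]
  [BorelSpace E] {m : Measure E} [SigmaFinite m] {J : Kernel E E} [IsSFiniteKernel J]
  {P : Kernel (ℝ≥0 × E) E} {p : ℝ} {f : E → ℝ}

/-- The time integral of the weighted modified carré du champ is controlled by the maximal
function and the square function. -/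
lemma lintegral_weighted_carreDuChamp_le (hP : IsSymmTransitionFunction m P)
    (hS : IsSymmContractionSemigroup hP.opL2) (hp : 2 ≤ p) (hfm : Measurable f)
    (hf : MemLp f (ENNReal.ofReal p) m) :
    ∫⁻ t : ℝ in Set.Ioi 0, ∫⁻ x, ‖semigroup P t.toNNReal f x‖ₑ ^ (p - 2)
        * modifiedCarreDuChamp J (semigroup P t.toNNReal f) x ∂m
      ≤ 185 ^ ((p - 2) / p) * (eLpNorm f (ENNReal.ofReal p) m ^ (p - 2)
        * eLpNorm (squareGTilde P J f) (ENNReal.ofReal p) m ^ (2 : ℝ)) := by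
  have hpp : 0 < p := by linarith
  have ha : 0 ≤ (p - 2) / p := div_nonneg (by linarith) hpp.le
  have hb : 0 ≤ 2 / p := by positivity
  let g : E → ℝ := fun x => |f x| ^ (p / 2)
  have hgm : Measurable g := hfm.norm.pow_const (p / 2)
  let F := dyadicMaxSq P g
  have hF : Measurable F := hP.measurable_dyadicMaxSq hgm
  let Γ : ℝ → E → ℝ≥0∞ := fun t => modifiedCarreDuChamp J (semigroup P t.toNNReal f)
  have hΓ : Measurable fun z : ℝ × E => Γ z.1 z.2 :=
    measurable_modifiedCarreDuChamp (J := J) (u := fun z => semigroup P z.1.toNNReal f z.2)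
      ((hP.measurable_semigroup hfm).comp (by fun_prop : Measurable fun z : ℝ × E =>
        (z.1.toNNReal, z.2)))
  have hsq : ∀ x, squareGTilde P J f x ^ p = (∫⁻ t in Set.Ioi 0, Γ t x) ^ (p / 2) := fun x => by
    rw [squareGTilde, ← ENNReal.rpow_mul]; congr 1; ring
  have hInt : ∀ x, ∫⁻ t in Set.Ioi 0, Γ t x = (squareGTilde P J f x ^ p) ^ (2 / p) := fun x => by
    rw [hsq, ← ENNReal.rpow_mul, div_mul_div_cancel₀ two_ne_zero, div_self hpp.ne',
      ENNReal.rpow_one]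
  have hIm : Measurable fun x => ∫⁻ t in Set.Ioi 0, Γ t x :=
    (hΓ.comp measurable_swap).lintegral_prod_right'
  have hsm : Measurable fun x => squareGTilde P J f x ^ p := by
    simp_rw [hsq]; exact hIm.pow_const _
  have hY : ∫⁻ x, squareGTilde P J f x ^ p ∂m
      = eLpNorm (squareGTilde P J f) (ENNReal.ofReal p) m ^ p := by
    rw [eLpNorm_eq_lintegral_rpow_enorm_toReal (ofReal_ne_zero_of_two_le hp) ENNReal.ofReal_ne_top,
      ENNReal.toReal_ofReal hpp.le, ← ENNReal.rpow_mul, one_div_mul_cancel hpp.ne',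
      ENNReal.rpow_one]
    simp only [enorm_eq_self]
  have hFX : ∫⁻ x, F x ∂m ≤ 185 * eLpNorm f (ENNReal.ofReal p) m ^ p := by
    refine (hP.lintegral_dyadicMaxSq_le hS (fun x => by positivity) hgm
      (memLp_abs_rpow_half hp hfm hf)).trans_eq ?_
    simp only [g, enorm_abs_rpow_half_sq hp]
    rw [eLpNorm_rpow_eq hp]
  calc _ ≤ ∫⁻ t : ℝ in Set.Ioi 0, ∫⁻ x, F x ^ ((p - 2) / p) * Γ t x ∂m := by
        refine lintegral_mono fun t => lintegral_mono_ae ?_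
        filter_upwards [hP.ae_enorm_semigroup_rpow_le hS hp hfm hf t.toNNReal] with x hx
        refine mul_le_mul_left ?_ _
        have := ENNReal.rpow_le_rpow hx ha
        rwa [← ENNReal.rpow_mul, mul_div_cancel₀ _ hpp.ne'] at this
    _ = ∫⁻ x, (∫⁻ t : ℝ in Set.Ioi 0, F x ^ ((p - 2) / p) * Γ t x) ∂m := by
        refine lintegral_lintegral_swap (Measurable.aemeasurable ?_)
        exact ((hF.comp measurable_snd).pow_const _).mul hΓ
    _ = ∫⁻ x, F x ^ ((p - 2) / p) * (squareGTilde P J f x ^ p) ^ (2 / p) ∂m := by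
        refine lintegral_congr fun x => ?_
        have hx : Measurable fun t => Γ t x := hΓ.comp measurable_prodMk_right
        rw [lintegral_const_mul _ hx, hInt]
    _ ≤ (∫⁻ x, F x ∂m) ^ ((p - 2) / p) * (∫⁻ x, squareGTilde P J f x ^ p ∂m) ^ (2 / p) :=
        ENNReal.lintegral_mul_norm_pow_le hF.aemeasurable hsm.aemeasurable ha hb
          (by rw [← add_div, sub_add_cancel, div_self hpp.ne'])
    _ ≤ (185 * eLpNorm f (ENNReal.ofReal p) m ^ p) ^ ((p - 2) / p)
        * (eLpNorm (squareGTilde P J f) (ENNReal.ofReal p) m ^ p) ^ (2 / p) := by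
        rw [hY]
        exact mul_le_mul_left (ENNReal.rpow_le_rpow hFX ha) _
    _ = _ := by
        rw [ENNReal.mul_rpow_of_nonneg _ _ ha, ← ENNReal.rpow_mul, ← ENNReal.rpow_mul,
          mul_div_cancel₀ _ hpp.ne', mul_div_cancel₀ _ hpp.ne', mul_assoc]

lemma eLpNorm_rpow_le_squareGTilde {𝓔 : DirichletForm m} (hJ : 𝓔.IsPureJump J)
    (hP : IsSymmTransitionFunction m P) (h𝓔 : 𝓔.IsAssociated P)
    (hstab : StronglyStable m P (ENNReal.ofReal p)) (hp : 2 ≤ p) (hfm : Measurable f)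
    (hf : MemLp f (ENNReal.ofReal p) m) :
    eLpNorm f (ENNReal.ofReal p) m ^ p ≤ squareFunctionConst p
      * (eLpNorm f (ENNReal.ofReal p) m ^ (p - 2)
        * eLpNorm (squareGTilde P J f) (ENNReal.ofReal p) m ^ (2 : ℝ)) := by
  have hpp : 0 < p := by linarith
  have hS := hP.isSymmContractionSemigroup h𝓔
  rw [← ENNReal.le_rpow_inv_iff hpp]
  refine hP.eLpNorm_le_of_semigroup hp hf hS fun h hh => ?_
  rw [ENNReal.le_rpow_inv_iff hpp]
  have hform : ∀ t : ℝ, ∀ ht : hP.halfPowFlow hp hf t.toNNReal ∈ 𝓔.domain,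
      ENNReal.ofReal (𝓔.form ⟨_, ht⟩ ⟨_, ht⟩) ≤ ENNReal.ofReal ((p / 2) ^ 2) *
        ∫⁻ x, ‖semigroup P t.toNNReal f x‖ₑ ^ (p - 2)
          * modifiedCarreDuChamp J (semigroup P t.toNNReal f) x ∂m := fun t ht =>
    hJ.ofReal_form_le hp ((hP.measurable_semigroup hfm).comp measurable_prodMk_left) ⟨_, ht⟩
      (coeFn_halfPow hp (hP.memLp_semigroup hp hf t.toNNReal))
  refine (hP.eLpNorm_semigroup_rpow_le hp hf hfm h𝓔 hstab hform hh).trans ?_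
  rw [lintegral_const_mul' _ _ ENNReal.ofReal_ne_top, squareFunctionConst, mul_assoc
    (ENNReal.ofReal _), mul_assoc (ENNReal.ofReal _) (185 ^ ((p - 2) / p))]
  exact mul_le_mul_right (mul_le_mul_right (lintegral_weighted_carreDuChamp_le hP hS hp hfm hf) _) _

/-- The lower bound for the square function `G̃`. -/
lemma eLpNorm_le_squareGTilde {𝓔 : DirichletForm m} (hJ : 𝓔.IsPureJump J)
    (hP : IsSymmTransitionFunction m P) (h𝓔 : 𝓔.IsAssociated P)
    (hstab : StronglyStable m P (ENNReal.ofReal p)) (hp : 2 ≤ p)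
    (hf : MemLp f (ENNReal.ofReal p) m) :
    eLpNorm f (ENNReal.ofReal p) m ≤ ((squareFunctionConst p).toNNReal + 1 : ℝ≥0)
      * eLpNorm (squareGTilde P J f) (ENNReal.ofReal p) m := by
  have hae : f =ᵐ[m] hf.1.mk f := hf.1.ae_eq_mk
  have hmk := hf.1.stronglyMeasurable_mk.measurable
  have hf' : MemLp (hf.1.mk f) (ENNReal.ofReal p) m := (memLp_congr_ae hae).1 hf
  have key := eLpNorm_rpow_le_squareGTilde hJ hP h𝓔 hstab hp hmk hf'
  rw [← eLpNorm_congr_ae hae, ← eLpNorm_congr_ae (squareGTilde_congr_ae hP hJ.symm hae)] at key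
  generalize eLpNorm (squareGTilde P J f) (ENNReal.ofReal p) m = Y at key ⊢
  have hX := hf.2.ne
  generalize eLpNorm f (ENNReal.ofReal p) m = X at key hX ⊢
  rcases eq_or_ne X 0 with rfl | hX0
  · exact zero_le
  have hsplit : X ^ p = X ^ (p - 2) * X ^ (2 : ℝ) := by
    rw [← ENNReal.rpow_add _ _ hX0 hX, sub_add_cancel]
  rw [hsplit, mul_left_comm] at key
  have h1 := (ENNReal.mul_le_mul_iff_right (by simp [hX0, hX])
    (ENNReal.rpow_ne_top_of_nonneg (by linarith) hX)).1 key
  rw [← ENNReal.rpow_le_rpow_iff (z := 2) two_pos, ENNReal.mul_rpow_of_nonneg _ _ zero_le_two]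
  refine h1.trans (mul_le_mul_left ?_ _)
  rw [← ENNReal.coe_toNNReal (squareFunctionConst_ne_top hp), ENNReal.rpow_two,
    ENNReal.toNNReal_coe]
  norm_cast
  nlinarith [zero_le (a := (squareFunctionConst p).toNNReal)]

end SquareFunction

theorem theorem4p2 (p : ℝ) (hp : 2 ≤ p) :
    ∃ C : ℝ≥0, 0 < C ∧
      ∀ (E : Type*) [MetricSpace E] [LocallyCompactSpace E] [TopologicalSpace.SeparableSpace E]
        [MeasurableSpace E] [BorelSpace E]
        (m : Measure E) [IsLocallyFiniteMeasure m] [m.IsOpenPosMeasure]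
        (𝓔 : DirichletForm m) (J : Kernel E E) [IsSFiniteKernel J] (P : Kernel (ℝ≥0 × E) E),
        𝓔.IsRegular → 𝓔.IsPureJump J → IsSymmTransitionFunction m P → 𝓔.IsAssociated P →
        StronglyStable m P (ENNReal.ofReal p) →
        ∀ f : E → ℝ, MemLp f (ENNReal.ofReal p) m →
          eLpNorm f (ENNReal.ofReal p) m
              ≤ C * eLpNorm (squareGTilde P J f) (ENNReal.ofReal p) m ∧
          (2 < p → eLpNorm f (ENNReal.ofReal p) m
              ≤ C * eLpNorm (squareG P J f) (ENNReal.ofReal p) m) := by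
  refine ⟨2 * ((squareFunctionConst p).toNNReal + 1), by positivity, ?_⟩
  intro E _ _ _ _ _ m _ _ 𝓔 J _ P _ hJ hP h𝓔 hstab f hf
  have := UniformSpace.secondCountable_of_separable E
  have h := eLpNorm_le_squareGTilde hJ hP h𝓔 hstab hp hf
  constructor
  · refine h.trans (mul_le_mul_left ?_ _)
    rw [ENNReal.coe_le_coe, two_mul]
    exact le_self_add
  · intro _
    refine h.trans ((mul_le_mul_right (eLpNorm_squareGTilde_le hp f) _).trans_eq ?_)
    rw [ENNReal.coe_mul, ENNReal.coe_ofNat]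
    ring
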